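/- Let $n\ge 2$, let $\Lambda=\bigoplus_{i=1}^n\mathbb{Z}\epsilon_i$ be the standard lattice in Euclidean space $\mathbb{R}^n$, and let $\mathcal A=\mathbb{C}[x_1^{\pm1},\dots,x_n^{\pm1}]$ with monomials $x^\lambda=\prod_i x_i^{\lambda_i}$ $(\lambda\in\Lambda)$. *Parameters.* Let $q^{1/2},t_0,t,t_n,t_0^\vee,t_n^\vee$ be nonzero complex numbers and $q=(q^{1/2})^2$; put $t_i=t$ for $0<i<n$. Assume that they are generic in the following sense: $q$ is not a root of unity, $t^{2k}\notin q^{\mathbb Z}$ for $1\le k\le n-1$, and $(t_0t_n)^2t^{2k}\notin q^{\mathbb Z}$ for $0\le k\le 2n-2$. *Orders.* Let $W$ be the group of permutations and sign changes of the coordinates. Call $\lambda$ dominant if $\lambda_1\ge\dots\ge\lambda_n\ge0$, and let $\lambda^+$ be the unique dominant element of $W\lambda$. Write $\lambda\le\mu$ if $\mu-\lambda$ is a linear combination with non-negative integer coefficients of $\epsilon_1-\epsilon_2,\dots,\epsilon_{n-1}-\epsilon_n,\epsilon_n$. Write $\lambda\preceq\mu$ if $\lambda^+<\mu^+$, or if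 $\lambda^+=\mu^+$ and $\lambda\le\mu$; and $\lambda\prec\mu$ if $\lambda\preceq\mu$ and $\lambda\ne\mu$. *Affine Weyl group.* On the space $\widehat V=\mathbb{R}^n\oplus\mathbb{R}\delta$ of affine linear functions on $\mathbb R^n$ ($\delta$ is the constant function $1$, and the scalar product is extended to $\widehat V$ with $\delta$ in its radical), let $a_0=\delta-2\epsilon_1$, $a_i=\epsilon_i-\epsilon_{i+1}$ $(0<i<n)$, $a_n=2\epsilon_n$, let $s_i(g)=g-\frac{2\langle g,a_i\rangle}{\langle a_i,a_i\rangle}a_i$, and let $\mathcal W$ be the group generated by $s_0,\dots,s_n$. It contains the translations $\tau(\lambda)f=f+\langle\lambda,f\rangle\delta$ $(\lambda\in\Lambda)$. *$Y$-operators.* Let $s_i$ act on $\mathcal A$ linearly by $s_i(x^\lambda)=x^{s_i\lambda}$, where $x^{\mu+c\delta}=q^{c}x^\mu$. Let $T_i=t_i+t_i^{-1}v_i(x)(s_i-\mathrm{id})$ on $\mathcal A$ for $i=0,\dots,n$, where $$v_0=\frac{(1-t_0t_0^\vee q^{1/2}x_1^{-1})(1+t_0(t_0^\vee)^{-1}q^{1/2}x_1^{-1})}{1-qx_1^{-2}},\qquad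 v_n=\frac{(1-t_nt_n^\vee x_n)(1+t_n(t_n^\vee)^{-1}x_n)}{1-x_n^2},$$ and $v_i=\frac{1-t^2x_ix_{i+1}^{-1}}{1-x_ix_{i+1}^{-1}}$ for $0<i<n$. For $w\in\mathcal W$ with a reduced expression $w=s_{i_1}\cdots s_{i_r}$ put $T_w=T_{i_1}\cdots T_{i_r}$ (independent of the reduced expression). Put $Y^\lambda=T_{\tau(\lambda)}$ for dominant $\lambda$, $Y^\lambda=Y^\mu(Y^\nu)^{-1}$ for $\lambda=\mu-\nu$ with $\mu,\nu$ dominant (independent of $\mu,\nu$), and $f(Y)=\sum_\lambda c_\lambda Y^\lambda$ for $f=\sum_\lambda c_\lambda x^\lambda\in\mathcal A$. *Spectrum.* Let $\varepsilon(m)=1$ for integers $m\ge0$ and $\varepsilon(m)=-1$ for $m<0$. For $\lambda\in\Lambda$ put $\rho_l(\lambda)=\sum_i\varepsilon(2\lambda_i)\epsilon_i$ and $\rho_m(\lambda)=\sum_{i<j}\bigl(\varepsilon(\lambda_i-\lambda_j)(\epsilon_i-\epsilon_j)+\varepsilon(\lambda_i+\lambda_j)(\epsilon_i+\epsilon_j)\bigr)$,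 and let $\gamma_\lambda\in(\mathbb{C}\setminus\{0\})^n$ have coordinates $(\gamma_\lambda)_i=(t_0t_n)^{\rho_l(\lambda)_i}\,t^{\rho_m(\lambda)_i}\,q^{\lambda_i}$. **Theorem.** There exists a unique basis $\{P_\lambda\}_{\lambda\in\Lambda}$ of $\mathcal A$ over $\mathbb C$ such that, for all $\lambda\in\Lambda$: 1. $P_\lambda=x^\lambda+\sum_{\mu\prec\lambda}c_{\lambda,\mu}x^\mu$ for certain constants $c_{\lambda,\mu}\in\mathbb C$ (finitely many nonzero); 2. $f(Y)P_\lambda=f(\gamma_\lambda)P_\lambda$ for all $f\in\mathcal A$. -/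

import Mathlib

namespace Koornwinder

noncomputable section

/-! ### The weight lattice, simple roots and orders -/

/-- The weight lattice `Λ` of type `C_n`: the lattice `⊕ ℤ ε_i` in Euclidean `n`-space,
written in coordinates with respect to `ε_1, …, ε_n`. -/
abbrev Weight (n : ℕ) : Type := Fin n → ℤ

/-- The standard basis vector `ε_k`, with `k = 1, …, n` (it is `0` for `k` outside this range). -/
def eps (n k : ℕ) : Weight n := fun j => if (j : ℕ) + 1 = k then 1 else 0

/-- The gradient of the simple affine root `a_i`:
`a_0 = δ - 2ε_1`, `a_i = ε_i - ε_{i+1}` for `0 < i < n`, `a_n = 2ε_n`. -/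
def rootGrad {n : ℕ} (i : Fin (n + 1)) : Weight n :=
  if i = 0 then -(2 • eps n 1)
  else if i = Fin.last n then 2 • eps n n
  else eps n i - eps n (i + 1)

/-- The coefficient of `δ` in the simple affine root `a_i`. -/
def rootDelta {n : ℕ} (i : Fin (n + 1)) : ℤ := if i = 0 then 1 else 0

/-- The co-root of the gradient of `a_i`, namely `-ε_1` for `i = 0`, `ε_i - ε_{i+1}` for
`0 < i < n`, and `ε_n` for `i = n`. -/
def corootGrad {n : ℕ} (i : Fin (n + 1)) : Weight n :=
  if i = 0 then -eps n 1
  else if i = Fin.last n then eps n n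
  else eps n i - eps n (i + 1)

/-- The pairing `⟨λ, a_i^∨⟩`. -/
def pairing {n : ℕ} (lam : Weight n) (i : Fin (n + 1)) : ℤ := lam ⬝ᵥ corootGrad i

/-- Dominant weights, i.e. `λ_1 ≥ λ_2 ≥ ⋯ ≥ λ_n ≥ 0`. -/
def IsDominant {n : ℕ} (lam : Weight n) : Prop := Antitone lam ∧ ∀ j, 0 ≤ lam j

/-- Two weights lie in the same orbit of the finite Weyl group `W` of permutations and sign
changes of the coordinates. -/
def SameOrbit {n : ℕ} (lam mu : Weight n) : Prop :=
  ∃ (σ : Equiv.Perm (Fin n)) (u : Fin n → ℤˣ), ∀ j, mu j = (u j : ℤ) * lam (σ j)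

/-- The dominant weight `λ⁺` in the `W`-orbit of `λ`: sort the `|λ_j|` in decreasing order. -/
def domRep {n : ℕ} (lam : Weight n) : Weight n :=
  fun j => |lam (Tuple.sort (fun k => -|lam k|) j)|

theorem domRep_isDominant {n : ℕ} (lam : Weight n) : IsDominant (domRep lam) := by
  refine ⟨fun i j hij => ?_, fun j => abs_nonneg _⟩
  have h := Tuple.monotone_sort (fun k => -|lam k|) hij
  simpa [domRep] using h

theorem domRep_sameOrbit {n : ℕ} (lam : Weight n) : SameOrbit lam (domRep lam) := by
  refine ⟨Tuple.sort (fun k => -|lam k|),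
    fun j => if 0 ≤ lam (Tuple.sort (fun k => -|lam k|) j) then 1 else -1, fun j => ?_⟩
  by_cases h : 0 ≤ lam (Tuple.sort (fun k => -|lam k|) j)
  · simp [domRep, h, abs_of_nonneg h]
  · simp [domRep, h, abs_of_neg (not_le.mp h)]

theorem domRep_unique {n : ℕ} (lam mu : Weight n) (h : SameOrbit lam mu) (hd : IsDominant mu) :
    mu = domRep lam := by
  obtain ⟨σ, u, hu⟩ := h
  have h1 : mu = (fun k => |lam k|) ∘ σ := by
    funext j
    have h2 : mu j = |mu j| := (abs_of_nonneg (hd.2 j)).symm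
    have h3 : |((u j : ℤˣ) : ℤ)| = 1 := by
      rcases Int.units_eq_one_or (u j) with h | h <;> simp [h]
    rw [h2, hu j, abs_mul, h3, one_mul]
    rfl
  have h4 : Antitone ((fun k => |lam k|) ∘ σ) := h1 ▸ hd.1
  rw [h1]
  exact Tuple.unique_antitone h4 (domRep_isDominant lam).1

/-- `λ ≤ μ`: the difference `μ - λ` is a sum of simple co-roots `a_i^∨` (`i = 1, …, n`). -/
def DomLE {n : ℕ} (lam mu : Weight n) : Prop :=
  mu - lam ∈ AddSubmonoid.closure {c : Weight n | ∃ i : Fin (n + 1), i ≠ 0 ∧ c = corootGrad i}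

/-- `λ ≼ μ`: either `λ⁺ < μ⁺`, or `λ⁺ = μ⁺` and `λ ≤ μ`. -/
def OrdLE {n : ℕ} (lam mu : Weight n) : Prop :=
  (DomLE (domRep lam) (domRep mu) ∧ domRep lam ≠ domRep mu) ∨
    (domRep lam = domRep mu ∧ DomLE lam mu)

/-- `λ ≺ μ`. -/
def OrdLT {n : ℕ} (lam mu : Weight n) : Prop := OrdLE lam mu ∧ lam ≠ mu

/-! ### The affine Weyl group, acting on affine linear functions -/

/-- Affine linear functions `v + c δ` on Euclidean `n`-space, as pairs `(v, c)`. -/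
abbrev AffFun (n : ℕ) : Type := (Fin n → ℝ) × ℝ

/-- The simple affine root `a_i` as an affine linear function. -/
def simpleRoot {n : ℕ} (i : Fin (n + 1)) : AffFun n :=
  (fun j => (rootGrad i j : ℝ), (rootDelta i : ℝ))

/-- The reflection `s_f(g) = g - ⟨g, f^∨⟩ f`, where `f^∨ = 2 f / ⟨f, f⟩`. -/
def reflection {n : ℕ} (f : AffFun n) : Module.End ℝ (AffFun n) where
  toFun g := g - (2 * (g.1 ⬝ᵥ f.1) / (f.1 ⬝ᵥ f.1)) • f
  map_add' g h := by
    simp only [Prod.fst_add, add_dotProduct, mul_add, add_div, add_smul]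
    abel
  map_smul' c g := by
    simp only [Prod.smul_fst, smul_dotProduct, smul_eq_mul, RingHom.id_apply, smul_sub, smul_smul]
    congr 2
    ring

/-- The translation `τ(λ) f = f + ⟨λ, f⟩ δ`. -/
def translation {n : ℕ} (lam : Weight n) : Module.End ℝ (AffFun n) where
  toFun f := f + (0, (fun j => (lam j : ℝ)) ⬝ᵥ f.1)
  map_add' g h := by
    ext
    · simp
    · simp only [dotProduct_add, Prod.snd_add, Prod.fst_add]
      ring
  map_smul' c g := by
    ext
    · simp
    · simp [dotProduct_smul]

/-- The product `s_{i_1} ⋯ s_{i_r}` of simple reflections. -/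
def wordProd {n : ℕ} (w : List (Fin (n + 1))) : Module.End ℝ (AffFun n) :=
  (w.map fun i => reflection (simpleRoot i)).prod

/-- `(i_1, …, i_r)` is a reduced expression for `g`: one has `g = s_{i_1} ⋯ s_{i_r}`, and no
shorter word in the simple reflections has this product. -/
def IsReducedWord {n : ℕ} (w : List (Fin (n + 1))) (g : Module.End ℝ (AffFun n)) : Prop :=
  wordProd w = g ∧ ∀ w' : List (Fin (n + 1)), wordProd w' = g → w.length ≤ w'.length

/-! ### Laurent polynomials and the difference-reflection operators -/

/-- The group algebra of the weight lattice, i.e. Laurent polynomials in `n` variables. -/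
abbrev Laurent (n : ℕ) : Type := AddMonoidAlgebra ℂ (Weight n)

/-- The monomial `x^λ`. -/
def mono {n : ℕ} (lam : Weight n) : Laurent n := AddMonoidAlgebra.single lam 1

/-- A nonzero complex number `q` with a fixed square root `qh`, and the five values
`t_0 = t_{a_0}`, `t = t_{a_i}` (`0 < i < n`), `t_n = t_{a_n}`, `t_0^∨ = t_{a_0/2}` and
`t_n^∨ = t_{a_n/2}` of a multiplicity function. -/
structure Parameters where
  qh : ℂ
  t0 : ℂ
  t : ℂ
  tn : ℂ
  t0v : ℂ
  tnv : ℂ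
  qh_ne : qh ≠ 0
  t0_ne : t0 ≠ 0
  t_ne : t ≠ 0
  tn_ne : tn ≠ 0
  t0v_ne : t0v ≠ 0
  tnv_ne : tnv ≠ 0

/-- The parameter `q`. -/
def Parameters.q (p : Parameters) : ℂ := p.qh ^ 2

/-- The value `t_{a_i}` of the multiplicity function. -/
def Parameters.tval (p : Parameters) {n : ℕ} (i : Fin (n + 1)) : ℂ :=
  if i = 0 then p.t0 else if i = Fin.last n then p.tn else p.t

/-- The monomial `x^{α + m δ} = q^m x^α`. -/
def affMono (p : Parameters) {n : ℕ} (al : Weight n) (m : ℤ) : Laurent n := p.q ^ m • mono al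

/-- The linear operator on Laurent polynomials with prescribed values on the monomials. -/
def ofMono {n : ℕ} (F : Weight n → Laurent n) : Module.End ℂ (Laurent n) where
  toFun f := f.coeff.sum fun lam c => c • F lam
  map_add' f g := by
    rw [AddMonoidAlgebra.coeff_add]
    exact Finsupp.sum_add_index' (by simp) (by intros; rw [add_smul])
  map_smul' c f := by
    rw [AddMonoidAlgebra.coeff_smul, Finsupp.sum_smul_index' (by simp)]
    simp [Finsupp.smul_sum, smul_smul]

/-- The action `s_i(x^λ) = x^{s_i λ}`, where `s_i λ = λ - ⟨λ, a_i^∨⟩ a_i`. -/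
def reflOp (p : Parameters) {n : ℕ} (i : Fin (n + 1)) : Module.End ℂ (Laurent n) :=
  ofMono fun lam =>
    affMono p (lam - pairing lam i • rootGrad i) (-(pairing lam i * rootDelta i))

/-- The divided difference operator `f ↦ (f - s_i f) / (1 - x^{a_i})`, written out on monomials
(see `one_sub_mul_divDiff`). -/
def divDiff (p : Parameters) {n : ℕ} (i : Fin (n + 1)) : Module.End ℂ (Laurent n) :=
  ofMono fun lam =>
    if 0 < pairing lam i then
      -∑ k ∈ Finset.range (pairing lam i).toNat,
        affMono p (lam - ((k : ℤ) + 1) • rootGrad i) (-(((k : ℤ) + 1) * rootDelta i))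
    else
      ∑ k ∈ Finset.range (-pairing lam i).toNat,
        affMono p (lam + (k : ℤ) • rootGrad i) ((k : ℤ) * rootDelta i)

/-- The numerator of the rational function
`v_{a_i}(x) = (1 - t_{a_i} t_{a_i/2} x^{a_i/2}) (1 + t_{a_i} t_{a_i/2}⁻¹ x^{a_i/2}) / (1 - x^{a_i})`.
Here `x^{a_0/2} = q^{1/2} x_1⁻¹` and `x^{a_n/2} = x_n`; for `0 < i < n` one has `t_{a_i/2} = 1`,
and the numerator is `1 - t² x^{a_i}`. -/
def vNum (p : Parameters) {n : ℕ} (i : Fin (n + 1)) : Laurent n :=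
  if i = 0 then
    (1 - (p.t0 * p.t0v * p.qh) • mono (-eps n 1)) * (1 + (p.t0 * p.t0v⁻¹ * p.qh) • mono (-eps n 1))
  else if i = Fin.last n then
    (1 - (p.tn * p.tnv) • mono (eps n n)) * (1 + (p.tn * p.tnv⁻¹) • mono (eps n n))
  else 1 - p.t ^ 2 • mono (rootGrad i)

/-- The difference-reflection operator `T_i = t_i + t_i⁻¹ v_{a_i}(x) (s_i - id)`
(see `one_sub_mul_heckeOp`). -/
def heckeOp (p : Parameters) {n : ℕ} (i : Fin (n + 1)) : Module.End ℂ (Laurent n) :=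
  p.tval i • LinearMap.id -
    (p.tval i)⁻¹ • (LinearMap.mulLeft ℂ (vNum p i) ∘ₗ divDiff p i)

theorem Parameters.q_ne (p : Parameters) : p.q ≠ 0 := pow_ne_zero 2 p.qh_ne

theorem affMono_mul (p : Parameters) {n : ℕ} (al be : Weight n) (a b : ℤ) :
    affMono p al a * affMono p be b = affMono p (al + be) (a + b) := by
  simp [affMono, mono, AddMonoidAlgebra.single_mul_single, zpow_add₀ p.q_ne]

theorem ofMono_mono {n : ℕ} (F : Weight n → Laurent n) (lam : Weight n) :
    ofMono F (mono lam) = F lam := by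
  simp [ofMono, mono, AddMonoidAlgebra.coeff_single]

theorem end_ext {n : ℕ} {A B : Module.End ℂ (Laurent n)} (h : ∀ lam, A (mono lam) = B (mono lam)) :
    A = B := by
  apply AddMonoidAlgebra.lhom_ext'
  intro lam
  apply LinearMap.ext_ring
  exact h lam

theorem one_sub_mul_divDiff (p : Parameters) {n : ℕ} (i : Fin (n + 1)) (f : Laurent n) :
    (1 - affMono p (rootGrad i) (rootDelta i)) * divDiff p i f = f - reflOp p i f := by
  suffices h : LinearMap.mulLeft ℂ (1 - affMono p (rootGrad i) (rootDelta i)) ∘ₗ divDiff p i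
      = LinearMap.id - reflOp p i by
    simpa using LinearMap.congr_fun h f
  apply end_ext
  intro lam
  simp only [LinearMap.comp_apply, LinearMap.mulLeft_apply, LinearMap.sub_apply,
    LinearMap.id_apply, divDiff, reflOp, ofMono_mono]
  have h0 : mono lam = affMono p lam 0 := by simp [affMono]
  rw [h0]
  split_ifs with hp
  · obtain ⟨N, hN⟩ := Int.eq_ofNat_of_zero_le hp.le
    rw [hN]
    simp only [Int.toNat_natCast]
    clear hN hp h0
    induction N with
    | zero => simp
    | succ N ih =>
      rw [Finset.sum_range_succ, neg_add, mul_add, ih, sub_mul, one_mul, mul_neg, affMono_mul]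
      have e1 : rootGrad i + (lam - ((N : ℤ) + 1) • rootGrad i) = lam - (N : ℤ) • rootGrad i := by
        rw [add_smul, one_smul]; abel
      have e2 : rootDelta i + -(((N : ℤ) + 1) * rootDelta i) = -((N : ℤ) * rootDelta i) := by ring
      rw [e1, e2]
      push_cast
      abel
  · obtain ⟨N, hN⟩ := Int.eq_ofNat_of_zero_le (neg_nonneg.mpr (not_lt.mp hp))
    have hN' : pairing lam i = -(N : ℤ) := by omega
    rw [hN']
    simp only [neg_neg, Int.toNat_natCast]
    clear hN hN' hp h0
    induction N with
    | zero => simp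
    | succ N ih =>
      rw [Finset.sum_range_succ, mul_add, ih, sub_mul, one_mul, affMono_mul]
      have e1 : rootGrad i + (lam + (N : ℤ) • rootGrad i)
          = lam - (-((N + 1 : ℕ) : ℤ)) • rootGrad i := by
        push_cast
        rw [neg_smul, add_smul, one_smul]; abel
      have e2 : rootDelta i + (N : ℤ) * rootDelta i = -(-((N + 1 : ℕ) : ℤ) * rootDelta i) := by
        push_cast; ring
      have e3 : lam - (-(N : ℤ)) • rootGrad i = lam + (N : ℤ) • rootGrad i := by
        rw [neg_smul]; abel
      have e4 : -(-(N : ℤ) * rootDelta i) = (N : ℤ) * rootDelta i := by ring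
      rw [e1, e2, e3, e4]
      abel

theorem one_sub_mul_heckeOp (p : Parameters) {n : ℕ} (i : Fin (n + 1)) (f : Laurent n) :
    (1 - affMono p (rootGrad i) (rootDelta i)) * heckeOp p i f =
      p.tval i • ((1 - affMono p (rootGrad i) (rootDelta i)) * f) +
        (p.tval i)⁻¹ • (vNum p i * (reflOp p i f - f)) := by
  have h := one_sub_mul_divDiff p i f
  have h2 : reflOp p i f - f
      = -((1 - affMono p (rootGrad i) (rootDelta i)) * divDiff p i f) := by rw [h]; abel
  rw [h2]
  simp only [heckeOp, LinearMap.sub_apply, LinearMap.smul_apply, LinearMap.id_apply,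
    LinearMap.comp_apply, LinearMap.mulLeft_apply, mul_sub, mul_smul_comm, mul_neg, smul_neg]
  rw [mul_left_comm]
  abel

/-! ### The `Y`-operators -/

/-- The operator `T_{i_1} ⋯ T_{i_r}`. -/
def heckeWord (p : Parameters) {n : ℕ} (w : List (Fin (n + 1))) : Module.End ℂ (Laurent n) :=
  (w.map fun i => heckeOp p i).prod

open Classical in
/-- The operator `T_g = T_{i_1} ⋯ T_{i_r}` for a reduced expression `g = s_{i_1} ⋯ s_{i_r}` of an
element `g` of the affine Weyl group. By the braid relations it does not depend on the reduced
expression. (The value `1` for `g` outside the affine Weyl group is irrelevant.) -/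
def heckeElt (p : Parameters) {n : ℕ} (g : Module.End ℝ (AffFun n)) : Module.End ℂ (Laurent n) :=
  if h : ∃ w : List (Fin (n + 1)), IsReducedWord w g then heckeWord p h.choose else 1

/-- A dominant weight `ν` such that `λ + ν` is dominant too. -/
def domShift {n : ℕ} (lam : Weight n) : Weight n :=
  fun j => (∑ k, |lam k|) * ((n : ℤ) - (j : ℤ))

theorem domShift_isDominant {n : ℕ} (lam : Weight n) : IsDominant (domShift lam) := by
  have hS : 0 ≤ ∑ k, |lam k| := Finset.sum_nonneg fun k _ => abs_nonneg _
  refine ⟨fun i j hij => ?_, fun j => ?_⟩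
  · apply mul_le_mul_of_nonneg_left _ hS
    have : (i : ℕ) ≤ (j : ℕ) := hij
    omega
  · apply mul_nonneg hS
    have := j.isLt
    omega

theorem add_domShift_isDominant {n : ℕ} (lam : Weight n) : IsDominant (lam + domShift lam) := by
  have hS : 0 ≤ ∑ k, |lam k| := Finset.sum_nonneg fun k _ => abs_nonneg _
  refine ⟨fun i j hij => ?_, fun j => ?_⟩
  · rcases eq_or_lt_of_le hij with h | h
    · rw [h]
    · have h1 : |lam i| + |lam j| ≤ ∑ k, |lam k| := by
        rw [← Finset.sum_pair (f := fun k => |lam k|) h.ne]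
        exact Finset.sum_le_sum_of_subset_of_nonneg (Finset.subset_univ _)
          fun k _ _ => abs_nonneg _
      have h2 : (1 : ℤ) ≤ (j : ℤ) - (i : ℤ) := by
        have : (i : ℕ) < (j : ℕ) := h
        omega
      have h3 := mul_le_mul_of_nonneg_left h2 hS
      have h4 := neg_abs_le (lam i)
      have h5 := le_abs_self (lam j)
      simp only [Pi.add_apply, domShift]
      nlinarith
  · have h1 : |lam j| ≤ ∑ k, |lam k| :=
      Finset.single_le_sum (f := fun k => |lam k|) (fun k _ => abs_nonneg _) (Finset.mem_univ j)
    have h2 : (1 : ℤ) ≤ (n : ℤ) - (j : ℤ) := by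
      have := j.isLt
      omega
    have h3 := mul_le_mul_of_nonneg_left h2 hS
    have h4 := neg_abs_le (lam j)
    simp only [Pi.add_apply, domShift]
    linarith

/-- The operator `Y^λ = Y^μ (Y^ν)⁻¹` for `λ = μ - ν` with `μ`, `ν` dominant, where
`Y^μ = T_{τ(μ)}` for dominant `μ`. -/
def yOp (p : Parameters) {n : ℕ} (lam : Weight n) : Module.End ℂ (Laurent n) :=
  heckeElt p (translation (lam + domShift lam)) *
    Ring.inverse (heckeElt p (translation (domShift lam)))

/-- The operator `f(Y) = ∑_λ c_λ Y^λ` for `f = ∑_λ c_λ x^λ`. -/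
def evalY (p : Parameters) {n : ℕ} (f : Laurent n) : Module.End ℂ (Laurent n) :=
  f.coeff.sum fun lam c => c • yOp p lam

/-! ### The spectral points -/

/-- The value `f(y)` of a Laurent polynomial at `y ∈ (ℂ ∖ {0})^n`. -/
def evalAt {n : ℕ} (y : Fin n → ℂ) (f : Laurent n) : ℂ :=
  f.coeff.sum fun lam c => c * ∏ j, y j ^ lam j

/-- The sign function with `sgn 0 = 1`. -/
def sgn (m : ℤ) : ℤ := if 0 ≤ m then 1 else -1

/-- `ρ_l(λ) = ∑ sgn ⟨λ, α⟩ α^∨`, over the long positive roots `α = 2ε_i`. -/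
def rhoL {n : ℕ} (lam : Weight n) : Weight n :=
  ∑ i : Fin n, sgn (2 * lam i) • (Pi.single i 1 : Weight n)

/-- `ρ_m(λ) = ∑ sgn ⟨λ, α⟩ α^∨`, over the positive roots `α = ε_i ± ε_j` (`i < j`). -/
def rhoM {n : ℕ} (lam : Weight n) : Weight n :=
  ∑ i : Fin n, ∑ j ∈ Finset.univ.filter (fun j => i < j),
    (sgn (lam i - lam j) • (Pi.single i 1 - Pi.single j 1 : Weight n) +
      sgn (lam i + lam j) • (Pi.single i 1 + Pi.single j 1 : Weight n))

/-- The spectral point `γ_λ = t_0^{ρ_l(λ)} t_n^{ρ_l(λ)} t^{ρ_m(λ)} q^λ`, a product of vectors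
`c^μ = (c^{μ_1}, …, c^{μ_n})` taken coordinatewise. -/
def spectralPoint (p : Parameters) {n : ℕ} (lam : Weight n) : Fin n → ℂ :=
  fun j => p.t0 ^ rhoL lam j * p.tn ^ rhoL lam j * p.t ^ rhoM lam j * p.q ^ lam j

/-- The genericity conditions: `q` is not a root of unity, and neither `t^{2k}` (`1 ≤ k ≤ n - 1`)
nor `(t_0 t_n)² t^{2k}` (`0 ≤ k ≤ 2n - 2`) is an integral power of `q`. -/
def Parameters.IsGeneric (p : Parameters) (n : ℕ) : Prop :=
  (∀ k : ℕ, 0 < k → p.q ^ k ≠ 1) ∧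
  (∀ k : ℕ, 1 ≤ k → k < n → ∀ m : ℤ, p.t ^ (2 * k) ≠ p.q ^ m) ∧
  (∀ k : ℕ, k + 2 ≤ 2 * n → ∀ m : ℤ, (p.t0 * p.tn) ^ 2 * p.t ^ (2 * k) ≠ p.q ^ m)

end

end Koornwinder

namespace Koornwinder

variable {n : ℕ}

/-! ### The affine Weyl group on integral affine functions -/

/-- Affine functions `v + c δ` with integral coefficients. -/
abbrev AffWt (n : ℕ) : Type := Weight n × ℤ

/-- Automorphisms of the lattice of integral affine functions. -/
abbrev AffAut (n : ℕ) : Type := AffWt n ≃ₗ[ℤ] AffWt n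

theorem apply_inv_apply (g : AffAut n) (x : AffWt n) : g (g⁻¹ x) = x := g.apply_symm_apply x

theorem inv_apply_apply (g : AffAut n) (x : AffWt n) : g⁻¹ (g x) = x := g.symm_apply_apply x

/-- The simple affine root `a_i` as an integral affine function. -/
def aRoot (i : Fin (n + 1)) : AffWt n := (rootGrad i, rootDelta i)

theorem eps_eq_single (j : Fin n) : eps n ((j : ℕ) + 1) = Pi.single j 1 := by
  funext k
  by_cases h : k = j
  · subst h; simp [eps]
  · have : (k : ℕ) ≠ j := fun e => h (Fin.ext e)
    simp [eps, h, this]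

theorem single_two (j : Fin n) : (Pi.single j 2 : Weight n) = 2 • Pi.single j 1 := by
  rw [← Pi.single_smul]; rfl

/-- The three kinds of simple roots. -/
theorem simple_cases [hn : Fact (2 ≤ n)] (i : Fin (n + 1)) :
    (∃ j : Fin n, (j : ℕ) = 0 ∧ (i : ℕ) = 0 ∧ rootGrad i = -(Pi.single j 2 : Weight n) ∧
      corootGrad i = -(Pi.single j 1 : Weight n) ∧ rootDelta i = 1) ∨
    (∃ j : Fin n, (j : ℕ) + 1 = n ∧ (i : ℕ) = n ∧ rootGrad i = (Pi.single j 2 : Weight n) ∧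
      corootGrad i = (Pi.single j 1 : Weight n) ∧ rootDelta i = 0) ∨
    (∃ j k : Fin n, (j : ℕ) + 1 = k ∧ (i : ℕ) = k ∧
      rootGrad i = (Pi.single j 1 - Pi.single k 1 : Weight n) ∧
      corootGrad i = (Pi.single j 1 - Pi.single k 1 : Weight n) ∧ rootDelta i = 0) := by
  have h2 := hn.out
  by_cases h0 : i = 0
  · left
    refine ⟨⟨0, by omega⟩, rfl, by simp [h0], ?_, ?_, by simp [rootDelta, h0]⟩
    · rw [single_two, ← eps_eq_single]; simp [rootGrad, h0]
    · rw [← eps_eq_single]; simp [corootGrad, h0]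
  right
  have h0' : (i : ℕ) ≠ 0 := fun e => h0 (Fin.ext e)
  by_cases hl : i = Fin.last n
  · left
    have hl' : (n - 1) + 1 = n := by omega
    refine ⟨⟨n - 1, by omega⟩, hl', by simp [hl], ?_, ?_, by simp [rootDelta, h0]⟩
    · rw [single_two, ← eps_eq_single, hl']; simp [rootGrad, hl]
      omega
    · rw [← eps_eq_single, hl']; simp [corootGrad, hl]
      omega
  · right
    have hl' : (i : ℕ) ≠ n := fun e => hl (Fin.ext e)
    have hlt := i.isLt
    have e : (i : ℕ) - 1 + 1 = i := by omega
    refine ⟨⟨i - 1, by omega⟩, ⟨i, by omega⟩, e, rfl, ?_, ?_, by simp [rootDelta, h0]⟩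
    · rw [← eps_eq_single, ← eps_eq_single]; simp [rootGrad, h0, hl, e]
    · rw [← eps_eq_single, ← eps_eq_single]; simp [corootGrad, h0, hl, e]

theorem pairing_add (v w : Weight n) (i : Fin (n + 1)) :
    pairing (v + w) i = pairing v i + pairing w i := add_dotProduct _ _ _

theorem pairing_smul (c : ℤ) (v : Weight n) (i : Fin (n + 1)) :
    pairing (c • v) i = c * pairing v i := smul_dotProduct _ _ _

theorem pairing_sub (v w : Weight n) (i : Fin (n + 1)) :
    pairing (v - w) i = pairing v i - pairing w i := sub_dotProduct _ _ _

theorem pairing_root_self [Fact (2 ≤ n)] (i : Fin (n + 1)) : pairing (rootGrad i : Weight n) i = 2 := by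
  rcases simple_cases i with ⟨j, -, -, h1, h2, -⟩ | ⟨j, -, -, h1, h2, -⟩ | ⟨j, k, hjk, -, h1, h2, -⟩
  · simp [pairing, h1, h2]
  · simp [pairing, h1, h2]
  · have : j ≠ k := fun e => by subst e; omega
    simp [pairing, h1, h2, this, this.symm]

theorem root_dot_self_mul_pairing [Fact (2 ≤ n)] (v : Weight n) (i : Fin (n + 1)) :
    ((rootGrad i : Weight n) ⬝ᵥ rootGrad i) * pairing v i = 2 * (v ⬝ᵥ rootGrad i) := by
  rcases simple_cases i with ⟨j, -, -, h1, h2, -⟩ | ⟨j, -, -, h1, h2, -⟩ | ⟨j, k, hjk, -, h1, h2, -⟩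
  · simp [pairing, h1, h2]; ring
  · simp [pairing, h1, h2]; ring
  · have : j ≠ k := fun e => by subst e; omega
    simp [pairing, h1, h2, this, this.symm]

theorem root_dot_self_pos [Fact (2 ≤ n)] (i : Fin (n + 1)) :
    0 < (rootGrad i : Weight n) ⬝ᵥ rootGrad i := by
  rcases simple_cases i with ⟨j, -, -, h1, -, -⟩ | ⟨j, -, -, h1, -, -⟩ | ⟨j, k, hjk, -, h1, -, -⟩
  · simp [h1]
  · simp [h1]
  · have : j ≠ k := fun e => by subst e; omega
    simp [h1, this, this.symm]

/-- The simple reflection `s_i` on integral affine functions. -/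
def aRefl [Fact (2 ≤ n)] (i : Fin (n + 1)) : AffAut n where
  toFun x := x - pairing x.1 i • aRoot i
  invFun x := x - pairing x.1 i • aRoot i
  left_inv x := by
    simp only [Prod.fst_sub, Prod.smul_fst, pairing_sub, pairing_smul, aRoot, pairing_root_self,
      sub_smul, mul_smul]
    module
  right_inv x := by
    simp only [Prod.fst_sub, Prod.smul_fst, pairing_sub, pairing_smul, aRoot, pairing_root_self,
      sub_smul, mul_smul]
    module
  map_add' x y := by
    simp only [Prod.fst_add, pairing_add, add_smul]
    abel
  map_smul' c x := by
    simp only [Prod.smul_fst, pairing_smul, mul_smul, smul_sub, RingHom.id_apply]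

/-- The product of the simple reflections of a word. -/
def wProd [Fact (2 ≤ n)] (w : List (Fin (n + 1))) : AffAut n := (w.map aRefl).prod

section
variable [Fact (2 ≤ n)]

theorem aRefl_apply (i : Fin (n + 1)) (x : AffWt n) :
    aRefl i x = x - pairing x.1 i • aRoot i := rfl

theorem aRefl_mul_self (i : Fin (n + 1)) : aRefl i * aRefl i = (1 : AffAut n) :=
  LinearEquiv.ext (aRefl i).left_inv

theorem aRefl_inv (i : Fin (n + 1)) : (aRefl i)⁻¹ = (aRefl i : AffAut n) :=
  inv_eq_of_mul_eq_one_left (aRefl_mul_self i)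

theorem aRefl_aRefl (i : Fin (n + 1)) (x : AffWt n) : aRefl i (aRefl i x) = x :=
  (aRefl i).left_inv x

theorem aRefl_aRoot (i : Fin (n + 1)) : aRefl i (aRoot i : AffWt n) = -aRoot i := by
  rw [aRefl_apply]
  have : pairing (aRoot i : AffWt n).1 i = 2 := pairing_root_self i
  rw [this]; module

@[simp] theorem wProd_nil : wProd ([] : List (Fin (n + 1))) = 1 := rfl

@[simp] theorem wProd_cons (i : Fin (n + 1)) (w : List (Fin (n + 1))) :
    wProd (i :: w) = aRefl i * wProd w := by simp [wProd]

@[simp] theorem wProd_append (v w : List (Fin (n + 1))) : wProd (v ++ w) = wProd v * wProd w := by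
  simp [wProd]

theorem wProd_reverse (w : List (Fin (n + 1))) : wProd w.reverse = (wProd w)⁻¹ := by
  induction w with
  | nil => simp
  | cons i w ih => simp [ih, aRefl_inv]

theorem aRefl_dot (i : Fin (n + 1)) (x y : AffWt n) :
    (aRefl i x).1 ⬝ᵥ (aRefl i y).1 = x.1 ⬝ᵥ y.1 := by
  have hx := root_dot_self_mul_pairing x.1 i
  have hy := root_dot_self_mul_pairing y.1 i
  simp only [aRefl_apply, aRoot, Prod.fst_sub, Prod.smul_fst, sub_dotProduct, dotProduct_sub,
    smul_dotProduct, dotProduct_smul, smul_eq_mul]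
  rw [dotProduct_comm (rootGrad i) y.1]
  have : pairing x.1 i * (pairing y.1 i * (rootGrad i ⬝ᵥ rootGrad i)) =
    pairing x.1 i * (y.1 ⬝ᵥ rootGrad i) + pairing y.1 i * (x.1 ⬝ᵥ rootGrad i) := by
    have h1 : 2 * (pairing x.1 i * (pairing y.1 i * (rootGrad i ⬝ᵥ rootGrad i))) =
      2 * (pairing x.1 i * (y.1 ⬝ᵥ rootGrad i) + pairing y.1 i * (x.1 ⬝ᵥ rootGrad i)) := by
      linear_combination pairing x.1 i * hy + pairing y.1 i * hx
    linarith
  linarith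

theorem wProd_dot (w : List (Fin (n + 1))) (x y : AffWt n) :
    (wProd w x).1 ⬝ᵥ (wProd w y).1 = x.1 ⬝ᵥ y.1 := by
  induction w with
  | nil => simp
  | cons i w ih => rw [wProd_cons]; simp only [LinearEquiv.mul_apply]; rw [aRefl_dot, ih]

theorem wProd_inv_dot (w : List (Fin (n + 1))) (x y : AffWt n) :
    ((wProd w)⁻¹ x).1 ⬝ᵥ y.1 = x.1 ⬝ᵥ (wProd w y).1 := by
  rw [← wProd_dot w, apply_inv_apply]

/-- An element of the affine Weyl group carrying `a_i` to `a_j` conjugates `s_i` to `s_j`. -/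
theorem wProd_mul_aRefl {w : List (Fin (n + 1))} {i j : Fin (n + 1)}
    (h : wProd w (aRoot i) = aRoot j) : wProd w * aRefl i = aRefl j * wProd w := by
  ext1 x
  simp only [LinearEquiv.mul_apply, aRefl_apply, map_sub, map_zsmul, h]
  congr 2
  have h1 := root_dot_self_mul_pairing x.1 i
  have h2 := root_dot_self_mul_pairing (wProd w x).1 j
  have h3 := wProd_dot w x (aRoot i)
  have h4 := wProd_dot w (aRoot i) (aRoot i)
  have h5 := root_dot_self_pos i
  rw [h] at h3 h4
  simp only [aRoot] at h3 h4
  rw [h3, h4, ← h1] at h2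
  exact (mul_left_cancel₀ h5.ne' h2).symm

/-- The Cartan integer `⟨a_j, a_i^∨⟩`. -/
def cartan (i j : Fin (n + 1)) : ℤ := pairing (rootGrad j : Weight n) i

theorem aRefl_aRoot' (i j : Fin (n + 1)) :
    aRefl i (aRoot j : AffWt n) = aRoot j - cartan i j • aRoot i := rfl
end

/-! ### Heights and roots -/

/-- The value of an affine function at an interior point of the fundamental alcove, rescaled. -/
def ht (x : AffWt n) : ℤ := (2 * n + 2) * x.2 + ∑ j, x.1 j * ((n : ℤ) - j)

theorem ht_add (x y : AffWt n) : ht (x + y) = ht x + ht y := by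
  simp only [ht, Prod.snd_add, Prod.fst_add, Pi.add_apply, add_mul, Finset.sum_add_distrib]; ring

theorem ht_smul (c : ℤ) (x : AffWt n) : ht (c • x) = c * ht x := by
  simp only [ht, Prod.smul_snd, Prod.smul_fst, Pi.smul_apply, smul_eq_mul, mul_add,
    Finset.mul_sum, mul_assoc]; ring_nf

theorem ht_neg (x : AffWt n) : ht (-x) = -ht x := by
  have := ht_smul (-1) x
  simpa using this

theorem ht_sub (x y : AffWt n) : ht (x - y) = ht x - ht y := by
  rw [sub_eq_add_neg, ht_add, ht_neg]; ring

/-- The affine roots: `±ε_j ± ε_k + c δ` and `±2ε_j + c δ`. -/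
def IsRoot (x : AffWt n) : Prop :=
  ∃ (j k : Fin n) (s t : ℤ), (s = 1 ∨ s = -1) ∧ (t = 1 ∨ t = -1) ∧ (j = k → s = t) ∧
    x.1 = Pi.single j s + Pi.single k t

theorem sum_single_mul (j : Fin n) (s : ℤ) (h : Fin n → ℤ) :
    ∑ i, (Pi.single j s : Weight n) i * h i = s * h j := by
  have := single_dotProduct h s j
  simpa [dotProduct] using this

theorem ht_of_eq {x : AffWt n} {j k : Fin n} {s t : ℤ} (h : x.1 = Pi.single j s + Pi.single k t) :
    ht x = (2 * n + 2) * x.2 + (s * ((n : ℤ) - j) + t * ((n : ℤ) - k)) := by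
  simp only [ht, h, Pi.add_apply, add_mul, Finset.sum_add_distrib,
    sum_single_mul _ _ (fun j : Fin n => (n : ℤ) - j)]

section
variable [Fact (2 ≤ n)]

theorem isRoot_aRoot (i : Fin (n + 1)) : IsRoot (aRoot i : AffWt n) := by
  rcases simple_cases i with ⟨j, -, -, h1, -, -⟩ | ⟨j, -, -, h1, -, -⟩ | ⟨j, k, hjk, -, h1, -, -⟩
  · refine ⟨j, j, -1, -1, by simp, by simp, by simp, ?_⟩
    rw [← Pi.single_add]; simp [aRoot, h1, ← Pi.single_neg]
  · refine ⟨j, j, 1, 1, by simp, by simp, by simp, ?_⟩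
    rw [← Pi.single_add]; simp [aRoot, h1]
  · refine ⟨j, k, 1, -1, by simp, by simp, fun e => by subst e; omega, ?_⟩
    simp [aRoot, h1, sub_eq_add_neg, Pi.single_neg]

theorem ht_aRoot_pos (i : Fin (n + 1)) : 0 < ht (aRoot i : AffWt n) := by
  rcases simple_cases i with ⟨j, h0, -, h1, -, h3⟩ | ⟨j, h0, -, h1, -, h3⟩ |
    ⟨j, k, hjk, -, h1, -, h3⟩
  · rw [ht_of_eq (x := aRoot i) (j := j) (k := j) (s := -1) (t := -1)
      (by rw [← Pi.single_add]; simp [aRoot, h1, ← Pi.single_neg])]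
    simp only [aRoot, h3]; omega
  · rw [ht_of_eq (x := aRoot i) (j := j) (k := j) (s := 1) (t := 1) (by rw [← Pi.single_add]; simp [aRoot, h1])]
    simp only [aRoot, h3]; omega
  · rw [ht_of_eq (x := aRoot i) (j := j) (k := k) (s := 1) (t := -1)
      (by simp [aRoot, h1, sub_eq_add_neg, Pi.single_neg])]
    simp only [aRoot, h3]; omega

/-- The gradient of `s_i x`: a transposition or a sign change of the coordinates. -/
theorem aRefl_cases (i : Fin (n + 1)) :
    (∃ j : Fin n, (j : ℕ) = 0 ∧ (i : ℕ) = 0 ∧ ∀ x : AffWt n,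
      aRefl i x = (Function.update x.1 j (-x.1 j), x.2 + x.1 j)) ∨
    (∃ j : Fin n, (j : ℕ) + 1 = n ∧ (i : ℕ) = n ∧ ∀ x : AffWt n,
      aRefl i x = (Function.update x.1 j (-x.1 j), x.2)) ∨
    (∃ j k : Fin n, (j : ℕ) + 1 = k ∧ (i : ℕ) = k ∧ ∀ x : AffWt n,
      aRefl i x = (x.1 ∘ Equiv.swap j k, x.2)) := by
  rcases simple_cases i with ⟨j, h0, hi, h1, h2, h3⟩ | ⟨j, h0, hi, h1, h2, h3⟩ |
    ⟨j, k, hjk, hi, h1, h2, h3⟩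
  · refine Or.inl ⟨j, h0, hi, fun x => ?_⟩
    ext l
    · by_cases h : l = j
      · subst h; simp [aRefl_apply, aRoot, pairing, h1, h2]; ring
      · simp [aRefl_apply, aRoot, pairing, h1, h2, h]
    · simp [aRefl_apply, aRoot, pairing, h2, h3]
  · refine Or.inr (Or.inl ⟨j, h0, hi, fun x => ?_⟩)
    ext l
    · by_cases h : l = j
      · subst h; simp [aRefl_apply, aRoot, pairing, h1, h2]; ring
      · simp [aRefl_apply, aRoot, pairing, h1, h2, h]
    · simp [aRefl_apply, aRoot, pairing, h2, h3]
  · refine Or.inr (Or.inr ⟨j, k, hjk, hi, fun x => ?_⟩)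
    have hne : j ≠ k := fun e => by subst e; omega
    ext l
    · by_cases h : l = j
      · subst h; simp [aRefl_apply, aRoot, pairing, h1, h2, hne]
      · by_cases h' : l = k
        · subst h'; simp [aRefl_apply, aRoot, pairing, h1, h2, h]
        · simp [aRefl_apply, aRoot, pairing, h1, h2, h, h', Equiv.swap_apply_of_ne_of_ne]
    · simp [aRefl_apply, aRoot, h3]

omit [Fact (2 ≤ n)] in
theorem update_single_neg (j l : Fin n) (s : ℤ) :
    Function.update (Pi.single l s : Weight n) j (-(Pi.single l s : Weight n) j) =
      Pi.single l (if l = j then -s else s) := by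
  funext m
  by_cases h : m = j
  · subst h
    by_cases h' : l = m
    · subst h'; simp
    · simp [h', Ne.symm h']
  · by_cases h' : l = j
    · subst h'; simp [h]
    · simp [h, h']

omit [Fact (2 ≤ n)] in
theorem update_add_neg (j : Fin n) (v w : Weight n) :
    Function.update (v + w) j (-(v + w) j) =
      Function.update v j (-v j) + Function.update w j (-w j) := by
  funext m
  by_cases h : m = j
  · subst h; simp; ring
  · simp [h]

omit [Fact (2 ≤ n)] in
theorem single_comp_swap (j k l : Fin n) (s : ℤ) :
    (Pi.single l s : Weight n) ∘ Equiv.swap j k = Pi.single (Equiv.swap j k l) s := by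
  funext m
  by_cases h : m = Equiv.swap j k l
  · subst h; simp
  · have : Equiv.swap j k m ≠ l := fun e => h (by rw [← e]; simp)
    simp [h, this]

theorem IsRoot.aRefl {x : AffWt n} (hx : IsRoot x) (i : Fin (n + 1)) : IsRoot (aRefl i x) := by
  obtain ⟨j, k, s, t, hs, ht, hst, hx⟩ := hx
  have key : ∀ l : Fin n,
      IsRoot ((Function.update x.1 l (-x.1 l), 0) : AffWt n) := by
    intro l
    refine ⟨j, k, if j = l then -s else s, if k = l then -t else t, ?_, ?_, ?_, ?_⟩
    · split_ifs <;> omega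
    · split_ifs <;> omega
    · rintro rfl; simp [hst rfl]
    · simp only [hx, update_add_neg, update_single_neg]
  rcases aRefl_cases i with ⟨l, -, -, h⟩ | ⟨l, -, -, h⟩ | ⟨l, m, -, -, h⟩
  · rw [h]; exact key l
  · rw [h]; exact key l
  · rw [h]
    refine ⟨Equiv.swap l m j, Equiv.swap l m k, s, t, hs, ht, fun e => hst ?_, ?_⟩
    · exact (Equiv.swap l m).injective e
    · simp only [hx, Pi.add_comp, single_comp_swap]

theorem IsRoot.wProd {x : AffWt n} (hx : IsRoot x) (w : List (Fin (n + 1))) :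
    IsRoot (wProd w x) := by
  induction w with
  | nil => exact hx
  | cons i w ih => rw [wProd_cons]; exact ih.aRefl i

theorem IsRoot.wProd_inv {x : AffWt n} (hx : IsRoot x) (w : List (Fin (n + 1))) :
    IsRoot ((Koornwinder.wProd w)⁻¹ x) := by
  rw [← wProd_reverse]; exact hx.wProd _

omit [Fact (2 ≤ n)] in
theorem IsRoot.ht_ne_zero {x : AffWt n} (hx : IsRoot x) : ht x ≠ 0 := by
  obtain ⟨j, k, s, t, hs, ht, hst, hx⟩ := hx
  rw [ht_of_eq hx]
  have hj := j.isLt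
  have hk := k.isLt
  intro h
  have hjk : j = k ∨ (j : ℕ) ≠ k := by
    by_cases e : j = k
    · exact Or.inl e
    · exact Or.inr fun e' => e (Fin.ext e')
  rcases lt_trichotomy x.2 0 with hc | hc | hc
  · have : (2 * (n : ℤ) + 2) * x.2 ≤ (2 * n + 2) * (-1) :=
      mul_le_mul_of_nonneg_left (by omega) (by omega)
    rcases hs with rfl | rfl <;> rcases ht with rfl | rfl <;> omega
  · rw [hc] at h
    rcases hs with rfl | rfl <;> rcases ht with rfl | rfl <;> omega
  · have : (2 * (n : ℤ) + 2) * 1 ≤ (2 * n + 2) * x.2 :=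
      mul_le_mul_of_nonneg_left (by omega) (by omega)
    rcases hs with rfl | rfl <;> rcases ht with rfl | rfl <;> omega

/-- A simple reflection `s_i` permutes the positive roots other than `a_i`. -/
theorem IsRoot.ht_aRefl_pos {x : AffWt n} (hx : IsRoot x) {i : Fin (n + 1)} (hpos : 0 < ht x)
    (hne : x ≠ aRoot i) : 0 < ht (Koornwinder.aRefl i x) := by
  obtain ⟨j, k, s, t, hs, ht', hst, hx⟩ := hx
  rw [ht_of_eq hx] at hpos
  have hj := j.isLt
  have hk := k.isLt
  have hc : (x.2 ≤ -1 ∧ (2 * (n : ℤ) + 2) * x.2 ≤ -(2 * n + 2)) ∨ x.2 = 0 ∨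
      (1 ≤ x.2 ∧ (2 * (n : ℤ) + 2) ≤ (2 * n + 2) * x.2) := by
    rcases lt_trichotomy x.2 0 with hc | hc | hc
    · left
      refine ⟨by omega, ?_⟩
      have : (2 * (n : ℤ) + 2) * x.2 ≤ (2 * n + 2) * (-1) :=
        mul_le_mul_of_nonneg_left (by omega) (by omega)
      omega
    · exact Or.inr (Or.inl hc)
    · right; right
      refine ⟨by omega, ?_⟩
      have : (2 * (n : ℤ) + 2) * 1 ≤ (2 * n + 2) * x.2 :=
        mul_le_mul_of_nonneg_left (by omega) (by omega)
      omega
  have hr := ht_aRoot_pos i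
  have e : ht (Koornwinder.aRefl i x) = ht x - pairing x.1 i * ht (aRoot i : AffWt n) := by
    rw [aRefl_apply, ht_sub, ht_smul]
  rw [e, ht_of_eq hx, hx, pairing_add]
  rcases simple_cases i with ⟨a, ha, -, h1, h2, h3⟩ | ⟨a, ha, -, h1, h2, h3⟩ |
    ⟨a, b, hab, -, h1, h2, h3⟩
  · have hp : ∀ (l : Fin n) (r : ℤ), ((l : ℕ) = 0 ∧ pairing (Pi.single l r : Weight n) i = -r) ∨
        ((l : ℕ) ≠ 0 ∧ pairing (Pi.single l r : Weight n) i = 0) := by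
      intro l r
      by_cases h : l = a
      · left; subst h; simp [ha, pairing, h2]
      · right; refine ⟨fun e => h (Fin.ext (by omega)), by simp [pairing, h2, h]⟩
    have hne' : ¬ ((j : ℕ) = 0 ∧ (k : ℕ) = 0 ∧ s = -1 ∧ t = -1 ∧ x.2 = 1) := by
      rintro ⟨hj, hk, rfl, rfl, hx2⟩
      apply hne
      have ej : j = a := Fin.ext (by omega)
      have ek : k = a := Fin.ext (by omega)
      ext1
      · rw [hx, ej, ek, ← Pi.single_add]; simp [aRoot, h1, ← Pi.single_neg]
      · simp [aRoot, h3, hx2]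
    have hH : ht (aRoot i : AffWt n) = 2 := by
      rw [ht_of_eq (x := aRoot i) (j := a) (k := a) (s := -1) (t := -1)
        (by rw [← Pi.single_add]; simp [aRoot, h1, ← Pi.single_neg])]
      simp only [aRoot, h3]; omega
    have hc' : (x.2 ≤ -1 ∧ (2 * (n : ℤ) + 2) * x.2 ≤ -(2 * n + 2)) ∨ x.2 = 0 ∨ x.2 = 1 ∨
        (2 ≤ x.2 ∧ 2 * (2 * (n : ℤ) + 2) ≤ (2 * n + 2) * x.2) := by
      rcases hc with h | h | ⟨h, -⟩
      · exact Or.inl h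
      · exact Or.inr (Or.inl h)
      · by_cases h1 : x.2 = 1
        · exact Or.inr (Or.inr (Or.inl h1))
        · refine Or.inr (Or.inr (Or.inr ⟨by omega, ?_⟩))
          have : (2 * (n : ℤ) + 2) * 2 ≤ (2 * n + 2) * x.2 :=
            mul_le_mul_of_nonneg_left (by omega) (by omega)
          omega
    rw [hH]
    rcases hp j s with ⟨q1, q2⟩ | ⟨q1, q2⟩ <;> rcases hp k t with ⟨r1, r2⟩ | ⟨r1, r2⟩ <;>
    rw [q2, r2] <;> rcases hs with rfl | rfl <;> rcases ht' with rfl | rfl <;>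
    rcases hc' with ⟨c1, c2⟩ | c1 | c1 | ⟨c1, c2⟩ <;> (try rw [c1] at hpos ⊢) <;> omega
  · have hp : ∀ (l : Fin n) (r : ℤ),
        ((l : ℕ) + 1 = n ∧ pairing (Pi.single l r : Weight n) i = r) ∨
        ((l : ℕ) + 1 ≠ n ∧ pairing (Pi.single l r : Weight n) i = 0) := by
      intro l r
      by_cases h : l = a
      · left; subst h; simp [ha, pairing, h2]
      · right; refine ⟨fun e => h (Fin.ext (by omega)), by simp [pairing, h2, h]⟩
    have hne' : ¬ ((j : ℕ) + 1 = n ∧ (k : ℕ) + 1 = n ∧ s = 1 ∧ t = 1 ∧ x.2 = 0) := by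
      rintro ⟨hj, hk, rfl, rfl, hx2⟩
      apply hne
      have ej : j = a := Fin.ext (by omega)
      have ek : k = a := Fin.ext (by omega)
      ext1
      · rw [hx, ej, ek, ← Pi.single_add]; simp [aRoot, h1]
      · simp [aRoot, h3, hx2]
    have hH : ht (aRoot i : AffWt n) = 2 := by
      rw [ht_of_eq (x := aRoot i) (j := a) (k := a) (s := 1) (t := 1)
        (by rw [← Pi.single_add]; simp [aRoot, h1])]
      simp only [aRoot, h3]; omega
    rw [hH]
    rcases hp j s with ⟨q1, q2⟩ | ⟨q1, q2⟩ <;> rcases hp k t with ⟨r1, r2⟩ | ⟨r1, r2⟩ <;>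
    rw [q2, r2] <;> rcases hs with rfl | rfl <;> rcases ht' with rfl | rfl <;>
    rcases hc with ⟨c1, c2⟩ | c1 | ⟨c1, c2⟩ <;> (try rw [c1] at hpos ⊢) <;> omega
  · have hab' : a ≠ b := fun e => by subst e; omega
    have hb := b.isLt
    have hp : ∀ (l : Fin n) (r : ℤ),
        ((l : ℕ) = a ∧ pairing (Pi.single l r : Weight n) i = r) ∨
        ((l : ℕ) = b ∧ pairing (Pi.single l r : Weight n) i = -r) ∨
        ((l : ℕ) ≠ a ∧ (l : ℕ) ≠ b ∧ pairing (Pi.single l r : Weight n) i = 0) := by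
      intro l r
      by_cases h : l = a
      · left; subst h; simp [pairing, h2, hab']
      by_cases h' : l = b
      · right; left; subst h'; simp [pairing, h2, hab'.symm]
      · right; right
        exact ⟨fun e => h (Fin.ext e), fun e => h' (Fin.ext e), by simp [pairing, h2, h, h']⟩
    have hne' : ¬ ((j : ℕ) = a ∧ (k : ℕ) = b ∧ s = 1 ∧ t = -1 ∧ x.2 = 0) := by
      rintro ⟨hj, hk, rfl, rfl, hx2⟩
      apply hne
      have ej : j = a := Fin.ext (by omega)
      have ek : k = b := Fin.ext (by omega)
      ext1
      · rw [hx, ej, ek]; simp [aRoot, h1, sub_eq_add_neg, Pi.single_neg]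
      · simp [aRoot, h3, hx2]
    have hne'' : ¬ ((j : ℕ) = b ∧ (k : ℕ) = a ∧ s = -1 ∧ t = 1 ∧ x.2 = 0) := by
      rintro ⟨hj, hk, rfl, rfl, hx2⟩
      apply hne
      have ej : j = b := Fin.ext (by omega)
      have ek : k = a := Fin.ext (by omega)
      ext1
      · rw [hx, ej, ek, add_comm]; simp [aRoot, h1, sub_eq_add_neg, Pi.single_neg]
      · simp [aRoot, h3, hx2]
    have hjk : (j : ℕ) = k → s = t := fun e => hst (Fin.ext e)
    have hH : ht (aRoot i : AffWt n) = 1 := by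
      rw [ht_of_eq (x := aRoot i) (j := a) (k := b) (s := 1) (t := -1)
        (by simp [aRoot, h1, sub_eq_add_neg, Pi.single_neg])]
      simp only [aRoot, h3]; omega
    rw [hH]
    rcases hp j s with ⟨q1, q2⟩ | ⟨q1, q2⟩ | ⟨q1, q1', q2⟩ <;>
    rcases hp k t with ⟨r1, r2⟩ | ⟨r1, r2⟩ | ⟨r1, r1', r2⟩ <;>
    rw [q2, r2] <;> rcases hs with rfl | rfl <;> rcases ht' with rfl | rfl <;>
    rcases hc with ⟨c1, c2⟩ | c1 | ⟨c1, c2⟩ <;> (try rw [c1] at hpos ⊢) <;> omega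
end
end Koornwinder

namespace Koornwinder

variable {n : ℕ} [Fact (2 ≤ n)]

/-! ### Reduced words and the exchange property -/

/-- A positive root made negative by `w⁻¹` occurs along the word `w`. -/
theorem exists_split_of_ht_neg (w : List (Fin (n + 1))) {x : AffWt n} (hx : IsRoot x)
    (hpos : 0 < ht x) (hneg : ht ((wProd w)⁻¹ x) < 0) :
    ∃ u j v, w = u ++ j :: v ∧ wProd u (aRoot j) = x := by
  induction w generalizing x with
  | nil => exact absurd hneg (by simpa using hpos.le)
  | cons i w ih =>
    by_cases hi : x = aRoot i
    · exact ⟨[], i, w, rfl, by simpa using hi.symm⟩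
    · have h1 : (wProd (i :: w))⁻¹ x = (wProd w)⁻¹ (aRefl i x) := by
        rw [wProd_cons, mul_inv_rev, aRefl_inv]; rfl
      rw [h1] at hneg
      obtain ⟨u, j, v, rfl, h⟩ := ih (hx.aRefl i) (hx.ht_aRefl_pos hpos hi) hneg
      refine ⟨i :: u, j, v, rfl, ?_⟩
      rw [wProd_cons, LinearEquiv.mul_apply, h, aRefl_aRefl]

/-- The exchange property. -/
theorem exchange {w : List (Fin (n + 1))} {i : Fin (n + 1)}
    (h : ht ((wProd w)⁻¹ (aRoot i)) < 0) :
    ∃ u, u.length + 1 = w.length ∧ wProd (i :: u) = wProd w := by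
  obtain ⟨u, j, v, rfl, hu⟩ := exists_split_of_ht_neg w (isRoot_aRoot i) (ht_aRoot_pos i) h
  refine ⟨u ++ v, by simp; omega, ?_⟩
  simp only [wProd_cons, wProd_append]
  rw [← mul_assoc, ← wProd_mul_aRefl hu, mul_assoc]

/-- A word of minimal length among those with the same product. -/
def IsRed (w : List (Fin (n + 1))) : Prop := ∀ w', wProd w' = wProd w → w.length ≤ w'.length

theorem wProd_cons_cons_self (i : Fin (n + 1)) (w : List (Fin (n + 1))) :
    wProd (i :: i :: w) = wProd w := by
  rw [wProd_cons, wProd_cons, ← mul_assoc, aRefl_mul_self, one_mul]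

theorem wProd_cons_inv_apply (i : Fin (n + 1)) (w : List (Fin (n + 1))) (x : AffWt n) :
    (wProd (i :: w))⁻¹ x = (wProd w)⁻¹ (aRefl i x) := by
  rw [wProd_cons, mul_inv_rev, aRefl_inv]; rfl

theorem ht_wProd_cons_inv (i : Fin (n + 1)) (w : List (Fin (n + 1))) :
    ht ((wProd (i :: w))⁻¹ (aRoot i)) = -ht ((wProd w)⁻¹ (aRoot i)) := by
  rw [wProd_cons_inv_apply, aRefl_aRoot, map_neg, ht_neg]

theorem IsRed.tail {i : Fin (n + 1)} {w : List (Fin (n + 1))} (h : IsRed (i :: w)) : IsRed w := by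
  intro w' hw'
  have := h (i :: w') (by simp [hw'])
  simpa using this

theorem IsRed.of_append {u w : List (Fin (n + 1))} (h : IsRed (u ++ w)) : IsRed w := by
  induction u with
  | nil => exact h
  | cons i u ih => exact ih h.tail

theorem IsRed.reverse {w : List (Fin (n + 1))} (h : IsRed w) : IsRed w.reverse := by
  intro w' hw'
  have := h w'.reverse (by rw [wProd_reverse, hw', wProd_reverse, inv_inv])
  simpa using this

theorem IsRed.ht_neg {i : Fin (n + 1)} {w : List (Fin (n + 1))} (h : IsRed (i :: w)) :
    ht ((wProd (i :: w))⁻¹ (aRoot i)) < 0 := by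
  by_contra hc
  have h0 := ((isRoot_aRoot i).wProd_inv (i :: w)).ht_ne_zero
  rw [ht_wProd_cons_inv] at hc h0
  obtain ⟨u, hu, hu'⟩ := exchange (w := w) (i := i) (by omega)
  have := h u (by rw [wProd_cons i w, ← hu', ← wProd_cons, wProd_cons_cons_self])
  simp at this
  omega

theorem IsRed.cons {i : Fin (n + 1)} {w : List (Fin (n + 1))} (h : IsRed w)
    (hpos : 0 < ht ((wProd w)⁻¹ (aRoot i))) : IsRed (i :: w) := by
  intro w' hw'
  obtain ⟨u, hu, hu'⟩ := exchange (w := w') (i := i) (by rw [hw', ht_wProd_cons_inv]; omega)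
  have := h u (by
    rw [hw', wProd_cons, wProd_cons] at hu'
    exact mul_left_cancel hu')
  simp; omega

theorem IsRed.exchange {i : Fin (n + 1)} {w : List (Fin (n + 1))} (h : IsRed w)
    (hneg : ht ((wProd w)⁻¹ (aRoot i)) < 0) :
    ∃ u, u.length + 1 = w.length ∧ wProd (i :: u) = wProd w ∧ IsRed (i :: u) := by
  obtain ⟨u, hu, hu'⟩ := Koornwinder.exchange hneg
  refine ⟨u, hu, hu', fun w' hw' => ?_⟩
  have := h w' (hw'.trans hu')
  simp; omega

theorem exists_isRed (w : List (Fin (n + 1))) : ∃ u, wProd u = wProd w ∧ IsRed u := by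
  obtain ⟨u, hu, hmin⟩ := (measure (List.length (α := Fin (n + 1)))).wf.has_min
    {u | wProd u = wProd w} ⟨w, rfl⟩
  exact ⟨u, hu, fun w' hw' => not_lt.mp (hmin w' (hw'.trans hu))⟩

/-! ### Matsumoto's theorem -/

/-- The braid relations of affine type `C_n`. -/
structure Braid {M : Type*} [Monoid M] (f : Fin (n + 1) → M) : Prop where
  comm : ∀ i j, cartan i j = 0 → cartan j i = 0 → f i * f j = f j * f i
  braid3 : ∀ i j, cartan i j = -1 → cartan j i = -1 → f i * f j * f i = f j * f i * f j
  braid4 : ∀ i j, cartan i j = -1 → cartan j i = -2 →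
    f i * f j * f i * f j = f j * f i * f j * f i

theorem cartan_cases {i j : Fin (n + 1)} (hij : i ≠ j) :
    (cartan i j = 0 ∧ cartan j i = 0) ∨ (cartan i j = -1 ∧ cartan j i = -1) ∨
    (cartan i j = -1 ∧ cartan j i = -2) ∨ (cartan i j = -2 ∧ cartan j i = -1) := by
  have hij' : (i : ℕ) ≠ j := fun e => hij (Fin.ext e)
  have hn := Fact.out (p := 2 ≤ n)
  have key : ∀ (j k : Fin n) (s : ℤ), (Pi.single j s : Weight n) k =
      if (k : ℕ) = j then s else 0 := by
    intro j k s; simp [Pi.single_apply, Fin.ext_iff]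
  rcases simple_cases i with ⟨a, ha, hi, h1, h2, -⟩ | ⟨a, ha, hi, h1, h2, -⟩ |
    ⟨a, b, hab, hi, h1, h2, -⟩ <;>
  rcases simple_cases j with ⟨c, hc, hj, h3, h4, -⟩ | ⟨c, hc, hj, h3, h4, -⟩ |
    ⟨c, d, hcd, hj, h3, h4, -⟩ <;>
  simp only [cartan, pairing, h1, h2, h3, h4, sub_dotProduct, dotProduct_sub, neg_dotProduct,
    dotProduct_neg, single_dotProduct, key] <;>
  split_ifs <;> omega

theorem aRefl_cartan (i j : Fin (n + 1)) :
    aRefl i (aRoot j : AffWt n) = aRoot j + (-cartan i j) • aRoot i := by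
  rw [aRefl_aRoot']; module

theorem aRefl_aRefl_root {i j : Fin (n + 1)} :
    aRefl i (aRefl j (aRoot i : AffWt n)) =
      (cartan i j * cartan j i - 1) • aRoot i + (-cartan j i) • aRoot j := by
  rw [aRefl_cartan j i, map_add, map_zsmul, aRefl_aRoot, aRefl_cartan i j]
  module

theorem aRefl_aRefl_aRefl_root {i j : Fin (n + 1)} (h : cartan i j * cartan j i = 2) :
    aRefl i (aRefl j (aRefl i (aRoot j : AffWt n))) = aRoot j := by
  rw [aRefl_cartan i j, map_add, map_zsmul, aRefl_aRoot, aRefl_cartan j i, map_add, map_neg,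
    map_zsmul, map_add, map_zsmul, aRefl_aRoot, aRefl_cartan i j]
  linear_combination h • (aRoot j - cartan i j • aRoot i : AffWt n)

theorem braid_aRefl : Braid (aRefl : Fin (n + 1) → AffAut n) where
  comm i j h1 h2 := by
    have := wProd_mul_aRefl (w := [i]) (i := j) (j := j) (by simp [aRefl_cartan, h1])
    simpa using this
  braid3 i j h1 h2 := by
    have := wProd_mul_aRefl (w := [i, j]) (i := i) (j := j)
      (by simp [aRefl_aRefl_root, h1, h2])
    simpa [mul_assoc] using this
  braid4 i j h1 h2 := by
    have := wProd_mul_aRefl (w := [i, j, i]) (i := j) (j := j) (by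
      simp only [wProd_cons, wProd_nil, mul_one, LinearEquiv.mul_apply]
      exact aRefl_aRefl_aRefl_root (by rw [h1, h2]; rfl))
    simpa [mul_assoc] using this

section
variable {M : Type*} [Monoid M] {f : Fin (n + 1) → M}

omit [Fact (2 ≤ n)] in
theorem ht_inv_combo {g : AffAut n} {x y : AffWt n} {a b : ℤ} (hx : ht (g⁻¹ x) < 0)
    (hy : ht (g⁻¹ y) < 0) (ha : 0 ≤ a) (hb : 0 < b) : ht (g⁻¹ (a • x + b • y)) < 0 := by
  rw [map_add, map_zsmul, map_zsmul, ht_add, ht_smul, ht_smul]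
  nlinarith

/-- Matsumoto's theorem: a product over a reduced word satisfying the braid relations depends
only on the element of the affine Weyl group. -/
theorem Braid.prod_eq_of_isRed (hf : Braid f) {w w' : List (Fin (n + 1))} (hw : IsRed w)
    (hw' : IsRed w') (h : wProd w = wProd w') : (w.map f).prod = (w'.map f).prod := by
  induction hN : w.length using Nat.strong_induction_on generalizing w w' with
  | _ N ih =>
  have hlen : w.length = w'.length := le_antisymm (hw _ h.symm) (hw' _ h)
  match w, w', hlen with
  | [], [], _ => rfl
  | i :: u, j :: u', hlen =>
  have htail : ∀ {k : Fin (n + 1)} {v v' : List (Fin (n + 1))}, v.length < N → IsRed (k :: v) →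
      IsRed (k :: v') → wProd (k :: v) = wProd (k :: v') → (v.map f).prod = (v'.map f).prod := by
    intro k v v' hv h1 h2 h3
    rw [wProd_cons, wProd_cons] at h3
    exact ih _ hv h1.tail h2.tail (mul_left_cancel h3) rfl
  simp only [List.length_cons] at hN hlen
  by_cases hij : i = j
  · subst hij
    rw [List.map_cons, List.map_cons, List.prod_cons, List.prod_cons,
      htail (by omega) hw hw' h]
  have hi := hw.ht_neg
  have hj := hw'.ht_neg
  rw [← h] at hj
  -- peel off letters from a reduced word
  have peel : ∀ {k l : Fin (n + 1)} {v : List (Fin (n + 1))}, v.length < N → IsRed (k :: v) →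
      ht ((wProd (k :: v))⁻¹ (aRefl k (aRoot l))) < 0 →
      ∃ v', v'.length + 1 = v.length ∧ wProd (l :: v') = wProd v ∧ IsRed (l :: v') ∧
        (v.map f).prod = f l * (v'.map f).prod := by
    intro k l v hv hr hneg
    rw [wProd_cons_inv_apply, aRefl_aRefl] at hneg
    obtain ⟨v', h1, h2, h3⟩ := hr.tail.exchange hneg
    exact ⟨v', h1, h2, h3, by rw [ih _ hv hr.tail h3 h2.symm rfl]; simp⟩
  -- the last step: compare with the word starting with `j`
  have finish : ∀ v, wProd (j :: v) = wProd (i :: u) → v.length + 1 = N →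
      (u'.map f).prod = (v.map f).prod := by
    intro v h1 h2
    refine (htail (k := j) (by omega) ?_ hw' (h1.trans h)).symm
    intro x hx
    have := hw x (hx.trans h1)
    simpa [h2, hN] using this
  have c1 : ht ((wProd (i :: u))⁻¹ (aRefl i (aRoot j))) < 0 := by
    rw [aRefl_cartan, add_comm (aRoot j),
      show (aRoot j : AffWt n) = (1 : ℤ) • aRoot j from (one_smul ℤ _).symm]
    refine ht_inv_combo hi hj ?_ one_pos
    rcases cartan_cases hij with h | h | h | h <;> omega
  obtain ⟨u2, l2, p2, r2, f2⟩ := peel (by omega) hw c1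
  rw [List.map_cons, List.map_cons, List.prod_cons, List.prod_cons, f2]
  have e2 : wProd (i :: u) = aRefl i * (aRefl j * wProd u2) := by
    rw [wProd_cons, ← p2, wProd_cons]
  rcases cartan_cases hij with ⟨hc, hc'⟩ | hc
  · rw [finish (i :: u2) (by
      rw [e2, wProd_cons, wProd_cons, ← mul_assoc, ← mul_assoc, braid_aRefl.comm i j hc hc'])
      (by simp; omega)]
    rw [List.map_cons, List.prod_cons, ← mul_assoc, ← mul_assoc, hf.comm i j hc hc']
  have c2 : ht ((wProd (j :: u2))⁻¹ (aRefl j (aRoot i))) < 0 := by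
    rw [p2]
    have : ht ((wProd (i :: u))⁻¹ (aRefl i (aRefl j (aRoot i)))) < 0 := by
      rw [aRefl_aRefl_root]
      refine ht_inv_combo hi hj ?_ ?_ <;>
      rcases hc with ⟨h, h'⟩ | ⟨h, h'⟩ | ⟨h, h'⟩ <;> rw [h'] <;> norm_num [h]
    rwa [wProd_cons_inv_apply, aRefl_aRefl] at this
  obtain ⟨u3, l3, p3, r3, f3⟩ := peel (by omega) r2 c2
  rw [f3]
  have e3 : wProd (i :: u) = aRefl i * (aRefl j * (aRefl i * wProd u3)) := by
    rw [e2, ← p3, wProd_cons]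
  rcases hc with ⟨hc, hc'⟩ | hc
  · rw [finish (i :: j :: u3) (by
      rw [e3, wProd_cons, wProd_cons, wProd_cons]
      simp only [← mul_assoc]
      rw [braid_aRefl.braid3 i j hc hc'])
      (by simp; omega)]
    simp only [List.map_cons, List.prod_cons]
    simp only [← mul_assoc]
    rw [hf.braid3 i j hc hc']
  have c3 : ht ((wProd (i :: u3))⁻¹ (aRefl i (aRoot j))) < 0 := by
    have h4 : aRefl i (aRefl j (aRefl i (aRoot j))) = (aRoot j : AffWt n) := by
      apply aRefl_aRefl_aRefl_root
      rcases hc with ⟨h, h'⟩ | ⟨h, h'⟩ <;> rw [h, h'] <;> rfl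
    have : ht ((wProd (i :: u))⁻¹ (aRefl i (aRefl j (aRefl i (aRoot j))))) < 0 := by
      rw [h4]; exact hj
    rwa [wProd_cons_inv_apply, aRefl_aRefl, ← p2, wProd_cons_inv_apply, aRefl_aRefl, ← p3] at this
  obtain ⟨u4, l4, p4, r4, f4⟩ := peel (by omega) r3 c3
  rw [f4]
  have e4 : wProd (i :: u) = aRefl i * (aRefl j * (aRefl i * (aRefl j * wProd u4))) := by
    rw [e3, ← p4, wProd_cons]
  have b4 : ∀ {M : Type _} [Monoid M] {f : Fin (n + 1) → M}, Braid f →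
      f i * f j * f i * f j = f j * f i * f j * f i := by
    intro M _ f hf
    rcases hc with ⟨h, h'⟩ | ⟨h, h'⟩
    · exact hf.braid4 i j h h'
    · exact (hf.braid4 j i h' h).symm
  rw [finish (i :: j :: i :: u4) (by
      rw [e4, wProd_cons, wProd_cons, wProd_cons, wProd_cons]
      simp only [← mul_assoc]
      rcases hc with ⟨h, h'⟩ | ⟨h, h'⟩
      · rw [braid_aRefl.braid4 i j h h']
      · rw [braid_aRefl.braid4 j i h' h])
      (by simp; omega)]
  simp only [List.map_cons, List.prod_cons]
  simp only [← mul_assoc]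
  rw [b4 hf]

/-- For involutions satisfying the braid relations the words need not be reduced. -/
theorem Braid.prod_eq (hf : Braid f) (hf2 : ∀ i, f i * f i = 1) {w w' : List (Fin (n + 1))}
    (h : wProd w = wProd w') : (w.map f).prod = (w'.map f).prod := by
  have key : ∀ w : List (Fin (n + 1)), ∃ u, IsRed u ∧ wProd u = wProd w ∧
      (w.map f).prod = (u.map f).prod := by
    intro w
    induction w with
    | nil => exact ⟨[], fun _ _ => by simp, rfl, rfl⟩
    | cons i w ih =>
      obtain ⟨u, hu, hu1, hu2⟩ := ih
      rcases lt_or_gt_of_ne ((isRoot_aRoot i).wProd_inv u).ht_ne_zero with hlt | hgt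
      · obtain ⟨v, -, hv, hv'⟩ := hu.exchange hlt
        refine ⟨v, hv'.tail, ?_, ?_⟩
        · rw [wProd_cons, ← hu1, ← hv, ← wProd_cons, wProd_cons_cons_self]
        · rw [List.map_cons, List.prod_cons, hu2, hf.prod_eq_of_isRed hu hv' hv.symm,
            List.map_cons, List.prod_cons, ← mul_assoc, hf2, one_mul]
      · exact ⟨i :: u, hu.cons hgt, by rw [wProd_cons, hu1, wProd_cons],
          by rw [List.map_cons, List.prod_cons, hu2]; simp⟩
  obtain ⟨u, hu, hu1, hu2⟩ := key w
  obtain ⟨u', hu', hu1', hu2'⟩ := key w'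
  rw [hu2, hu2', hf.prod_eq_of_isRed hu hu' (by rw [hu1, hu1', h])]
end
end Koornwinder

namespace Koornwinder

variable {n : ℕ}

/-! ### Translations -/

/-- The translation `τ(λ)` on integral affine functions. -/
def transl (lam : Weight n) : AffAut n where
  toFun x := (x.1, x.2 + lam ⬝ᵥ x.1)
  invFun x := (x.1, x.2 - lam ⬝ᵥ x.1)
  left_inv x := by simp
  right_inv x := by simp
  map_add' x y := by
    ext
    · simp
    · simp; ring
  map_smul' c x := by
    ext
    · simp
    · simp only [Prod.smul_snd, Prod.smul_fst, dotProduct_smul, smul_eq_mul, RingHom.id_apply]; ring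

theorem transl_apply (lam : Weight n) (x : AffWt n) :
    transl lam x = (x.1, x.2 + lam ⬝ᵥ x.1) := rfl

theorem transl_inv_apply (lam : Weight n) (x : AffWt n) :
    (transl lam)⁻¹ x = (x.1, x.2 - lam ⬝ᵥ x.1) := rfl

theorem transl_mul (lam mu : Weight n) : transl lam * transl mu = transl (lam + mu) := by
  ext x
  · simp [transl_apply]
  · simp [transl_apply]; ring

theorem transl_zero : transl (0 : Weight n) = 1 := by
  ext x <;> simp [transl_apply]

theorem ht_eq_of_fst_eq {x y : AffWt n} (h : x.1 = y.1) :
    ht x = ht y + (2 * n + 2) * (x.2 - y.2) := by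
  simp only [ht, h]; ring

theorem ht_transl_inv (lam : Weight n) (x : AffWt n) :
    ht ((transl lam)⁻¹ x) = ht x - (2 * n + 2) * (lam ⬝ᵥ x.1) := by
  rw [ht_eq_of_fst_eq (y := x) (by rfl), transl_inv_apply]; ring

/-- The positive roots `ε_j - ε_k` (`j < k`), `ε_j + ε_k` and `2ε_j` of the finite root system. -/
def IsPosGrad (v : Weight n) : Prop :=
  ∃ j k : Fin n, (j < k ∧ v = Pi.single j 1 - Pi.single k 1) ∨
    v = Pi.single j 1 + Pi.single k 1

theorem IsRoot.isPosGrad {x : AffWt n} (hx : IsRoot x) {lam : Weight n} (hl : IsDominant lam)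
    (h : 0 < lam ⬝ᵥ x.1) : IsPosGrad x.1 := by
  obtain ⟨j, k, s, t, hs, ht, hst, hx⟩ := hx
  rw [hx, dotProduct_add, dotProduct_single, dotProduct_single] at h
  have hj := hl.2 j
  have hk := hl.2 k
  rcases hs with rfl | rfl <;> rcases ht with rfl | rfl
  · exact ⟨j, k, Or.inr hx⟩
  · refine ⟨j, k, Or.inl ⟨?_, by rw [hx, Pi.single_neg, sub_eq_add_neg]⟩⟩
    by_contra hc
    have := hl.1 (not_lt.mp hc)
    omega
  · refine ⟨k, j, Or.inl ⟨?_, by rw [hx, Pi.single_neg]; abel⟩⟩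
    by_contra hc
    have := hl.1 (not_lt.mp hc)
    omega
  · omega

theorem IsPosGrad.dot_nonneg {v : Weight n} (hv : IsPosGrad v) {lam : Weight n}
    (hl : IsDominant lam) : 0 ≤ lam ⬝ᵥ v := by
  obtain ⟨j, k, ⟨hjk, rfl⟩ | rfl⟩ := hv
  · have := hl.1 hjk.le
    simpa [dotProduct_sub]
  · have := hl.2 j
    have := hl.2 k
    simp [dotProduct_add]; omega

section
variable [Fact (2 ≤ n)]

/-- The roots along a reduced word are the positive roots made negative by the inverse. -/
theorem IsRed.ht_root {u v : List (Fin (n + 1))} {i : Fin (n + 1)} (h : IsRed (u ++ i :: v)) :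
    0 < ht (wProd u (aRoot i)) ∧ ht ((wProd (u ++ i :: v))⁻¹ (wProd u (aRoot i))) < 0 := by
  constructor
  · have h1 : IsRed (i :: u.reverse) := by
      have := h.reverse
      rw [List.reverse_append, List.reverse_cons, List.append_assoc] at this
      exact this.of_append
    have h2 := h1.ht_neg
    rw [ht_wProd_cons_inv, wProd_reverse, inv_inv] at h2
    omega
  · have h2 := h.of_append.ht_neg
    rw [wProd_append, mul_inv_rev, LinearEquiv.mul_apply, inv_apply_apply]
    exact h2

theorem IsRed.transl_root {u v : List (Fin (n + 1))} {i : Fin (n + 1)} (h : IsRed (u ++ i :: v))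
    {lam : Weight n} (hl : IsDominant lam) (hw : wProd (u ++ i :: v) = transl lam) :
    IsPosGrad (wProd u (aRoot i)).1 := by
  obtain ⟨h1, h2⟩ := h.ht_root
  rw [hw, ht_transl_inv] at h2
  refine ((isRoot_aRoot i).wProd u).isPosGrad hl ?_
  by_contra hc
  have : (2 * (n : ℤ) + 2) * (lam ⬝ᵥ (wProd u (aRoot i)).1) ≤ 0 :=
    mul_nonpos_of_nonneg_of_nonpos (by omega) (not_lt.mp hc)
  omega

/-- Lengths of dominant translations add. -/
theorem IsRed.append_transl {w w' : List (Fin (n + 1))} (hw : IsRed w) (hw' : IsRed w')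
    {lam mu : Weight n} (hl : IsDominant lam) (hm : IsDominant mu) (h : wProd w = transl lam)
    (h' : wProd w' = transl mu) : IsRed (w ++ w') := by
  suffices key : ∀ v u, w = u ++ v → IsRed (v ++ w') from key w [] rfl
  intro v
  induction v with
  | nil => intro _ _; exact hw'
  | cons i v ih =>
    intro u hu
    refine (ih (u ++ [i]) (by simp [hu])).cons ?_
    subst hu
    have hpos := hw.transl_root hl h
    obtain ⟨-, h2⟩ := hw.ht_root
    have e : (wProd (v ++ w'))⁻¹ (aRoot i) =
        -(transl (lam + mu))⁻¹ (wProd u (aRoot i)) := by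
      rw [← transl_mul, ← h, ← h']
      simp only [wProd_append, wProd_cons, mul_inv_rev, LinearEquiv.mul_apply, aRefl_inv]
      rw [inv_apply_apply, aRefl_aRoot, map_neg, map_neg, neg_neg]
    rw [e, Koornwinder.ht_neg, ht_transl_inv, add_dotProduct, mul_add]
    rw [h, ht_transl_inv] at h2
    have := mul_nonneg (show 0 ≤ 2 * (n : ℤ) + 2 by omega) (hpos.dot_nonneg hm)
    omega

/-! ### Comparison with the real affine functions -/

/-- Integral affine functions as real affine functions. -/
def toAffFun (x : AffWt n) : AffFun n := (fun j => (x.1 j : ℝ), (x.2 : ℝ))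

omit [Fact (2 ≤ n)] in
theorem toAffFun_injective : Function.Injective (toAffFun : AffWt n → AffFun n) := by
  intro x y h
  simp only [toAffFun, Prod.mk.injEq] at h
  ext j
  · exact_mod_cast congrFun h.1 j
  · exact_mod_cast h.2

omit [Fact (2 ≤ n)] in
theorem end_eq_of_toAffFun {A B : Module.End ℝ (AffFun n)}
    (h : ∀ x : AffWt n, A (toAffFun x) = B (toAffFun x)) : A = B := by
  have hx : ∀ f : AffFun n, f = ∑ j, f.1 j • toAffFun ((Pi.single j 1, 0) : AffWt n) +
      f.2 • toAffFun ((0, 1) : AffWt n) := by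
    intro f
    ext k
    · simp [toAffFun, Prod.fst_sum, Finset.sum_apply, Pi.single_apply]
    · simp [toAffFun, Prod.snd_sum]
  refine LinearMap.ext fun f => ?_
  rw [hx f]
  simp only [map_add, map_sum, map_smul, h]

omit [Fact (2 ≤ n)] in
theorem cast_dotProduct (v w : Weight n) :
    (fun j => (v j : ℝ)) ⬝ᵥ (fun j => (w j : ℝ)) = ((v ⬝ᵥ w : ℤ) : ℝ) := by
  simp [dotProduct]

theorem reflection_toAffFun (i : Fin (n + 1)) (x : AffWt n) :
    reflection (simpleRoot i) (toAffFun x) = toAffFun (aRefl i x) := by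
  have h1 := root_dot_self_mul_pairing x.1 i
  have h2 : ((rootGrad i : Weight n) ⬝ᵥ rootGrad i : ℤ) ≠ 0 := (root_dot_self_pos i).ne'
  have h3 : (2 * (((x.1 ⬝ᵥ rootGrad i : ℤ)) : ℝ) / ((rootGrad i ⬝ᵥ rootGrad i : ℤ) : ℝ)) =
      (pairing x.1 i : ℝ) := by
    rw [div_eq_iff (by exact_mod_cast h2), mul_comm (pairing x.1 i : ℝ)]
    exact_mod_cast h1.symm
  simp only [reflection, LinearMap.coe_mk, AddHom.coe_mk, toAffFun, simpleRoot, cast_dotProduct, h3,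
    aRefl_apply, aRoot]
  ext j <;> simp

theorem wordProd_toAffFun (w : List (Fin (n + 1))) (x : AffWt n) :
    wordProd w (toAffFun x) = toAffFun (wProd w x) := by
  induction w with
  | nil => simp [wordProd]
  | cons i w ih =>
    have : wordProd (i :: w) = reflection (simpleRoot i) * wordProd w := by simp [wordProd]
    rw [this, Module.End.mul_apply, ih, reflection_toAffFun, wProd_cons, LinearEquiv.mul_apply]

omit [Fact (2 ≤ n)] in
theorem translation_toAffFun (lam : Weight n) (x : AffWt n) :
    translation lam (toAffFun x) = toAffFun (transl lam x) := by
  simp only [translation, LinearMap.coe_mk, AddHom.coe_mk, toAffFun, cast_dotProduct, transl_apply]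
  ext <;> simp

theorem wordProd_eq_translation_iff {w : List (Fin (n + 1))} {lam : Weight n} :
    wordProd w = translation lam ↔ wProd w = transl lam := by
  constructor
  · intro h
    apply LinearEquiv.ext
    intro x
    apply toAffFun_injective
    rw [← wordProd_toAffFun, h, translation_toAffFun]
  · intro h
    apply end_eq_of_toAffFun
    intro x
    rw [wordProd_toAffFun, h, translation_toAffFun]

theorem isReducedWord_iff {w : List (Fin (n + 1))} {lam : Weight n} :
    IsReducedWord w (translation lam) ↔ wProd w = transl lam ∧ IsRed w := by
  unfold IsReducedWord
  rw [wordProd_eq_translation_iff]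
  refine and_congr_right fun h => forall_congr' fun w' => ?_
  rw [wordProd_eq_translation_iff, h]

/-- `T_{τ(λ)}` is the product over some reduced word of `τ(λ)`. -/
theorem exists_heckeElt_eq (p : Parameters) {lam : Weight n} (h : ∃ w, wProd w = transl lam) :
    ∃ w, wProd w = transl lam ∧ IsRed w ∧ heckeElt p (translation lam) = heckeWord p w := by
  obtain ⟨w, hw⟩ := h
  obtain ⟨u, hu, hr⟩ := exists_isRed w
  have hex : ∃ w, IsReducedWord w (translation lam) :=
    ⟨u, isReducedWord_iff.mpr ⟨hu.trans hw, hr⟩⟩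
  obtain ⟨h1, h2⟩ := isReducedWord_iff.mp hex.choose_spec
  exact ⟨hex.choose, h1, h2, by rw [heckeElt, dif_pos hex]⟩
end
end Koornwinder

namespace Koornwinder

variable {n : ℕ} [Fact (2 ≤ n)]

/-! ### A character of the translation lattice -/

/-- The linear part of `s_i`. -/
def wRefl (i : Fin (n + 1)) (v : Weight n) : Weight n := v - pairing v i • rootGrad i

theorem aRefl_fst (i : Fin (n + 1)) (x : AffWt n) : (aRefl i x).1 = wRefl i x.1 := rfl

omit [Fact (2 ≤ n)] in
theorem pairing_wRefl (i j : Fin (n + 1)) (v : Weight n) :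
    pairing (wRefl i v) j = pairing v j - pairing v i * cartan j i := by
  rw [wRefl, pairing_sub, pairing_smul]; rfl

theorem cartan_self (i : Fin (n + 1)) : cartan i i = 2 := pairing_root_self i

theorem wRefl_wRefl (i : Fin (n + 1)) (v : Weight n) : wRefl i (wRefl i v) = v :=
  congrArg Prod.fst (aRefl_aRefl i ((v, 0) : AffWt n))

/-- The operator `f(ν) ↦ τ_i^{sgn ⟨ν, a_i^∨⟩} f(s_i ν)`. -/
noncomputable def signOp (τ : Fin (n + 1) → ℂ) (i : Fin (n + 1)) : Module.End ℂ (Weight n → ℂ) where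
  toFun f v := τ i ^ (pairing v i).sign * f (wRefl i v)
  map_add' f g := by funext v; simp [mul_add]
  map_smul' c f := by funext v; simp; ring

omit [Fact (2 ≤ n)] in
theorem signOp_apply (τ : Fin (n + 1) → ℂ) (i : Fin (n + 1)) (f : Weight n → ℂ) (v : Weight n) :
    signOp τ i f v = τ i ^ (pairing v i).sign * f (wRefl i v) := rfl

variable {τ : Fin (n + 1) → ℂ}

theorem signOp_mul_self (hτ : ∀ i, τ i ≠ 0) (i : Fin (n + 1)) :
    signOp τ i * signOp τ i = 1 := by
  ext1 f; funext v
  rw [Module.End.mul_apply, signOp_apply, signOp_apply, pairing_wRefl, cartan_self, wRefl_wRefl,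
    show pairing v i - pairing v i * 2 = -pairing v i by ring, Int.sign_neg, ← mul_assoc,
    ← zpow_add₀ (hτ i)]
  simp

theorem wRefl_word_eq {u v : List (Fin (n + 1))} (h : wProd u = wProd v) (x : Weight n) :
    (wProd u ((x, 0) : AffWt n)).1 = (wProd v ((x, 0) : AffWt n)).1 := by rw [h]

theorem braid_signOp (hτ : ∀ i j, cartan i j = -1 → cartan j i = -1 → τ i = τ j) :
    Braid (signOp τ) where
  comm i j h h' := by
    ext1 f; funext v
    have := wRefl_word_eq (u := [j, i]) (v := [i, j])
      (by simpa using (braid_aRefl.comm i j h h').symm) v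
    simp only [wProd_cons, wProd_nil, mul_one, LinearEquiv.mul_apply, aRefl_fst] at this
    simp only [Module.End.mul_apply, signOp_apply, pairing_wRefl, h, h', this]
    ring_nf
  braid3 i j h h' := by
    ext1 f; funext v
    have := wRefl_word_eq (u := [i, j, i]) (v := [j, i, j])
      (by simpa [mul_assoc] using braid_aRefl.braid3 i j h h') v
    simp only [wProd_cons, wProd_nil, mul_one, LinearEquiv.mul_apply, aRefl_fst] at this
    simp only [Module.End.mul_apply, signOp_apply, pairing_wRefl, h, h', this, cartan_self,
      hτ i j h h']
    ring_nf
  braid4 i j h h' := by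
    ext1 f; funext v
    have := wRefl_word_eq (u := [i, j, i, j]) (v := [j, i, j, i])
      (by simpa [mul_assoc] using braid_aRefl.braid4 i j h h') v
    simp only [wProd_cons, wProd_nil, mul_one, LinearEquiv.mul_apply, aRefl_fst] at this
    simp only [Module.End.mul_apply, signOp_apply, pairing_wRefl, h, h', this, cartan_self]
    ring_nf

/-- The product of `τ_i^{± 1}` over the roots along a word, with signs given by `v`. -/
noncomputable def signProd (τ : Fin (n + 1) → ℂ) : List (Fin (n + 1)) → Weight n → ℂ
  | [], _ => 1
  | i :: w, v => τ i ^ (pairing v i).sign * signProd τ w (wRefl i v)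

omit [Fact (2 ≤ n)] in
theorem signProd_eq (w : List (Fin (n + 1))) (v : Weight n) :
    (w.map (signOp τ)).prod 1 v = signProd τ w v := by
  induction w generalizing v with
  | nil => simp [signProd]
  | cons i w ih => simp [signProd, signOp_apply, ih]

theorem signProd_append (u w : List (Fin (n + 1))) (v : Weight n) :
    signProd τ (u ++ w) v = signProd τ u v * signProd τ w ((wProd u)⁻¹ ((v, 0) : AffWt n)).1 := by
  induction u generalizing v with
  | nil => simp [signProd]
  | cons i u ih =>
    rw [List.cons_append, signProd, ih, signProd, mul_assoc, wProd_cons_inv_apply]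
    congr 3
    have key : ∀ (u : List (Fin (n + 1))) (x y : AffWt n), x.1 = y.1 →
        (wProd u x).1 = (wProd u y).1 := by
      intro u x y h
      induction u with
      | nil => simpa
      | cons i u ih => simp only [wProd_cons, LinearEquiv.mul_apply, aRefl_fst, ih]
    rw [← wProd_reverse]
    exact key _ _ _ rfl

/-- Words with the same product have the same `signProd`. -/
theorem signProd_congr (hτ0 : ∀ i, τ i ≠ 0)
    (hτ : ∀ i j, cartan i j = -1 → cartan j i = -1 → τ i = τ j) {w w' : List (Fin (n + 1))}
    (h : wProd w = wProd w') (v : Weight n) : signProd τ w v = signProd τ w' v := by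
  rw [← signProd_eq, ← signProd_eq, (braid_signOp hτ).prod_eq (signOp_mul_self hτ0) h]

/-- Some word for `g` has the function `χ` as its `signProd`. -/
def HasSign (τ : Fin (n + 1) → ℂ) (g : AffAut n) (χ : Weight n → ℂ) : Prop :=
  ∃ w, wProd w = g ∧ ∀ v, signProd τ w v = χ v

theorem HasSign.mul {g h : AffAut n} {χ ψ : Weight n → ℂ} (hg : HasSign τ g χ)
    (hh : HasSign τ h ψ) :
    HasSign τ (g * h) fun v => χ v * ψ (g⁻¹ ((v, 0) : AffWt n)).1 := by
  obtain ⟨u, rfl, hu⟩ := hg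
  obtain ⟨w, rfl, hw⟩ := hh
  exact ⟨u ++ w, wProd_append _ _, fun v => by rw [signProd_append, hu, hw]⟩

theorem hasSign_aRefl (τ : Fin (n + 1) → ℂ) (i : Fin (n + 1)) :
    HasSign τ (aRefl i) fun v => τ i ^ (pairing v i).sign :=
  ⟨[i], by simp, fun v => by simp [signProd]⟩

/-- Conjugation by a simple reflection. -/
theorem HasSign.conj {g : AffAut n} {χ : Weight n → ℂ} (hg : HasSign τ g χ) (i : Fin (n + 1)) :
    HasSign τ (aRefl i * g * aRefl i) fun v => τ i ^ (pairing v i).sign * χ (wRefl i v) *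
      τ i ^ (pairing (g⁻¹ (aRefl i ((v, 0) : AffWt n))).1 i).sign := by
  have := ((hasSign_aRefl τ i).mul hg).mul (hasSign_aRefl τ i)
  simpa only [aRefl_inv, aRefl_fst, mul_inv_rev, LinearEquiv.mul_apply] using this

/-- The exponent `∑_{k ∈ s} sgn (v_j - v_k) + sgn (v_j + v_k)`. -/
def signSum (s : Finset (Fin n)) (j : Fin n) (v : Weight n) : ℤ :=
  ∑ k ∈ s, ((v j - v k).sign + (v j + v k).sign)

/-- The sign change of the `j`-th coordinate. -/
def negCoord (j : Fin n) : AffAut n where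
  toFun x := (Function.update x.1 j (-x.1 j), x.2)
  invFun x := (Function.update x.1 j (-x.1 j), x.2)
  left_inv x := by simp
  right_inv x := by simp
  map_add' x y := by
    ext k
    · by_cases h : k = j
      · subst h; simp; ring
      · simp [h]
    · simp
  map_smul' c x := by
    ext k
    · by_cases h : k = j
      · subst h; simp
      · simp [h]
    · simp

omit [Fact (2 ≤ n)] in
theorem negCoord_apply (j : Fin n) (x : AffWt n) :
    negCoord j x = (Function.update x.1 j (-x.1 j), x.2) := rfl

omit [Fact (2 ≤ n)] in
theorem negCoord_inv (j : Fin n) : (negCoord j)⁻¹ = negCoord j := rfl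

theorem middle_cases {j k : Fin n} (hjk : (j : ℕ) + 1 = k) : ∃ i : Fin (n + 1), (i : ℕ) = k ∧
    (∀ x : AffWt n, aRefl i x = (x.1 ∘ Equiv.swap j k, x.2)) ∧
    (∀ v : Weight n, pairing v i = v j - v k) := by
  have hk := k.isLt
  refine ⟨⟨k, by omega⟩, rfl, ?_, ?_⟩
  · rcases aRefl_cases (⟨k, by omega⟩ : Fin (n + 1)) with ⟨a, -, h, -⟩ | ⟨a, -, h, -⟩ |
      ⟨a, b, hab, h, h'⟩
    · simp at h; omega
    · simp at h; omega
    · have e1 : b = k := Fin.ext h.symm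
      subst e1
      have e2 : a = j := Fin.ext (by omega)
      subst e2
      exact h'
  · rcases simple_cases (⟨k, by omega⟩ : Fin (n + 1)) with ⟨a, -, h, -⟩ | ⟨a, -, h, -⟩ |
      ⟨a, b, hab, h, -, h', -⟩
    · simp at h; omega
    · simp at h; omega
    · have e1 : b = k := Fin.ext h.symm
      subst e1
      have e2 : a = j := Fin.ext (by omega)
      subst e2
      intro v
      simp [pairing, h', dotProduct_sub]

/-- Values that are constant on the simple roots `ε_i - ε_{i+1}`. -/
structure SignData (τ : Fin (n + 1) → ℂ) (t0 t tn : ℂ) : Prop where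
  ne : ∀ i, τ i ≠ 0
  zero : τ 0 = t0
  last : τ (Fin.last n) = tn
  mid : ∀ i : Fin (n + 1), (i : ℕ) ≠ 0 → (i : ℕ) ≠ n → τ i = t

variable {t0 t tn : ℂ}

theorem SignData.t_ne (h : SignData τ t0 t tn) : t ≠ 0 := by
  have hn := Fact.out (p := 2 ≤ n)
  rw [← h.mid ⟨1, by omega⟩ (by simp) (by simp; omega)]
  exact h.ne _

theorem hasSign_negCoord (h : SignData τ t0 t tn) (j : Fin n) :
    HasSign τ (negCoord j) fun v => tn ^ (v j).sign * t ^ signSum (Finset.Ioi j) j v := by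
  have hn := Fact.out (p := 2 ≤ n)
  obtain ⟨m, hm⟩ : ∃ m, (j : ℕ) + m + 1 = n := ⟨n - 1 - j, by omega⟩
  induction m generalizing j with
  | zero =>
    obtain ⟨w, hw1, hw2⟩ := hasSign_aRefl τ (Fin.last n)
    rcases aRefl_cases (Fin.last n) with ⟨a, -, e, -⟩ | ⟨a, ha, -, e⟩ | ⟨a, b, hab, e, -⟩
    · simp at e; omega
    · have : a = j := Fin.ext (by omega)
      subst this
      refine ⟨w, hw1.trans (LinearEquiv.ext e), fun v => ?_⟩
      have hI : Finset.Ioi a = ∅ := by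
        ext k
        simp only [Finset.mem_Ioi, Fin.lt_def, Finset.notMem_empty, iff_false]
        omega
      have hp : pairing v (Fin.last n) = v a := by
        rcases simple_cases (Fin.last n) with ⟨b, -, e, -⟩ | ⟨b, hb, -, -, e', -⟩ |
          ⟨b, c, hbc, e, -⟩
        · simp at e; omega
        · have : b = a := Fin.ext (by omega)
          subst this
          simp [pairing, e']
        · have := c.isLt
          simp at e; omega
      simp [hw2, h.last, signSum, hI, hp]
    · have := b.isLt
      simp at e; omega
  | succ m ih =>
    obtain ⟨k, hk⟩ : ∃ k : Fin n, (j : ℕ) + 1 = k := ⟨⟨j + 1, by omega⟩, rfl⟩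
    obtain ⟨i, hi, hs, hp⟩ := middle_cases hk
    have hjk : j ≠ k := fun e => by subst e; omega
    obtain ⟨w, hw1, hw2⟩ := (ih k (by omega)).conj i
    have hti : τ i = t := h.mid i (by omega) (by omega)
    refine ⟨w, hw1.trans ?_, fun v => (hw2 v).trans ?_⟩
    · apply LinearEquiv.ext
      intro x
      simp only [LinearEquiv.mul_apply, hs, negCoord_apply]
      ext l
      · by_cases hlj : l = j
        · subst hlj; simp
        · by_cases hlk : l = k
          · subst hlk; simp [hjk, hlj]
          · simp [Equiv.swap_apply_of_ne_of_ne hlj hlk, hlj, hlk]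
      · rfl
    · have hI : Finset.Ioi j = insert k (Finset.Ioi k) := by
        ext l
        simp only [Finset.mem_Ioi, Finset.mem_insert, Fin.lt_def, Fin.ext_iff]
        omega
      have hv : wRefl i v = v ∘ Equiv.swap j k := congrArg Prod.fst (hs (v, 0))
      have hS : signSum (Finset.Ioi k) k (v ∘ Equiv.swap j k) = signSum (Finset.Ioi k) j v := by
        apply Finset.sum_congr rfl
        intro l hl
        rw [Finset.mem_Ioi, Fin.lt_def] at hl
        have h1 : l ≠ j := fun e => by subst e; omega
        have h2 : l ≠ k := fun e => by subst e; omega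
        simp [Equiv.swap_apply_of_ne_of_ne h1 h2]
      beta_reduce
      rw [hti, hv, hS, hp, hs, negCoord_inv, negCoord_apply, hp]
      have hS' : signSum (Finset.Ioi j) j v =
          (v j - v k).sign + (v j + v k).sign + signSum (Finset.Ioi k) j v := by
        rw [signSum, hI, Finset.sum_insert (by simp)]; rfl
      rw [hS', zpow_add₀ h.t_ne, zpow_add₀ h.t_ne]
      simp [hjk]
      rw [add_comm (v k)]
      ring

theorem hasSign_transl_single (h : SignData τ t0 t tn) (j : Fin n) :
    HasSign τ (transl (Pi.single j 1)) fun v =>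
      (t0 * tn) ^ (v j).sign * t ^ signSum (Finset.univ.erase j) j v := by
  have hn := Fact.out (p := 2 ≤ n)
  obtain ⟨m, hm⟩ : ∃ m, (j : ℕ) = m := ⟨j, rfl⟩
  induction m generalizing j with
  | zero =>
    obtain ⟨w, hw1, hw2⟩ := (hasSign_negCoord h j).mul (hasSign_aRefl τ 0)
    refine ⟨w, hw1.trans ?_, fun v => (hw2 v).trans ?_⟩
    · rcases aRefl_cases (0 : Fin (n + 1)) with ⟨a, ha, -, e⟩ | ⟨a, ha, e, -⟩ | ⟨a, b, hab, e, -⟩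
      · have : a = j := Fin.ext (by omega)
        subst this
        apply LinearEquiv.ext
        intro x
        rw [LinearEquiv.mul_apply, e, negCoord_apply, transl_apply]
        simp
      · simp at e; omega
      · simp at e; omega
    · have hI : Finset.Ioi j = Finset.univ.erase j := by
        ext k
        simp only [Finset.mem_Ioi, Fin.lt_def, Finset.mem_erase, Finset.mem_univ, and_true, ne_eq,
          Fin.ext_iff]
        omega
      have hp : ∀ v : Weight n, pairing v 0 = -v j := by
        intro v
        rcases simple_cases (0 : Fin (n + 1)) with ⟨b, hb, -, -, e, -⟩ | ⟨b, -, e, -⟩ |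
          ⟨b, c, hbc, e, -⟩
        · have : b = j := Fin.ext (by omega)
          subst this
          simp [pairing, e]
        · simp at e; omega
        · simp at e; omega
      beta_reduce
      rw [hI, h.zero, hp, negCoord_inv, negCoord_apply]
      simp [mul_zpow]
      ring
  | succ m ih =>
    obtain ⟨k, hk⟩ : ∃ k : Fin n, (k : ℕ) + 1 = j := ⟨⟨m, by omega⟩, by simp [hm]⟩
    obtain ⟨i, hi, hs, hp⟩ := middle_cases hk
    have hjk : k ≠ j := fun e => by subst e; omega
    obtain ⟨w, hw1, hw2⟩ := (ih k (by omega)).conj i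
    have hti : τ i = t := h.mid i (by omega) (by omega)
    refine ⟨w, hw1.trans ?_, fun v => (hw2 v).trans ?_⟩
    · apply LinearEquiv.ext
      intro x
      simp only [LinearEquiv.mul_apply, hs, transl_apply]
      ext l
      · simp
      · simp
    · have hv : wRefl i v = v ∘ Equiv.swap k j := congrArg Prod.fst (hs (v, 0))
      have hS : signSum (Finset.univ.erase k) k (v ∘ Equiv.swap k j) =
          signSum (Finset.univ.erase j) j v := by
        apply Finset.sum_equiv (Equiv.swap k j)
        · intro l
          simp [Equiv.swap_apply_eq_iff]
        · intro l _
          simp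
      beta_reduce
      rw [hti, hv, hS, hp, transl_inv_apply, hs, hp]
      simp
      rw [show v j - v k = -(v k - v j) by ring, Int.sign_neg, zpow_neg]
      have := zpow_ne_zero (v k - v j).sign h.t_ne
      field_simp

/-- The character by which the translations act. -/
theorem hasSign_transl (h : SignData τ t0 t tn) {lam : Weight n} (hl : ∀ j, 0 ≤ lam j) :
    HasSign τ (transl lam) fun v =>
      ∏ j, ((t0 * tn) ^ (v j).sign * t ^ signSum (Finset.univ.erase j) j v) ^ lam j := by
  have one : HasSign τ 1 fun _ => 1 := ⟨[], rfl, fun v => rfl⟩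
  have mul : ∀ {lam mu : Weight n} {χ ψ : Weight n → ℂ}, HasSign τ (transl lam) χ →
      HasSign τ (transl mu) ψ → HasSign τ (transl (lam + mu)) fun v => χ v * ψ v := by
    intro lam mu χ ψ h1 h2
    rw [← transl_mul]
    exact h1.mul h2
  have single : ∀ (j : Fin n) (m : ℕ), HasSign τ (transl (Pi.single j (m : ℤ))) fun v =>
      ((t0 * tn) ^ (v j).sign * t ^ signSum (Finset.univ.erase j) j v) ^ (m : ℤ) := by
    intro j m
    induction m with
    | zero => simpa [transl_zero] using one
    | succ m ih =>
      have := mul ih (hasSign_transl_single h j)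
      rw [← Pi.single_add] at this
      push_cast
      simpa only [zpow_natCast, ← pow_succ, ← Nat.cast_succ] using this
  have key : ∀ s : Finset (Fin n), HasSign τ (transl (∑ j ∈ s, Pi.single j (lam j))) fun v =>
      ∏ j ∈ s, ((t0 * tn) ^ (v j).sign * t ^ signSum (Finset.univ.erase j) j v) ^ lam j := by
    intro s
    induction s using Finset.induction_on with
    | empty => simpa [transl_zero] using one
    | insert j s hj ih =>
      simp only [Finset.sum_insert hj, Finset.prod_insert hj]
      obtain ⟨m, hm⟩ := Int.eq_ofNat_of_zero_le (hl j)
      refine mul ?_ ih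
      rw [hm]
      exact single j m
  have := key Finset.univ
  rwa [Finset.univ_sum_single] at this
end Koornwinder

namespace Koornwinder

/-! ### Braid relations for Demazure-Lusztig operators over a field -/

section
variable {K : Type*} [Field K]

/-- The operator `t + t⁻¹ v (σ - 1)`. -/
def dlOp (t v : K) (σ : K →+* K) (f : K) : K := t * f + t⁻¹ * v * (σ f - f)

theorem dlOp_eq (t v : K) (σ : K →+* K) (f : K) :
    dlOp t v σ f = (t - t⁻¹ * v) * f + t⁻¹ * v * σ f := by
  rw [dlOp]; ring

theorem dlOp_comm {t u v w : K} {σ τ : K →+* K} (h : ∀ f, σ (τ f) = τ (σ f)) (h1 : σ u = u)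
    (h2 : σ w = w) (h3 : τ t = t) (h4 : τ v = v) (f : K) :
    dlOp t v σ (dlOp u w τ f) = dlOp u w τ (dlOp t v σ f) := by
  simp only [dlOp, map_add, map_sub, map_mul, map_inv₀, h1, h2, h3, h4, h]
  ring

theorem dlOp_inv {t v : K} {σ : K →+* K} (h : ∀ f, σ (σ f) = f) (ht : t ≠ 0) (h1 : σ t = t)
    (h2 : v + σ v = 1 + t ^ 2) (f : K) :
    dlOp t v σ (dlOp t v σ f) - (t - t⁻¹) * dlOp t v σ f = f := by
  simp only [dlOp, map_add, map_sub, map_mul, map_inv₀, h1, h, eq_sub_of_add_eq' h2]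
  field_simp
  ring

theorem dlOp_braid3 {t X Y : K} {σ τ : K →+* K} (h : ∀ f, σ (τ (σ f)) = τ (σ (τ f)))
    (hσ : ∀ f, σ (σ f) = f) (hτ : ∀ f, τ (τ f) = f)
    (ht : t ≠ 0) (hX : X ≠ 0) (hY : Y ≠ 0) (hX1 : 1 - X ≠ 0) (hY1 : 1 - Y ≠ 0)
    (hXY : 1 - X * Y ≠ 0) (h1 : σ t = t) (h2 : τ t = t) (h3 : σ X = X⁻¹) (h4 : σ Y = X * Y)
    (h5 : τ X = X * Y) (h6 : τ Y = Y⁻¹) (f : K) :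
    dlOp t ((1 - t ^ 2 * X) / (1 - X)) σ (dlOp t ((1 - t ^ 2 * Y) / (1 - Y)) τ
      (dlOp t ((1 - t ^ 2 * X) / (1 - X)) σ f)) =
    dlOp t ((1 - t ^ 2 * Y) / (1 - Y)) τ (dlOp t ((1 - t ^ 2 * X) / (1 - X)) σ
      (dlOp t ((1 - t ^ 2 * Y) / (1 - Y)) τ f)) := by
  have eX : (1 - t ^ 2 * X⁻¹) / (1 - X⁻¹) = (t ^ 2 - X) / (1 - X) := by
    have : 1 - X⁻¹ ≠ 0 := by
      intro h; apply hX1; field_simp at h; linear_combination -h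
    rw [div_eq_div_iff this hX1]
    field_simp
    ring
  have eY : (1 - t ^ 2 * Y⁻¹) / (1 - Y⁻¹) = (t ^ 2 - Y) / (1 - Y) := by
    have : 1 - Y⁻¹ ≠ 0 := by
      intro h; apply hY1; field_simp at h; linear_combination -h
    rw [div_eq_div_iff this hY1]
    field_simp
    ring
  simp only [dlOp, map_add, map_sub, map_mul, map_inv₀, map_div₀, map_pow, map_one, h1, h2, h3, h4,
    h5, h6, hσ, hτ, h, eX, eY, 
    inv_mul_cancel_left₀ hX, mul_inv_cancel_right₀ hY]
  generalize τ (σ (τ f)) = f0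
  generalize σ (τ f) = f1
  generalize τ (σ f) = f2
  generalize σ f = f3
  generalize τ f = f4
  field_simp
  ring

theorem dlOp_braid4 {t u a X Y : K} {σ τ : K →+* K}
    (h : ∀ f, σ (τ (σ (τ f))) = τ (σ (τ (σ f))))
    (hσ : ∀ f, σ (σ f) = f) (hτ : ∀ f, τ (τ f) = f)
    (ht : t ≠ 0) (hu : u ≠ 0) (ha : a ≠ 0) (hX : X ≠ 0) (hY : Y ≠ 0) (hX1 : 1 - X ≠ 0)
    (hY1 : 1 - Y ^ 2 ≠ 0) (hXY : 1 - X * Y ^ 2 ≠ 0) (hXY' : 1 - X ^ 2 * Y ^ 2 ≠ 0)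
    (h1 : σ t = t) (h2 : τ t = t) (h1' : σ u = u) (h2' : τ u = u) (h1a : σ a = a) (h2a : τ a = a)
    (h3 : σ X = X⁻¹) (h4 : σ Y = X * Y) (h5 : τ X = X * Y ^ 2) (h6 : τ Y = Y⁻¹) (f : K) :
    dlOp t ((1 - t ^ 2 * X) / (1 - X)) σ
      (dlOp u ((1 - u * a * Y) * (1 + u * a⁻¹ * Y) / (1 - Y ^ 2)) τ
      (dlOp t ((1 - t ^ 2 * X) / (1 - X)) σ
      (dlOp u ((1 - u * a * Y) * (1 + u * a⁻¹ * Y) / (1 - Y ^ 2)) τ f))) =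
    dlOp u ((1 - u * a * Y) * (1 + u * a⁻¹ * Y) / (1 - Y ^ 2)) τ
      (dlOp t ((1 - t ^ 2 * X) / (1 - X)) σ
      (dlOp u ((1 - u * a * Y) * (1 + u * a⁻¹ * Y) / (1 - Y ^ 2)) τ
      (dlOp t ((1 - t ^ 2 * X) / (1 - X)) σ f))) := by
  obtain ⟨A, hA⟩ : ∃ A, A = fun Z : K => t - t⁻¹ * ((1 - t ^ 2 * Z) / (1 - Z)) := ⟨_, rfl⟩
  obtain ⟨C, hC⟩ : ∃ C, C = fun Z : K =>
    u - u⁻¹ * ((1 - u * a * Z) * (1 + u * a⁻¹ * Z) / (1 - Z ^ 2)) := ⟨_, rfl⟩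
  have S : ∀ f, dlOp t ((1 - t ^ 2 * X) / (1 - X)) σ f = A X * f + (t - A X) * σ f := by
    intro f; rw [dlOp_eq, hA]; ring
  have T : ∀ f, dlOp u ((1 - u * a * Y) * (1 + u * a⁻¹ * Y) / (1 - Y ^ 2)) τ f =
      C Y * f + (u - C Y) * τ f := by
    intro f; rw [dlOp_eq, hC]; ring
  have mA : ∀ (ρ : K →+* K), ρ t = t → ∀ Z, ρ (A Z) = A (ρ Z) := by
    intro ρ e Z; simp [hA, e]
  have mC : ∀ (ρ : K →+* K), ρ u = u → ρ a = a → ∀ Z, ρ (C Z) = C (ρ Z) := by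
    intro ρ e e' Z; simp [hC, e, e']
  have x1 : X⁻¹ * (X * Y) = Y := inv_mul_cancel_left₀ hX Y
  have x2 : X⁻¹ * (X * Y) ^ 2 = X * Y ^ 2 := by field_simp
  have x3 : X * Y ^ 2 * Y⁻¹ = X * Y := by field_simp
  have x4 : X * Y ^ 2 * Y⁻¹ ^ 2 = X := by field_simp
  have inv_ne : ∀ Z : K, 1 - Z ≠ 0 → 1 - Z⁻¹ ≠ 0 := by
    intro Z h1 h2
    have : Z⁻¹ = 1 := by linear_combination -h2
    rw [inv_eq_one] at this
    simp [this] at h1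
  have iA : ∀ Z, Z ≠ 0 → 1 - Z ≠ 0 → A Z⁻¹ = t - t⁻¹ - A Z := by
    intro Z h0 h1
    have h2 := inv_ne Z h1
    have h3 : Z - 1 ≠ 0 := by rw [← neg_ne_zero, neg_sub]; exact h1
    have e : (1 - t ^ 2 * Z⁻¹) / (1 - Z⁻¹) = (t ^ 2 - Z) / (1 - Z) := by
      rw [div_eq_div_iff h2 h1]; field_simp; ring
    simp only [hA, e]
    field_simp
    ring
  have iC : ∀ Z, Z ≠ 0 → 1 - Z ^ 2 ≠ 0 → C Z⁻¹ = u - u⁻¹ - C Z := by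
    intro Z h0 h1
    have h2 := inv_ne _ h1
    rw [← inv_pow] at h2
    have e : (1 - u * a * Z⁻¹) * (1 + u * a⁻¹ * Z⁻¹) / (1 - Z⁻¹ ^ 2) =
        (u * a - Z) * (Z + u * a⁻¹) / (1 - Z ^ 2) := by
      rw [div_eq_div_iff h2 h1]; field_simp; ring
    simp only [hC, e]
    field_simp
    ring
  have hXY2 : 1 - (X * Y) ^ 2 ≠ 0 := by rwa [mul_pow]
  have I : A X * C Y + C (X * Y) * (t - t⁻¹ - A X) + A (X * Y ^ 2) * (u - u⁻¹ - C (X * Y)) =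
      C Y * A (X * Y ^ 2) := by
    have eA : ∀ Z, 1 - Z ≠ 0 → A Z = (t - t⁻¹) / (1 - Z) := by
      intro Z h; simp only [hA]; field_simp; ring
    have eC : ∀ Z, 1 - Z ^ 2 ≠ 0 → C Z = (u - u⁻¹ - (a⁻¹ - a) * Z) / (1 - Z ^ 2) := by
      intro Z h; simp only [hC]; field_simp; ring
    rw [eA _ hX1, eA _ hXY, eC _ hY1, eC _ hXY2, mul_pow]
    generalize t - t⁻¹ = r
    generalize u - u⁻¹ = s
    generalize a⁻¹ - a = k
    field_simp
    ring
  simp only [S, T, map_add, map_sub, map_mul, mA σ h1, mA τ h2, mC σ h1' h1a, mC τ h2' h2a,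
    h1, h2, h1', h2', h3, h4, h5, h6, map_inv₀, map_pow, h, hσ, hτ, x1, x2, x3, x4, iA _ hX hX1,
    iC _ hY hY1]
  generalize τ (σ (τ (σ f))) = f0
  generalize τ (σ (τ f)) = f1
  generalize σ (τ (σ f)) = f2
  generalize τ (σ f) = f3
  generalize σ (τ f) = f4
  generalize τ f = f5
  generalize σ f = f6
  generalize A X = a1 at *
  generalize A (X * Y ^ 2) = a2 at *
  generalize C Y = c1 at *
  generalize C (X * Y) = c2 at *
  have ht' := mul_inv_cancel₀ ht
  have hu' := mul_inv_cancel₀ hu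
  generalize t⁻¹ = t' at *
  generalize u⁻¹ = u' at *
  linear_combination ((t - a1) * (u - c2) * f4 - (u - c1) * (t - a2) * f3 +
    (t - a1) * (c2 - c1) * f6 + (u - c1) * (a1 - a2) * f5) * I
end
end Koornwinder

namespace Koornwinder

variable {n : ℕ}

/-! ### The affine Weyl group acting on Laurent polynomials -/

/-- The monomial `x^{v + c δ} = q^c x^v`. -/
noncomputable def am (p : Parameters) (x : AffWt n) : Laurent n := affMono p x.1 x.2

theorem am_add (p : Parameters) (x y : AffWt n) : am p (x + y) = am p x * am p y :=
  (affMono_mul p _ _ _ _).symm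

theorem am_zero (p : Parameters) : am p (0 : AffWt n) = 1 := by
  simp [am, affMono, mono, AddMonoidAlgebra.one_def]

theorem am_mk_zero (p : Parameters) (v : Weight n) : am p (v, 0) = mono v := by
  simp [am, affMono]

/-- The action of an automorphism of the lattice of affine functions on Laurent polynomials. -/
noncomputable def affOp (p : Parameters) (g : AffAut n) : Module.End ℂ (Laurent n) :=
  ofMono fun lam => am p (g (lam, 0))

theorem affOp_mono (p : Parameters) (g : AffAut n) (lam : Weight n) :
    affOp p g (mono lam) = am p (g (lam, 0)) := ofMono_mono _ _

/-- Automorphisms fixing `δ`. -/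
def FixesDelta (g : AffAut n) : Prop := g (0, 1) = (0, 1)

theorem FixesDelta.apply {g : AffAut n} (hg : FixesDelta g) (x : AffWt n) :
    g x = g (x.1, 0) + (0, x.2) := by
  have h : x = (x.1, 0) + x.2 • ((0, 1) : AffWt n) := by ext <;> simp
  conv_lhs => rw [h, map_add, map_zsmul, hg]
  simp

theorem FixesDelta.mul {g h : AffAut n} (hg : FixesDelta g) (hh : FixesDelta h) :
    FixesDelta (g * h) := by
  unfold FixesDelta at *
  rw [LinearEquiv.mul_apply, hh, hg]

theorem fixesDelta_aRefl [Fact (2 ≤ n)] (i : Fin (n + 1)) : FixesDelta (aRefl i : AffAut n) := by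
  simp [FixesDelta, aRefl_apply, pairing]

theorem fixesDelta_wProd [Fact (2 ≤ n)] (w : List (Fin (n + 1))) : FixesDelta (wProd w) := by
  induction w with
  | nil => rfl
  | cons i w ih => rw [wProd_cons]; exact (fixesDelta_aRefl i).mul ih

theorem am_eq_smul (p : Parameters) (x : AffWt n) : am p x = p.q ^ x.2 • mono x.1 := rfl

theorem am_add_delta (p : Parameters) (x : AffWt n) (c : ℤ) :
    am p (x + (0, c)) = p.q ^ c • am p x := by
  simp [am_eq_smul, zpow_add₀ p.q_ne, smul_smul, mul_comm]

theorem affOp_am (p : Parameters) {g : AffAut n} (hg : FixesDelta g) (x : AffWt n) :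
    affOp p g (am p x) = am p (g x) := by
  rw [am_eq_smul, map_smul, affOp_mono, hg.apply x, am_add_delta]

theorem affOp_mul (p : Parameters) {g : AffAut n} (hg : FixesDelta g) (h : AffAut n) :
    affOp p (g * h) = affOp p g * affOp p h := by
  apply end_ext
  intro lam
  rw [Module.End.mul_apply, affOp_mono, affOp_mono, affOp_am p hg]
  rfl

theorem affOp_one (p : Parameters) : affOp p (1 : AffAut n) = 1 := by
  apply end_ext
  intro lam
  rw [affOp_mono, LinearEquiv.coe_one, id, am_mk_zero]; rfl

theorem mono_mul (v w : Weight n) : mono v * mono w = mono (v + w) := by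
  simp [mono, AddMonoidAlgebra.single_mul_single]

theorem affOp_map_mul (p : Parameters) (g : AffAut n) (f₁ f₂ : Laurent n) :
    affOp p g (f₁ * f₂) = affOp p g f₁ * affOp p g f₂ := by
  have h1 : affOp p g ∘ₗ LinearMap.mulRight ℂ f₂ =
      LinearMap.mulRight ℂ (affOp p g f₂) ∘ₗ affOp p g := by
    apply end_ext
    intro lam
    have h2 : affOp p g ∘ₗ LinearMap.mulLeft ℂ (mono lam) =
        LinearMap.mulLeft ℂ (affOp p g (mono lam)) ∘ₗ affOp p g := by
      apply end_ext
      intro mu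
      simp only [LinearMap.comp_apply, LinearMap.mulLeft_apply, mono_mul, affOp_mono, ← am_add,
        ← map_add]
      simp
    exact LinearMap.congr_fun h2 f₂
  exact LinearMap.congr_fun h1 f₁

theorem affOp_map_one (p : Parameters) (g : AffAut n) : affOp p g 1 = 1 := by
  rw [← am_zero p, show am p (0 : AffWt n) = mono 0 from am_mk_zero p 0, affOp_mono,
    show ((0, 0) : AffWt n) = 0 from rfl, map_zero, am_zero, ← am_mk_zero p]
  exact (am_zero p).symm

theorem reflOp_eq [Fact (2 ≤ n)] (p : Parameters) (i : Fin (n + 1)) :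
    reflOp p i = affOp p (aRefl i : AffAut n) := by
  apply end_ext
  intro lam
  rw [affOp_mono, reflOp, ofMono_mono, aRefl_apply]
  simp [am, aRoot]

/-- `affOp` as a ring homomorphism. -/
noncomputable def affHom (p : Parameters) (g : AffAut n) : Laurent n →+* Laurent n where
  toFun := affOp p g
  map_one' := affOp_map_one p g
  map_mul' := affOp_map_mul p g
  map_zero' := map_zero _
  map_add' := map_add _

/-- The field of fractions of the Laurent polynomials. -/
abbrev RatFun (n : ℕ) : Type := FractionRing (Laurent n)

/-- The inclusion of Laurent polynomials into rational functions. -/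
noncomputable abbrev toRat : Laurent n →+* RatFun n := algebraMap (Laurent n) (RatFun n)

/-- The inclusion of constants into rational functions. -/
noncomputable abbrev toConst : ℂ →+* RatFun n := algebraMap ℂ (RatFun n)

theorem toRat_injective : Function.Injective (toRat : Laurent n → RatFun n) :=
  IsFractionRing.injective _ _

theorem toRat_smul (c : ℂ) (f : Laurent n) : toRat (c • f) = toConst c * toRat f := by
  rw [Algebra.smul_def, map_mul]
  congr 1

theorem toConst_eq (c : ℂ) : (toConst c : RatFun n) = toRat (c • 1) := by
  rw [toRat_smul, map_one, mul_one]

theorem ratFun_hom_ext {F G : RatFun n →+* RatFun n} (h : ∀ f, F (toRat f) = G (toRat f)) :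
    F = G :=
  IsLocalization.ringHom_ext (nonZeroDivisors (Laurent n)) (RingHom.ext h)

section
variable [Fact (2 ≤ n)]

theorem affHom_injective (p : Parameters) (i : Fin (n + 1)) :
    Function.Injective (affHom p (aRefl i : AffAut n)) := by
  apply Function.LeftInverse.injective (g := affOp p (aRefl i : AffAut n))
  intro f
  change affOp p (aRefl i) (affOp p (aRefl i) f) = f
  rw [← Module.End.mul_apply, ← affOp_mul p (fixesDelta_aRefl i), aRefl_mul_self, affOp_one]
  rfl

/-- The reflection `s_i` as an endomorphism of the field of rational functions. -/
noncomputable def ratRefl (p : Parameters) (i : Fin (n + 1)) : RatFun n →+* RatFun n :=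
  IsFractionRing.map (affHom_injective p i)

theorem ratRefl_toRat (p : Parameters) (i : Fin (n + 1)) (f : Laurent n) :
    ratRefl p i (toRat f) = toRat (affOp p (aRefl i : AffAut n) f) := by
  simp [ratRefl, IsFractionRing.map, affHom]

theorem ratRefl_toConst (p : Parameters) (i : Fin (n + 1)) (c : ℂ) :
    ratRefl p i (toConst c : RatFun n) = toConst c := by
  rw [toConst_eq, ratRefl_toRat, map_smul, affOp_map_one]

/-- The composition of the `ratRefl p i` along a word. -/
theorem ratRefl_word (p : Parameters) {u v : List (Fin (n + 1))} (h : wProd u = wProd v)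
    (f : RatFun n) : (u.map fun i => (ratRefl p i : RatFun n → RatFun n)).foldr (· ∘ ·) id f =
      (v.map fun i => (ratRefl p i : RatFun n → RatFun n)).foldr (· ∘ ·) id f := by
  have key : ∀ w : List (Fin (n + 1)), ∃ F : RatFun n →+* RatFun n,
      (∀ f, F f = (w.map fun i => (ratRefl p i : RatFun n → RatFun n)).foldr (· ∘ ·) id f) ∧
      ∀ f, F (toRat f) = toRat (affOp p (wProd w) f) := by
    intro w
    induction w with
    | nil => exact ⟨RingHom.id _, fun f => rfl, fun f => by rw [wProd_nil, affOp_one]; rfl⟩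
    | cons i w ih =>
      obtain ⟨F, h1, h2⟩ := ih
      refine ⟨(ratRefl p i).comp F, fun f => ?_, fun f => ?_⟩
      · simp [h1]
      · rw [RingHom.comp_apply, h2, ratRefl_toRat, wProd_cons,
          affOp_mul p (fixesDelta_aRefl i)]
        rfl
  obtain ⟨F, h1, h2⟩ := key u
  obtain ⟨G, h3, h4⟩ := key v
  rw [← h1, ← h3]
  exact RingHom.congr_fun (ratFun_hom_ext fun f => by rw [h2, h4, h]) f
end
end Koornwinder

namespace Koornwinder

variable {n : ℕ}

theorem toRat_one_sub_am_ne_zero (p : Parameters) {x : AffWt n} (hx : x.1 ≠ 0) :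
    1 - toRat (am p x) ≠ 0 := by
  rw [← map_one toRat, ← map_sub, Ne, ← map_zero toRat, toRat_injective.eq_iff]
  intro h
  have h1 := congrArg (fun f : Laurent n => f.coeff 0) h
  simp [am, affMono, mono, AddMonoidAlgebra.one_def, hx] at h1

theorem toRat_am_ne_zero (p : Parameters) (x : AffWt n) : toRat (am p x) ≠ 0 := by
  intro h
  have := am_add p x (-x)
  rw [add_neg_cancel, am_zero] at this
  have h2 := congrArg toRat this
  rw [map_mul, h, zero_mul, map_one] at h2
  exact one_ne_zero h2

section
variable [Fact (2 ≤ n)]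

theorem rootGrad_ne_zero (i : Fin (n + 1)) : (rootGrad i : Weight n) ≠ 0 := by
  intro h
  have := pairing_root_self (n := n) i
  rw [h] at this
  simp [pairing] at this

/-- `1 - x^{a_i}` is not zero. -/
theorem one_sub_root_ne_zero (p : Parameters) (i : Fin (n + 1)) :
    1 - toRat (am p (aRoot i : AffWt n)) ≠ 0 :=
  toRat_one_sub_am_ne_zero p (rootGrad_ne_zero i)

/-- The function `v_{a_i}`. -/
noncomputable def vFun (p : Parameters) (i : Fin (n + 1)) : RatFun n :=
  toRat (vNum p i) / (1 - toRat (am p (aRoot i)))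

theorem toRat_heckeOp (p : Parameters) (i : Fin (n + 1)) (f : Laurent n) :
    toRat (heckeOp p i f) =
      dlOp (toConst (p.tval i)) (vFun p i) (ratRefl p i) (toRat f) := by
  have h := congrArg toRat (one_sub_mul_heckeOp p i f)
  have h1 := one_sub_root_ne_zero p i
  rw [show affMono p (rootGrad i : Weight n) (rootDelta i) = am p (aRoot i) from rfl] at h
  simp only [map_add, map_mul, map_sub, map_one, toRat_smul, reflOp_eq] at h
  rw [← mul_right_inj' h1, h, dlOp, ratRefl_toRat, vFun, map_inv₀]
  field_simp

/-! ### The kinds of simple roots -/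

/-- The simple roots `a_0` and `a_n`. -/
def IsLong (i : Fin (n + 1)) : Prop := i = 0 ∨ i = Fin.last n

theorem IsLong.rootGrad_eq {i : Fin (n + 1)} (hi : IsLong i) :
    (rootGrad i : Weight n) = (2 : ℤ) • corootGrad i := by
  have := Fact.out (p := 2 ≤ n)
  rcases hi with rfl | rfl
  · simp [rootGrad, corootGrad]
  · have h : Fin.last n ≠ 0 := by intro h; simp [Fin.ext_iff] at h; omega
    simp [rootGrad, corootGrad, h]

omit [Fact (2 ≤ n)] in
theorem rootGrad_eq_of_not_isLong {i : Fin (n + 1)} (hi : ¬ IsLong i) :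
    (rootGrad i : Weight n) = corootGrad i := by
  simp only [IsLong, not_or] at hi
  simp [rootGrad, corootGrad, hi]

omit [Fact (2 ≤ n)] in
theorem rootDelta_eq_of_not_isLong {i : Fin (n + 1)} (hi : ¬ IsLong i) : rootDelta i = 0 := by
  simp only [IsLong, not_or] at hi
  simp [rootDelta, hi]

theorem IsLong.even_cartan {i : Fin (n + 1)} (hi : IsLong i) (j : Fin (n + 1)) :
    cartan j i = 2 * pairing (corootGrad i : Weight n) j := by
  rw [cartan, hi.rootGrad_eq, pairing_smul]

omit [Fact (2 ≤ n)] in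
theorem tval_of_not_isLong (p : Parameters) {i : Fin (n + 1)} (hi : ¬ IsLong i) :
    p.tval i = p.t := by
  simp only [IsLong, not_or] at hi
  simp [Parameters.tval, hi]

theorem root_dot_self_of_not_isLong {i : Fin (n + 1)} (hi : ¬ IsLong i) :
    (rootGrad i : Weight n) ⬝ᵥ rootGrad i = 2 := by
  have h1 := pairing_root_self (n := n) i
  rw [pairing, ← rootGrad_eq_of_not_isLong hi] at h1
  exact h1

theorem not_isLong_of_cartan {i j : Fin (n + 1)} (h : cartan j i = -1) : ¬ IsLong i := by
  intro hi
  have := hi.even_cartan j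
  omega

theorem isLong_of_cartan {i j : Fin (n + 1)} (h : cartan i j = -1) (h' : cartan j i = -2) :
    IsLong i := by
  by_contra hi
  have h1 := root_dot_self_mul_pairing (rootGrad j : Weight n) i
  have h2 := root_dot_self_mul_pairing (rootGrad i : Weight n) j
  rw [root_dot_self_of_not_isLong hi] at h1
  rw [root_dot_self_of_not_isLong (not_isLong_of_cartan h), dotProduct_comm] at h2
  change 2 * cartan i j = _ at h1
  change 2 * cartan j i = _ at h2
  omega

/-- The monomial `x^{a_i / 2}` for `i = 0, n`. -/
noncomputable def halfMono (p : Parameters) (i : Fin (n + 1)) : Laurent n :=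
  (if i = 0 then p.qh else 1) • mono (corootGrad i)

/-- The parameter `t_{a_i / 2}` for `i = 0, n`. -/
def Parameters.tvee (p : Parameters) (i : Fin (n + 1)) : ℂ := if i = 0 then p.t0v else p.tnv

theorem halfMono_mul_self (p : Parameters) {i : Fin (n + 1)} (hi : IsLong i) :
    halfMono p i * halfMono p i = am p (aRoot i : AffWt n) := by
  rw [halfMono, smul_mul_smul_comm, mono_mul, am_eq_smul, aRoot, hi.rootGrad_eq, two_smul]
  congr 1
  simp only [rootDelta]
  split_ifs
  · simp [Parameters.q, sq]
  · simp

theorem toRat_halfMono_sq (p : Parameters) {i : Fin (n + 1)} (hi : IsLong i) :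
    toRat (halfMono p i) ^ 2 = toRat (am p (aRoot i : AffWt n)) := by
  rw [sq, ← map_mul, halfMono_mul_self p hi]

theorem vNum_of_isLong (p : Parameters) {i : Fin (n + 1)} (hi : IsLong i) :
    toRat (vNum p i) =
      (1 - toConst (p.tval i) * toConst (p.tvee i) * toRat (halfMono p i)) *
      (1 + toConst (p.tval i) * (toConst (p.tvee i))⁻¹ * toRat (halfMono p i)) := by
  have := Fact.out (p := 2 ≤ n)
  rcases hi with rfl | rfl
  · simp only [vNum, halfMono, Parameters.tval, Parameters.tvee, corootGrad, if_true, map_mul,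
      map_sub, map_add, map_one, toRat_smul, map_inv₀]
    ring
  · have h : Fin.last n ≠ 0 := by intro h; simp [Fin.ext_iff] at h; omega
    simp only [vNum, halfMono, Parameters.tval, Parameters.tvee, corootGrad, if_true, map_mul,
      map_sub, map_add, map_one, toRat_smul, map_inv₀, h, if_false]
    ring

theorem vFun_of_isLong (p : Parameters) {i : Fin (n + 1)} (hi : IsLong i) :
    vFun p i =
      (1 - toConst (p.tval i) * toConst (p.tvee i) * toRat (halfMono p i)) *
      (1 + toConst (p.tval i) * (toConst (p.tvee i))⁻¹ * toRat (halfMono p i)) /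
      (1 - toRat (halfMono p i) ^ 2) := by
  rw [vFun, vNum_of_isLong p hi, toRat_halfMono_sq p hi]

omit [Fact (2 ≤ n)] in
theorem vFun_of_not_isLong (p : Parameters) {i : Fin (n + 1)} (hi : ¬ IsLong i) :
    vFun p i = (1 - toConst p.t ^ 2 * toRat (am p (aRoot i))) / (1 - toRat (am p (aRoot i))) := by
  have h : vNum p i = 1 - p.t ^ 2 • am p (aRoot i : AffWt n) := by
    rw [am_eq_smul, aRoot, rootDelta_eq_of_not_isLong hi, zpow_zero, one_smul]
    simp only [IsLong, not_or] at hi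
    simp [vNum, hi]
  rw [vFun, h, map_sub, map_one, toRat_smul, map_pow]

theorem ratRefl_am (p : Parameters) (i : Fin (n + 1)) (x : AffWt n) :
    ratRefl p i (toRat (am p x)) = toRat (am p (aRefl i x)) := by
  rw [ratRefl_toRat, affOp_am p (fixesDelta_aRefl i)]

theorem ratRefl_am_self (p : Parameters) (i : Fin (n + 1)) :
    ratRefl p i (toRat (am p (aRoot i))) = (toRat (am p (aRoot i)))⁻¹ := by
  rw [ratRefl_am, aRefl_aRoot]
  apply eq_inv_of_mul_eq_one_left
  rw [← map_mul, ← am_add, neg_add_cancel, am_zero, map_one]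

theorem affOp_halfMono (p : Parameters) (i j : Fin (n + 1)) :
    affOp p (aRefl j : AffAut n) (halfMono p i) =
      am p (-pairing (corootGrad i : Weight n) j • aRoot j) * halfMono p i := by
  rw [halfMono, map_smul, affOp_mono, mul_smul_comm, ← am_mk_zero p, ← am_add, aRefl_apply]
  congr 2
  module

theorem halfMono_ne_zero (p : Parameters) {i : Fin (n + 1)} (hi : IsLong i) :
    toRat (halfMono p i : Laurent n) ≠ 0 := by
  intro h
  have := toRat_am_ne_zero p (aRoot i : AffWt n)
  rw [← halfMono_mul_self p hi, map_mul, h, zero_mul] at this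
  exact this rfl

theorem pairing_coroot_of_isLong {i : Fin (n + 1)} (hi : IsLong i) :
    pairing (corootGrad i : Weight n) i = 1 := by
  have := hi.even_cartan i
  rw [cartan, pairing_root_self] at this
  omega

theorem ratRefl_halfMono_self (p : Parameters) {i : Fin (n + 1)} (hi : IsLong i) :
    ratRefl p i (toRat (halfMono p i)) = (toRat (halfMono p i))⁻¹ := by
  rw [ratRefl_toRat, affOp_halfMono, pairing_coroot_of_isLong hi, neg_smul, one_smul]
  apply eq_inv_of_mul_eq_one_left
  rw [← map_mul, mul_assoc, halfMono_mul_self p hi,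
    ← am_add, neg_add_cancel, am_zero, map_one]

theorem ratRefl_ratRefl (p : Parameters) (i : Fin (n + 1)) (f : RatFun n) :
    ratRefl p i (ratRefl p i f) = f := by
  simpa using ratRefl_word p (u := [i, i]) (v := []) (wProd_cons_cons_self i []) f

omit [Fact (2 ≤ n)] in
theorem toConst_ne_zero {c : ℂ} (hc : c ≠ 0) : (toConst c : RatFun n) ≠ 0 := by
  rwa [Ne, map_eq_zero]

omit [Fact (2 ≤ n)] in
theorem tval_ne_zero (p : Parameters) (i : Fin (n + 1)) : p.tval i ≠ 0 := by
  unfold Parameters.tval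
  split_ifs
  exacts [p.t0_ne, p.tn_ne, p.t_ne]

omit [Fact (2 ≤ n)] in
theorem tvee_ne_zero (p : Parameters) (i : Fin (n + 1)) : p.tvee i ≠ 0 := by
  unfold Parameters.tvee
  split_ifs
  exacts [p.t0v_ne, p.tnv_ne]

theorem vFun_add_ratRefl (p : Parameters) (i : Fin (n + 1)) :
    vFun p i + ratRefl p i (vFun p i) = 1 + (toConst (p.tval i)) ^ 2 := by
  have inv_ne : ∀ Z : RatFun n, 1 - Z ≠ 0 → 1 - Z⁻¹ ≠ 0 := by
    intro Z h1 h2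
    have : Z⁻¹ = 1 := by linear_combination -h2
    rw [inv_eq_one] at this
    simp [this] at h1
  by_cases hi : IsLong i
  · have h0 := halfMono_ne_zero p hi
    have h1 : 1 - toRat (halfMono p i) ^ 2 ≠ 0 := by
      rw [toRat_halfMono_sq p hi]; exact one_sub_root_ne_zero p i
    have h3 := toConst_ne_zero (n := n) (tvee_ne_zero p i)
    have h4 := ratRefl_toConst p i (p.tvee i)
    have h5 := ratRefl_toConst p i (p.tval i)
    rw [vFun_of_isLong p hi]
    simp only [map_mul, map_sub, map_add, map_one, map_div₀, map_inv₀, map_pow,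
      ratRefl_halfMono_self p hi] at h4 h5 ⊢
    have h2 := inv_ne _ h1
    rw [← inv_pow] at h2
    simp only [h4, h5]
    generalize (toRat (halfMono p i) : RatFun n) = Z at *
    generalize (toConst (p.tvee i) : RatFun n) = a at *
    generalize (toConst (p.tval i) : RatFun n) = u at *
    have e : (1 - u * a * Z⁻¹) * (1 + u * a⁻¹ * Z⁻¹) / (1 - Z⁻¹ ^ 2) =
        (u * a - Z) * (Z + u * a⁻¹) / (1 - Z ^ 2) := by
      rw [div_eq_div_iff h2 h1]; field_simp; ring
    rw [e]
    field_simp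
    ring
  · have h0 := toRat_am_ne_zero p (aRoot i : AffWt n)
    have h1 := one_sub_root_ne_zero p i
    have h5 := ratRefl_toConst p i p.t
    have h2 := inv_ne _ h1
    rw [vFun_of_not_isLong p hi, tval_of_not_isLong p hi]
    simp only [map_mul, map_sub, map_one, map_div₀, map_pow, ratRefl_am_self, h5]
    generalize (toRat (am p (aRoot i)) : RatFun n) = Z at *
    generalize (toConst p.t : RatFun n) = u at *
    have e : (1 - u ^ 2 * Z⁻¹) / (1 - Z⁻¹) = (u ^ 2 - Z) / (1 - Z) := by
      rw [div_eq_div_iff h2 h1]; field_simp; ring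
    rw [e]
    field_simp
    ring

/-- The quadratic relation for `T_i`. -/
theorem heckeOp_mul_self (p : Parameters) (i : Fin (n + 1)) :
    heckeOp p i * heckeOp p i - (p.tval i - (p.tval i)⁻¹) • heckeOp p i =
      (1 : Module.End ℂ (Laurent n)) := by
  refine LinearMap.ext fun f => toRat_injective ?_
  rw [LinearMap.sub_apply, LinearMap.smul_apply, Module.End.mul_apply, map_sub, toRat_smul,
    toRat_heckeOp, toRat_heckeOp, map_sub, map_inv₀]
  exact dlOp_inv (ratRefl_ratRefl p i) (toConst_ne_zero (tval_ne_zero p i))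
    (ratRefl_toConst p i _) (vFun_add_ratRefl p i) _

theorem isUnit_heckeOp (p : Parameters) (i : Fin (n + 1)) :
    IsUnit (heckeOp p i : Module.End ℂ (Laurent n)) := by
  have h := heckeOp_mul_self (n := n) p i
  refine ⟨⟨heckeOp p i, heckeOp p i - (p.tval i - (p.tval i)⁻¹) • 1, ?_, ?_⟩, rfl⟩
  · rw [mul_sub, mul_smul_comm, mul_one, h]
  · rw [sub_mul, smul_mul_assoc, one_mul, h]

theorem isUnit_heckeWord (p : Parameters) (w : List (Fin (n + 1))) :
    IsUnit (heckeWord p w) := by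
  induction w with
  | nil => simp [heckeWord]
  | cons i w ih =>
    rw [heckeWord, List.map_cons, List.prod_cons]
    exact (isUnit_heckeOp p i).mul ih

/-- The braid relations for the operators `T_i`. -/
theorem braid_heckeOp (p : Parameters) :
    Braid (heckeOp p : Fin (n + 1) → Module.End ℂ (Laurent n)) where
  comm i j h h' := by
    have fix : ∀ {i j : Fin (n + 1)}, cartan i j = 0 →
        ratRefl p i (vFun p j) = vFun p j := by
      intro i j h
      have h5 := fun c => ratRefl_toConst (n := n) p i c
      by_cases hj : IsLong j
      · have e : ratRefl p i (toRat (halfMono p j)) = toRat (halfMono p j) := by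
          have h2 := hj.even_cartan i
          have h3 : pairing (corootGrad j : Weight n) i = 0 := by omega
          rw [ratRefl_toRat, affOp_halfMono, h3, neg_zero, zero_smul, am_zero, one_mul]
        rw [vFun_of_isLong p hj]
        simp only [map_mul, map_sub, map_add, map_one, map_div₀, map_inv₀, map_pow, e, h5]
      · have e : ratRefl p i (toRat (am p (aRoot j))) = toRat (am p (aRoot j)) := by
          rw [ratRefl_am, aRefl_aRoot', h, zero_smul, sub_zero]
        rw [vFun_of_not_isLong p hj]
        simp only [map_mul, map_sub, map_one, map_div₀, map_pow, e, h5]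
    refine LinearMap.ext fun f => toRat_injective ?_
    simp only [Module.End.mul_apply, toRat_heckeOp]
    refine dlOp_comm (fun f => ?_) (ratRefl_toConst p i _) (fix h) (ratRefl_toConst p j _)
      (fix h') _
    exact ratRefl_word p (u := [i, j]) (v := [j, i])
      (by simpa using braid_aRefl.comm i j h h') f
  braid3 i j h h' := by
    have hi := not_isLong_of_cartan h'
    have hj := not_isLong_of_cartan h
    refine LinearMap.ext fun f => toRat_injective ?_
    simp only [Module.End.mul_apply, toRat_heckeOp, vFun_of_not_isLong p hi,
      vFun_of_not_isLong p hj, tval_of_not_isLong p hi, tval_of_not_isLong p hj]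
    have e1 : ratRefl p i (toRat (am p (aRoot j))) =
        toRat (am p (aRoot i)) * toRat (am p (aRoot j)) := by
      rw [ratRefl_am, aRefl_cartan, h, neg_neg, one_smul, am_add, map_mul, mul_comm]
    have e2 : ratRefl p j (toRat (am p (aRoot i))) =
        toRat (am p (aRoot i)) * toRat (am p (aRoot j)) := by
      rw [ratRefl_am, aRefl_cartan, h', neg_neg, one_smul, am_add, map_mul]
    refine dlOp_braid3 (fun f => ?_) (ratRefl_ratRefl p i) (ratRefl_ratRefl p j)
      (toConst_ne_zero p.t_ne) (toRat_am_ne_zero p _) (toRat_am_ne_zero p _)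
      (one_sub_root_ne_zero p i) (one_sub_root_ne_zero p j) ?_ (ratRefl_toConst p i _)
      (ratRefl_toConst p j _) (ratRefl_am_self p i) e1 e2 (ratRefl_am_self p j) _
    · exact ratRefl_word p (u := [i, j, i]) (v := [j, i, j])
        (by simpa [mul_assoc] using braid_aRefl.braid3 i j h h') f
    · rw [← e1, ← map_one (ratRefl p i), ← map_sub, Ne, map_eq_zero]
      exact one_sub_root_ne_zero p j
  braid4 i j h h' := by
    have hi := isLong_of_cartan h h'
    have hj := not_isLong_of_cartan h
    refine LinearMap.ext fun f => toRat_injective ?_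
    simp only [Module.End.mul_apply, toRat_heckeOp, vFun_of_isLong p hi,
      vFun_of_not_isLong p hj, tval_of_not_isLong p hj]
    have h0 := halfMono_ne_zero p hi
    have h1 : 1 - toRat (halfMono p i) ^ 2 ≠ 0 := by
      rw [toRat_halfMono_sq p hi]; exact one_sub_root_ne_zero p i
    have e1 : ratRefl p j (toRat (halfMono p i)) =
        toRat (am p (aRoot j)) * toRat (halfMono p i) := by
      have h2 := hi.even_cartan j
      have h3 : pairing (corootGrad i : Weight n) j = -1 := by omega
      rw [ratRefl_toRat, affOp_halfMono, h3, neg_neg, one_smul, map_mul]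
    have e2 : ratRefl p i (toRat (am p (aRoot j))) =
        toRat (am p (aRoot j)) * toRat (halfMono p i) ^ 2 := by
      rw [ratRefl_am, aRefl_cartan, h, neg_neg, one_smul, am_add, map_mul,
        toRat_halfMono_sq p hi]
    refine (dlOp_braid4 (fun f => ?_) (ratRefl_ratRefl p j) (ratRefl_ratRefl p i)
      (toConst_ne_zero p.t_ne) (toConst_ne_zero (tval_ne_zero p i))
      (toConst_ne_zero (tvee_ne_zero p i)) (toRat_am_ne_zero p _) h0
      (one_sub_root_ne_zero p j) h1 ?_ ?_ (ratRefl_toConst p j _)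
      (ratRefl_toConst p i _) (ratRefl_toConst p j _)
      (ratRefl_toConst p i _) (ratRefl_toConst p j _)
      (ratRefl_toConst p i _) (ratRefl_am_self p j) e1 e2 (ratRefl_halfMono_self p hi) _).symm
    · exact ratRefl_word p (u := [j, i, j, i]) (v := [i, j, i, j])
        (by simpa [mul_assoc] using (braid_aRefl.braid4 i j h h').symm) f
    · rw [← e2, ← map_one (ratRefl p i), ← map_sub, Ne, map_eq_zero]
      exact one_sub_root_ne_zero p j
    · rw [← mul_pow, ← e1, ← map_pow, ← map_one (ratRefl p j), ← map_sub, Ne, map_eq_zero]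
      exact h1
end
end Koornwinder

namespace Koornwinder

variable {n : ℕ}

/-! ### Dominance order and orbits -/

/-- The partial sum `v_1 + ⋯ + v_k`. -/
def psum (k : Fin n) (v : Weight n) : ℤ := ∑ j ∈ Finset.Iic k, v j

theorem psum_add (k : Fin n) (v w : Weight n) : psum k (v + w) = psum k v + psum k w := by
  simp [psum, Finset.sum_add_distrib]

theorem psum_smul (k : Fin n) (c : ℤ) (v : Weight n) : psum k (c • v) = c * psum k v := by
  simp [psum, Finset.mul_sum]

theorem psum_sub (k : Fin n) (v w : Weight n) : psum k (v - w) = psum k v - psum k w := by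
  simp [psum, Finset.sum_sub_distrib]

theorem corootGrad_succ (k : Fin n) :
    corootGrad k.succ = eps n ((k : ℕ) + 1) - eps n ((k : ℕ) + 2) := by
  have h0 : k.succ ≠ 0 := Fin.succ_ne_zero k
  by_cases hl : k.succ = Fin.last n
  · have h : (k : ℕ) + 1 = n := by simpa [Fin.ext_iff] using hl
    have h2 : eps n ((k : ℕ) + 2) = 0 := by
      funext j
      have := j.isLt
      simp only [eps, Pi.zero_apply, ite_eq_right_iff]
      omega
    rw [corootGrad, if_neg h0, if_pos hl, h2, sub_zero, h]
  · simp [corootGrad, h0, hl]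

theorem psum_single (k j : Fin n) (s : ℤ) :
    psum k (Pi.single j s) = if j ≤ k then s else 0 := by
  simp [psum, Pi.single_apply]

theorem sum_psum_smul_coroot (v : Weight n) :
    ∑ k, psum k v • corootGrad k.succ = v := by
  funext j
  have h1 : ∀ k : Fin n, (corootGrad k.succ : Weight n) j =
      (if k = j then 1 else 0) - (if (k : ℕ) + 1 = j then 1 else 0) := by
    intro k
    rw [corootGrad_succ]
    simp only [eps, Pi.sub_apply, Fin.ext_iff]
    congr 1
    · simp [eq_comm]
    · have : ((j : ℕ) + 1 = (k : ℕ) + 2) ↔ ((k : ℕ) + 1 = j) := by omega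
      simp only [this]
  simp only [Finset.sum_apply, Pi.smul_apply, smul_eq_mul, h1, mul_sub, Finset.sum_sub_distrib,
    mul_ite, mul_one, mul_zero, Finset.sum_ite_eq', Finset.mem_univ, if_true]
  by_cases hj : (j : ℕ) = 0
  · have h2 : Finset.Iic j = {j} := by
      ext k
      simp only [Finset.mem_Iic, Finset.mem_singleton, Fin.le_def, Fin.ext_iff]
      omega
    have h3 : ∀ k : Fin n, ¬ (k : ℕ) + 1 = j := by intro k; omega
    simp [psum, h2, h3]
  · have hlt := j.isLt
    obtain ⟨i, hi⟩ : ∃ i : Fin n, (i : ℕ) + 1 = j := ⟨⟨j - 1, by omega⟩, by simp; omega⟩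
    have h2 : Finset.Iic j = insert j (Finset.Iic i) := by
      ext k
      simp only [Finset.mem_Iic, Finset.mem_insert, Fin.le_def, Fin.ext_iff]
      omega
    have h3 : ∀ k : Fin n, (k : ℕ) + 1 = j ↔ k = i := by
      intro k; rw [Fin.ext_iff]; omega
    have h4 : j ∉ Finset.Iic i := by
      rw [Finset.mem_Iic, Fin.le_def]; omega
    simp [psum, h2, h3, Finset.sum_insert h4]

theorem domLE_iff {lam mu : Weight n} : DomLE lam mu ↔ ∀ k, psum k lam ≤ psum k mu := by
  have key : ∀ v : Weight n, v ∈ AddSubmonoid.closure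
      {c : Weight n | ∃ i : Fin (n + 1), i ≠ 0 ∧ c = corootGrad i} ↔ ∀ k, 0 ≤ psum k v := by
    intro v
    constructor
    · intro h
      induction h using AddSubmonoid.closure_induction with
      | mem x hx =>
        obtain ⟨i, hi, rfl⟩ := hx
        obtain ⟨j, rfl⟩ := Fin.exists_succ_eq.mpr hi
        intro k
        rw [corootGrad_succ, psum_sub, eps_eq_single, psum_single]
        have h2 : psum k (eps n ((j : ℕ) + 2)) ≤ if j ≤ k then 1 else 0 := by
          by_cases h : (j : ℕ) + 1 < n
          · rw [show (j : ℕ) + 2 = ((⟨j + 1, h⟩ : Fin n) : ℕ) + 1 from rfl, eps_eq_single,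
              psum_single]
            split_ifs with h1 h2 <;> simp only [Fin.le_def] at * <;> omega
          · have : eps n ((j : ℕ) + 2) = 0 := by
              funext l
              have := l.isLt
              simp only [eps, Pi.zero_apply, ite_eq_right_iff]
              omega
            rw [this]
            simp only [psum, Pi.zero_apply, Finset.sum_const_zero]
            split_ifs <;> simp
        omega
      | zero => intro k; simp [psum]
      | add x y _ _ hx hy =>
        intro k
        rw [psum_add]
        exact add_nonneg (hx k) (hy k)
    · intro h
      rw [← sum_psum_smul_coroot v]
      refine AddSubmonoid.sum_mem _ fun k _ => ?_
      obtain ⟨m, hm⟩ := Int.eq_ofNat_of_zero_le (h k)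
      rw [hm, natCast_zsmul]
      refine AddSubmonoid.nsmul_mem _ (AddSubmonoid.subset_closure ?_) m
      exact ⟨k.succ, Fin.succ_ne_zero k, rfl⟩
  rw [DomLE, key]
  exact forall_congr' fun k => by rw [psum_sub, sub_nonneg]

theorem DomLE.trans {lam mu nu : Weight n} (h1 : DomLE lam mu) (h2 : DomLE mu nu) :
    DomLE lam nu := by
  rw [domLE_iff] at *
  exact fun k => (h1 k).trans (h2 k)

theorem DomLE.antisymm {lam mu : Weight n} (h1 : DomLE lam mu) (h2 : DomLE mu lam) :
    lam = mu := by
  rw [domLE_iff] at *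
  rw [← sum_psum_smul_coroot lam, ← sum_psum_smul_coroot mu]
  exact Finset.sum_congr rfl fun k _ => by rw [le_antisymm (h1 k) (h2 k)]

theorem SameOrbit.trans {lam mu nu : Weight n} (h1 : SameOrbit lam mu) (h2 : SameOrbit mu nu) :
    SameOrbit lam nu := by
  obtain ⟨σ, u, h⟩ := h1
  obtain ⟨σ', u', h'⟩ := h2
  refine ⟨σ'.trans σ, fun j => u' j * u (σ' j), fun j => ?_⟩
  rw [h' j, h]
  simp [mul_assoc]

theorem SameOrbit.refl (lam : Weight n) : SameOrbit lam lam :=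
  ⟨Equiv.refl _, fun _ => 1, fun j => by simp⟩

theorem SameOrbit.domRep_eq {lam mu : Weight n} (h : SameOrbit lam mu) : domRep lam = domRep mu :=
  (domRep_unique _ _ (h.trans (domRep_sameOrbit mu)) (domRep_isDominant mu)).symm

theorem units_mul_self (u : ℤˣ) : (u : ℤ) * u = 1 := by
  rw [← Units.val_mul, Int.units_mul_self, Units.val_one]

theorem SameOrbit.symm {lam mu : Weight n} (h : SameOrbit lam mu) : SameOrbit mu lam := by
  obtain ⟨σ, u, h⟩ := h
  refine ⟨σ.symm, fun j => u (σ.symm j), fun j => ?_⟩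
  rw [h, ← mul_assoc, units_mul_self, one_mul, Equiv.apply_symm_apply]

theorem SameOrbit.dot_self {lam mu : Weight n} (h : SameOrbit lam mu) : lam ⬝ᵥ lam = mu ⬝ᵥ mu := by
  obtain ⟨σ, u, h⟩ := h
  simp only [dotProduct, h]
  rw [← Equiv.sum_comp σ]
  refine Finset.sum_congr rfl fun j _ => ?_
  linear_combination -(lam (σ j) * lam (σ j)) * units_mul_self (u j)

theorem psum_le_psum_domRep (k : Fin n) (lam : Weight n) : psum k lam ≤ psum k (domRep lam) := by
  set σ := Tuple.sort (fun k => -|lam k|) with hσ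
  have h1 : ∀ j, lam j ≤ domRep lam (σ.symm j) := by
    intro j
    simp only [domRep, ← hσ, Equiv.apply_symm_apply]
    exact le_abs_self _
  have h2 : ∀ v : Weight n, psum k v = ∑ j, (if j ≤ k then 1 else 0) * v j := by
    intro v
    simp only [psum, ite_mul, one_mul, zero_mul]
    rw [← Finset.sum_filter]
    congr 1
    ext j; simp
  calc psum k lam ≤ psum k (domRep lam ∘ σ.symm) := Finset.sum_le_sum fun j _ => h1 j
    _ = ∑ j, (if j ≤ k then 1 else 0) * domRep lam (σ.symm j) := h2 _
    _ ≤ ∑ j, (if j ≤ k then 1 else 0) * domRep lam j := by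
      apply Monovary.sum_mul_comp_perm_le_sum_mul
      apply Antitone.monovary
      · intro i j hij
        dsimp only
        split_ifs with h3 h4
        · exact le_rfl
        · exact absurd (hij.trans h3) h4
        · exact zero_le_one
        · exact le_rfl
      · exact (domRep_isDominant lam).1
    _ = psum k (domRep lam) := (h2 _).symm

theorem SameOrbit.domLE {lam mu : Weight n} (h : SameOrbit lam mu) : DomLE lam (domRep mu) := by
  rw [domLE_iff, ← h.domRep_eq]
  exact fun k => psum_le_psum_domRep k lam

/-- A point strictly inside the segment between two elements of an orbit is smaller. -/
theorem ordLT_of_segment {mu mu' kap : Weight n} (h : SameOrbit mu mu') {N k : ℤ} (hk : 0 < k)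
    (hkN : k < N) (hseg : N • kap = (N - k) • mu + k • mu') (hnorm : kap ⬝ᵥ kap < mu ⬝ᵥ mu) :
    OrdLT kap mu := by
  have hne : domRep kap ≠ domRep mu := by
    intro e
    rw [(domRep_sameOrbit kap).dot_self, (domRep_sameOrbit mu).dot_self, e] at hnorm
    exact lt_irrefl _ hnorm
  refine ⟨Or.inl ⟨?_, hne⟩, fun e => hne (by rw [e])⟩
  obtain ⟨σ, u, hu⟩ := domRep_sameOrbit kap
  have h1 : SameOrbit mu (fun j => (u j : ℤ) * mu (σ j)) := ⟨σ, u, fun _ => rfl⟩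
  have h2 : SameOrbit mu' (fun j => (u j : ℤ) * mu' (σ j)) := ⟨σ, u, fun _ => rfl⟩
  have h3 : N • domRep kap =
      (N - k) • (fun j => (u j : ℤ) * mu (σ j)) + k • (fun j => (u j : ℤ) * mu' (σ j)) := by
    funext j
    have := congrFun hseg (σ j)
    simp only [Pi.smul_apply, Pi.add_apply, smul_eq_mul] at this ⊢
    rw [hu j]
    linear_combination (u j : ℤ) * this
  have h4 := domLE_iff.mp h1.symm.domLE
  have h5 := domLE_iff.mp h2.symm.domLE
  rw [← h.domRep_eq] at h5
  rw [domLE_iff]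
  intro l
  have h6 := congrArg (psum l) h3
  rw [psum_smul, psum_add, psum_smul, psum_smul] at h6
  have h7 := mul_le_mul_of_nonneg_left (h4 l) (sub_nonneg.mpr hkN.le)
  have h8 := mul_le_mul_of_nonneg_left (h5 l) hk.le
  refine le_of_mul_le_mul_left ?_ (hk.trans hkN)
  linarith

theorem ordLT_of_root_string {mu be : Weight n} {N k : ℤ} (h : SameOrbit mu (mu - N • be))
    (hN : N * (be ⬝ᵥ be) = 2 * (mu ⬝ᵥ be)) (hbe : 0 < be ⬝ᵥ be) (hk : 0 < k) (hkN : k < N) :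
    OrdLT (mu - k • be) mu := by
  refine ordLT_of_segment h hk hkN (by module) ?_
  simp only [sub_dotProduct, dotProduct_sub, smul_dotProduct, dotProduct_smul, smul_eq_mul,
    dotProduct_comm be mu]
  have : 0 < k * (N - k) * (be ⬝ᵥ be) := mul_pos (mul_pos hk (sub_pos.mpr hkN)) hbe
  nlinarith

theorem OrdLE.domLE_domRep {lam mu : Weight n} (h : OrdLE lam mu) :
    DomLE (domRep lam) (domRep mu) := by
  rcases h with h | h
  · exact h.1
  · rw [h.1, domLE_iff]; exact fun _ => le_rfl

theorem OrdLT.trans {lam mu nu : Weight n} (h1 : OrdLT lam mu) (h2 : OrdLT mu nu) :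
    OrdLT lam nu := by
  have h3 := h1.1.domLE_domRep.trans h2.1.domLE_domRep
  by_cases e : domRep lam = domRep nu
  · have e1 : domRep lam = domRep mu :=
      h1.1.domLE_domRep.antisymm (e ▸ h2.1.domLE_domRep)
    have e2 : domRep mu = domRep nu := e1.symm.trans e
    have d1 : DomLE lam mu := by
      rcases h1.1 with h | h
      · exact absurd e1 h.2
      · exact h.2
    have d2 : DomLE mu nu := by
      rcases h2.1 with h | h
      · exact absurd e2 h.2
      · exact h.2
    refine ⟨Or.inr ⟨e, d1.trans d2⟩, ?_⟩
    rintro rfl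
    exact h1.2 (d1.antisymm d2)
  · exact ⟨Or.inl ⟨h3, e⟩, fun h => e (by rw [h])⟩

theorem OrdLT.irrefl (lam : Weight n) : ¬ OrdLT lam lam := fun h => h.2 rfl

theorem sum_domRep (lam : Weight n) : ∑ j, domRep lam j = ∑ j, |lam j| :=
  Equiv.sum_comp (Tuple.sort fun k => -|lam k|) fun j => |lam j|

theorem finite_setOf_ordLT (lam : Weight n) : {mu | OrdLT mu lam}.Finite := by
  rcases n with _ | n
  · exact Set.toFinite _
  refine (Set.finite_Icc (fun _ => -∑ j, |lam j|) (fun _ => ∑ j, |lam j|)).subset ?_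
  intro mu hmu
  have h := domLE_iff.mp hmu.1.domLE_domRep (Fin.last n)
  have h1 : Finset.Iic (Fin.last n) = Finset.univ := by ext j; simp [Fin.le_last]
  rw [psum, psum, h1, sum_domRep, sum_domRep] at h
  have h2 : ∀ j, |mu j| ≤ ∑ j, |lam j| := fun j =>
    (Finset.single_le_sum (f := fun j => |mu j|) (fun _ _ => abs_nonneg _)
      (Finset.mem_univ j)).trans h
  exact ⟨fun j => (abs_le.mp (h2 j)).1, fun j => (abs_le.mp (h2 j)).2⟩

theorem IsPosGrad.psum_nonneg {v : Weight n} (hv : IsPosGrad v) (k : Fin n) : 0 ≤ psum k v := by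
  obtain ⟨i, j, ⟨hij, rfl⟩ | rfl⟩ := hv
  · rw [psum_sub, psum_single, psum_single]
    split_ifs with h1 h2 h2
    · simp
    · simp
    · exact absurd (hij.le.trans h2) h1
    · simp
  · rw [psum_add, psum_single, psum_single]
    split_ifs <;> simp

theorem sameOrbit_update (v : Weight n) (j : Fin n) :
    SameOrbit v (Function.update v j (-v j)) := by
  refine ⟨Equiv.refl _, fun l => if l = j then -1 else 1, fun l => ?_⟩
  by_cases h : l = j
  · subst h; simp
  · simp [h]

section
variable [Fact (2 ≤ n)]

theorem sameOrbit_aRefl (i : Fin (n + 1)) (x : AffWt n) : SameOrbit x.1 (aRefl i x).1 := by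
  rcases aRefl_cases i with ⟨j, -, -, h⟩ | ⟨j, -, -, h⟩ | ⟨j, k, -, -, h⟩
  · rw [h]; exact sameOrbit_update _ _
  · rw [h]; exact sameOrbit_update _ _
  · rw [h]; exact ⟨Equiv.swap j k, fun _ => 1, fun l => by simp⟩

theorem sameOrbit_wProd (w : List (Fin (n + 1))) (x : AffWt n) :
    SameOrbit x.1 (wProd w x).1 := by
  induction w with
  | nil => exact SameOrbit.refl _
  | cons i w ih => rw [wProd_cons]; exact ih.trans (sameOrbit_aRefl i _)
end
end Koornwinder

namespace Koornwinder

variable {n : ℕ}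

/-! ### Triangular operators -/

/-- The span of the monomials `x^μ` with `μ ≺ λ`. -/
noncomputable def lowSpan (lam : Weight n) : Submodule ℂ (Laurent n) :=
  Submodule.span ℂ {f | ∃ mu, OrdLT mu lam ∧ f = mono mu}

theorem mono_mem_lowSpan {mu lam : Weight n} (h : OrdLT mu lam) : mono mu ∈ lowSpan lam :=
  Submodule.subset_span ⟨mu, h, rfl⟩

theorem lowSpan_mono {mu lam : Weight n} (h : OrdLT mu lam) : lowSpan mu ≤ lowSpan lam := by
  refine Submodule.span_le.mpr ?_
  rintro _ ⟨nu, hnu, rfl⟩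
  exact mono_mem_lowSpan (hnu.trans h)

/-- Triangular operators with given diagonal. -/
def IsTri (A : Module.End ℂ (Laurent n)) (d : Weight n → ℂ) : Prop :=
  ∀ lam, A (mono lam) - d lam • mono lam ∈ lowSpan lam

theorem IsTri.map_lowSpan {A : Module.End ℂ (Laurent n)} {d : Weight n → ℂ} (hA : IsTri A d)
    {lam : Weight n} {f : Laurent n} (hf : f ∈ lowSpan lam) : A f ∈ lowSpan lam := by
  have : lowSpan lam ≤ (lowSpan lam).comap A := by
    refine Submodule.span_le.mpr ?_
    rintro _ ⟨mu, hmu, rfl⟩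
    have h := lowSpan_mono hmu (hA mu)
    have h2 := Submodule.smul_mem _ (d mu) (mono_mem_lowSpan hmu)
    have h3 := Submodule.add_mem _ h h2
    rwa [sub_add_cancel] at h3
  exact this hf

theorem IsTri.mul {A B : Module.End ℂ (Laurent n)} {d e : Weight n → ℂ} (hA : IsTri A d)
    (hB : IsTri B e) : IsTri (A * B) fun lam => d lam * e lam := by
  intro lam
  have h1 := hA.map_lowSpan (hB lam)
  have h2 := Submodule.smul_mem _ (e lam) (hA lam)
  have h3 := Submodule.add_mem _ h1 h2
  convert h3 using 1
  rw [Module.End.mul_apply, map_sub, map_smul, smul_sub, smul_smul, mul_comm (e lam)]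
  abel

theorem isTri_one : IsTri (1 : Module.End ℂ (Laurent n)) fun _ => 1 := by
  intro lam
  simp

/-! ### The operators `T_i s_i` -/

/-- The span of the `x^{v + k h}` with `0 < k < m`. -/
noncomputable def openString (v h : Weight n) (m : ℤ) : Submodule ℂ (Laurent n) :=
  Submodule.span ℂ {f | ∃ k : ℤ, 0 < k ∧ k < m ∧ f = mono (v + k • h)}

theorem mono_mem_openString {v h : Weight n} {m k : ℤ} (hk : 0 < k) (hkm : k < m) :
    mono (v + k • h) ∈ openString v h m := Submodule.subset_span ⟨k, hk, hkm, rfl⟩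

theorem openString_le {v h : Weight n} {m m' : ℤ} (hm : m ≤ m') :
    openString v h m ≤ openString v h m' := by
  refine Submodule.span_le.mpr ?_
  rintro _ ⟨k, hk, hkm, rfl⟩
  exact mono_mem_openString hk (by omega)

/-- The ratio of a simple root by its coroot. -/
def rootRatio (i : Fin (n + 1)) : ℤ := if i = 0 ∨ i = Fin.last n then 2 else 1

section
variable [Fact (2 ≤ n)]

theorem rootGrad_eq_ratio (i : Fin (n + 1)) :
    (rootGrad i : Weight n) = rootRatio i • corootGrad i := by
  by_cases hi : IsLong i
  · rw [hi.rootGrad_eq, show rootRatio i = 2 from if_pos hi]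
  · rw [rootGrad_eq_of_not_isLong hi, show rootRatio i = 1 from if_neg hi, one_smul]

omit [Fact (2 ≤ n)] in
theorem rootRatio_pos (i : Fin (n + 1)) : 0 < rootRatio i := by
  unfold rootRatio; split_ifs <;> norm_num

theorem rootRatio_mul_dot (i : Fin (n + 1)) :
    rootRatio i * ((corootGrad i : Weight n) ⬝ᵥ corootGrad i) = 2 := by
  have := pairing_root_self (n := n) i
  rwa [rootGrad_eq_ratio, pairing_smul] at this

theorem vNum_eq (p : Parameters) (i : Fin (n + 1)) : ∃ c : ℂ, (¬ IsLong i → c = 0) ∧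
    vNum p i = 1 + c • mono (corootGrad i) - p.tval i ^ 2 • am p (aRoot i : AffWt n) := by
  by_cases hi : IsLong i
  · refine ⟨if i = 0 then (p.t0 * p.t0v⁻¹ * p.qh - p.t0 * p.t0v * p.qh)
      else (p.tn * p.tnv⁻¹ - p.tn * p.tnv), fun h => absurd hi h, ?_⟩
    rw [am_eq_smul, aRoot, hi.rootGrad_eq, two_smul, ← mono_mul]
    have := Fact.out (p := 2 ≤ n)
    have key : ∀ (a b : ℂ) (f : Laurent n), (1 - a • f) * (1 + b • f) =
        1 + (b - a) • f - (a * b) • (f * f) := by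
      intro a b f
      rw [sub_mul, one_mul, mul_add, mul_one, smul_mul_smul_comm, sub_smul]
      abel
    rcases hi with rfl | rfl
    · simp only [vNum, if_true, corootGrad, key, rootDelta, Parameters.tval, zpow_one, smul_smul]
      congr 2
      have := p.t0v_ne
      rw [Parameters.q]
      field_simp
    · have h : Fin.last n ≠ 0 := by intro h; simp [Fin.ext_iff] at h; omega
      simp only [vNum, h, if_true, if_false, corootGrad, key, rootDelta, Parameters.tval, zpow_zero,
        smul_smul]
      congr 2
      have := p.tnv_ne
      field_simp
  · refine ⟨0, fun _ => rfl, ?_⟩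
    rw [zero_smul, add_zero, am_eq_smul, aRoot, rootDelta_eq_of_not_isLong hi,
      tval_of_not_isLong p hi, zpow_zero, one_smul]
    simp only [IsLong, not_or] at hi
    simp [vNum, hi]

omit [Fact (2 ≤ n)] in
theorem am_mem {p : Parameters} {x : AffWt n} {S : Submodule ℂ (Laurent n)}
    (h : mono x.1 ∈ S) : am p x ∈ S := by
  rw [am_eq_smul]; exact S.smul_mem _ h

omit [Fact (2 ≤ n)] in
theorem mono_mul_am (p : Parameters) (v : Weight n) (x : AffWt n) :
    mono v * am p x = am p (x + (v, 0)) := by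
  rw [add_comm, am_add, am_mk_zero]

theorem vNum_mul_sum (p : Parameters) (i : Fin (n + 1)) (y : AffWt n) (m : ℕ) :
    vNum p i * ∑ k ∈ Finset.range (m + 1), am p (y + (k : ℤ) • aRoot i) -
      (am p y - p.tval i ^ 2 • am p (y + ((m : ℤ) + 1) • aRoot i)) ∈
    openString y.1 (corootGrad i) (((m : ℤ) + 1) * rootRatio i) := by
  obtain ⟨c, hc, hv⟩ := vNum_eq (n := n) p i
  have hr := rootRatio_pos i
  -- the middle term of `vNum p i` times a monomial of the string
  have mid : ∀ m : ℕ, c • (mono (corootGrad i) * am p (y + (m : ℤ) • aRoot i)) ∈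
      openString y.1 (corootGrad i) (((m : ℤ) + 1) * rootRatio i) := by
    intro m
    by_cases hi : IsLong i
    · refine Submodule.smul_mem _ _ ?_
      rw [mono_mul_am]
      refine am_mem ?_
      have e : (y + (m : ℤ) • aRoot i + (corootGrad i, 0)).1 =
          y.1 + ((m : ℤ) * rootRatio i + 1) • corootGrad i := by
        simp only [Prod.fst_add, Prod.smul_fst, aRoot, rootGrad_eq_ratio]
        module
      have h2 : rootRatio i = 2 := if_pos hi
      rw [e, h2]
      exact mono_mem_openString (by omega) (by omega)
    · rw [hc hi, zero_smul]; exact Submodule.zero_mem _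
  have step : ∀ m : ℕ, vNum p i * am p (y + (m : ℤ) • aRoot i) =
      am p (y + (m : ℤ) • aRoot i) + c • (mono (corootGrad i) * am p (y + (m : ℤ) • aRoot i)) -
      p.tval i ^ 2 • am p (y + ((m : ℤ) + 1) • aRoot i) := by
    intro m
    rw [hv, sub_mul, add_mul, one_mul, smul_mul_assoc, smul_mul_assoc, ← am_add]
    congr 3
    module
  induction m with
  | zero =>
    have h := mid 0
    have h2 := step 0
    simp only [Nat.cast_zero, zero_smul, add_zero, zero_add, one_smul] at h h2 ⊢
    rw [Finset.sum_range_one, Nat.cast_zero, zero_smul, add_zero, h2]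
    convert h using 1
    abel
  | succ m ih =>
    rw [Finset.sum_range_succ, mul_add, step]
    have h1 := openString_le (m' := ((m + 1 : ℕ) + 1 : ℤ) * rootRatio i)
      (by push_cast; nlinarith) ih
    have h2 := mid (m + 1)
    have h3 : am p (y + ((m + 1 : ℕ) : ℤ) • aRoot i) ∈
        openString y.1 (corootGrad i) (((m + 1 : ℕ) + 1 : ℤ) * rootRatio i) := by
      refine am_mem ?_
      have e : (y + ((m + 1 : ℕ) : ℤ) • aRoot i).1 =
          y.1 + (((m + 1 : ℕ) : ℤ) * rootRatio i) • corootGrad i := by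
        simp only [Prod.fst_add, Prod.smul_fst, aRoot, rootGrad_eq_ratio]
        module
      rw [e]
      exact mono_mem_openString (by push_cast; positivity) (by nlinarith)
    have h4 := Submodule.smul_mem _ (1 - p.tval i ^ 2) h3
    have h5 := Submodule.add_mem _ (Submodule.add_mem _ h1 h2) h4
    convert h5 using 1
    push_cast
    rw [sub_smul, one_smul]
    abel

omit [Fact (2 ≤ n)] in
theorem heckeOp_mono (p : Parameters) (i : Fin (n + 1)) (v : Weight n) :
    heckeOp p i (mono v) = p.tval i • mono v - (p.tval i)⁻¹ • (vNum p i * divDiff p i (mono v)) :=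
  rfl

omit [Fact (2 ≤ n)] in
theorem divDiff_mono_of_neg (p : Parameters) (i : Fin (n + 1)) (v : Weight n) {m : ℕ}
    (h : pairing v i = -(m : ℤ)) :
    divDiff p i (mono v) = ∑ k ∈ Finset.range m, am p ((v, 0) + (k : ℤ) • aRoot i) := by
  rw [divDiff, ofMono_mono, if_neg (by omega), h, neg_neg, Int.toNat_natCast]
  refine Finset.sum_congr rfl fun k _ => ?_
  simp [am, aRoot]

omit [Fact (2 ≤ n)] in
theorem divDiff_mono_of_pos (p : Parameters) (i : Fin (n + 1)) (v : Weight n) {m : ℕ}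
    (h : pairing v i = (m : ℤ) + 1) :
    divDiff p i (mono v) = -∑ k ∈ Finset.range (m + 1),
      am p ((v, 0) - ((m : ℤ) + 1) • aRoot i + (k : ℤ) • aRoot i) := by
  rw [divDiff, ofMono_mono, if_pos (by omega), h, show ((m : ℤ) + 1).toNat = m + 1 by omega,
    ← Finset.sum_range_reflect]
  congr 1
  refine Finset.sum_congr rfl fun k hk => ?_
  rw [Finset.mem_range] at hk
  have e : (((m + 1 - 1 - k : ℕ) : ℤ) + 1) = (m : ℤ) + 1 - k := by omega
  rw [e]
  have e2 : ((v, 0) - ((m : ℤ) + 1) • aRoot i + (k : ℤ) • aRoot i : AffWt n) =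
      (v - ((m : ℤ) + 1 - k) • rootGrad i, -(((m : ℤ) + 1 - k) * rootDelta i)) := by
    ext1
    · simp only [Prod.fst_add, Prod.fst_sub, Prod.smul_fst, aRoot]; module
    · simp only [Prod.snd_add, Prod.snd_sub, Prod.smul_snd, aRoot, smul_eq_mul]; ring
  rw [e2]; rfl

/-- `T_i` on `x^v` with `⟨v, a_i^∨⟩ < 0`. -/
theorem heckeOp_mono_of_neg (p : Parameters) (i : Fin (n + 1)) (v : Weight n) {m : ℕ}
    (h : pairing v i = -((m : ℤ) + 1)) :
    heckeOp p i (mono v) - (p.tval i • am p ((v, 0) + ((m : ℤ) + 1) • aRoot i) +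
      (p.tval i - (p.tval i)⁻¹) • mono v) ∈
      openString v (corootGrad i) (((m : ℤ) + 1) * rootRatio i) := by
  have h1 := Submodule.smul_mem _ (-(p.tval i)⁻¹) (vNum_mul_sum p i (v, 0) m)
  have ht := tval_ne_zero p i
  rw [heckeOp_mono, divDiff_mono_of_neg p i v (m := m + 1) (by push_cast; exact h)]
  convert h1 using 1
  rw [am_mk_zero, smul_sub, smul_sub, smul_smul,
    show -(p.tval i)⁻¹ * p.tval i ^ 2 = -p.tval i by field_simp]
  module

/-- `T_i` on `x^v` with `⟨v, a_i^∨⟩ > 0`. -/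
theorem heckeOp_mono_of_pos (p : Parameters) (i : Fin (n + 1)) (v : Weight n) {m : ℕ}
    (h : pairing v i = (m : ℤ) + 1) :
    heckeOp p i (mono v) - (p.tval i)⁻¹ • am p ((v, 0) - ((m : ℤ) + 1) • aRoot i) ∈
      openString (v - ((m : ℤ) + 1) • rootGrad i) (corootGrad i)
        (((m : ℤ) + 1) * rootRatio i) := by
  have h1 := Submodule.smul_mem _ ((p.tval i)⁻¹)
    (vNum_mul_sum p i ((v, 0) - ((m : ℤ) + 1) • aRoot i) m)
  have ht := tval_ne_zero p i
  rw [heckeOp_mono, divDiff_mono_of_pos p i v h]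
  convert (show _ ∈ openString (v - ((m : ℤ) + 1) • rootGrad i) (corootGrad i)
    (((m : ℤ) + 1) * rootRatio i) from h1) using 1
  rw [sub_add_cancel, am_mk_zero, smul_sub, smul_sub, smul_smul,
    show (p.tval i)⁻¹ * p.tval i ^ 2 = p.tval i by field_simp, mul_neg]
  module

/-- The action of `T_i s_i` on monomials. -/
theorem heckeOp_affOp_mono (p : Parameters) (i : Fin (n + 1)) (v : Weight n) :
    heckeOp p i (affOp p (aRefl i) (mono v)) -
      (if 0 ≤ pairing v i then p.tval i else (p.tval i)⁻¹) • mono v ∈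
    Submodule.span ℂ {f | ∃ k : ℤ, ((0 < k ∧ k ≤ pairing v i * rootRatio i) ∨
      (k < 0 ∧ pairing v i * rootRatio i < k)) ∧ f = mono (v - k • corootGrad i)} := by
  have hr := rootRatio_pos i
  have ht := tval_ne_zero p i
  have hs : affOp p (aRefl i) (mono v) =
      p.q ^ (aRefl i ((v, 0) : AffWt n)).2 • mono (wRefl i v) := by
    rw [affOp_mono, am_eq_smul, aRefl_fst]
  have hs1 : aRefl i ((v, 0) : AffWt n) = (v, 0) - pairing v i • aRoot i := rfl
  have hw : wRefl i v = v - (pairing v i * rootRatio i) • corootGrad i := by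
    rw [wRefl, rootGrad_eq_ratio, smul_smul]
  have hp : pairing (wRefl i v) i = -pairing v i := by
    rw [pairing_wRefl, cartan_self]; ring
  have hq := p.q_ne
  have ham : am p ((wRefl i v, 0) + pairing v i • aRoot i) =
      p.q ^ (-(aRefl i ((v, 0) : AffWt n)).2) • mono v := by
    have e : ((wRefl i v, 0) + pairing v i • aRoot i : AffWt n) =
        (v, -(aRefl i ((v, 0) : AffWt n)).2) := by
      rw [hs1]
      ext1
      · simp [aRoot, wRefl]
      · simp
    rw [e]; rfl
  rw [hs, map_smul]
  set c := (aRefl i ((v, 0) : AffWt n)).2 with hcdef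
  rcases lt_trichotomy (pairing v i) 0 with hneg | hzero | hpos
  · obtain ⟨m, hm⟩ : ∃ m : ℕ, pairing v i = -((m : ℤ) + 1) :=
      ⟨(-pairing v i - 1).toNat, by omega⟩
    rw [if_neg (by omega)]
    have h1 := heckeOp_mono_of_pos p i (wRefl i v) (m := m) (by rw [hp, hm, neg_neg])
    have e1 : ((wRefl i v, 0) - ((m : ℤ) + 1) • aRoot i : AffWt n) =
        (wRefl i v, 0) + pairing v i • aRoot i := by rw [hm]; module
    have e2 : wRefl i v - ((m : ℤ) + 1) • rootGrad i = v := by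
      rw [wRefl, hm]; module
    rw [e1, e2, ham] at h1
    have h2 := Submodule.smul_mem _ (p.q ^ c) h1
    rw [smul_sub, smul_comm (p.q ^ c), smul_smul (p.q ^ c), ← zpow_add₀ hq, add_neg_cancel,
      zpow_zero, one_smul] at h2
    refine Submodule.span_mono ?_ h2
    rintro _ ⟨k, hk, hkm, rfl⟩
    refine ⟨-k, Or.inr ⟨by omega, ?_⟩, by rw [neg_smul, sub_neg_eq_add]⟩
    rw [hm]; linarith
  · rw [if_pos hzero.ge]
    have h0 : divDiff p i (mono v) = 0 := by
      rw [divDiff_mono_of_neg p i v (m := 0) (by simpa using hzero)]; simp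
    have hc : c = 0 := by rw [hcdef, hs1, hzero]; simp
    have hv : wRefl i v = v := by rw [wRefl, hzero]; simp
    rw [hc, hv, zpow_zero, one_smul, heckeOp_mono, h0, mul_zero, smul_zero, sub_zero, sub_self]
    exact Submodule.zero_mem _
  · obtain ⟨m, hm⟩ : ∃ m : ℕ, pairing v i = (m : ℤ) + 1 := ⟨(pairing v i - 1).toNat, by omega⟩
    rw [if_pos hpos.le]
    have h1 := heckeOp_mono_of_neg p i (wRefl i v) (m := m) (by rw [hp, hm])
    rw [← hm, ham] at h1
    have h2 := Submodule.smul_mem _ (p.q ^ c) h1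
    rw [smul_sub, smul_add, smul_comm (p.q ^ c) (p.tval i), smul_smul (p.q ^ c) (p.q ^ (-c)),
      ← zpow_add₀ hq, add_neg_cancel, zpow_zero, one_smul] at h2
    set S := Submodule.span ℂ {f : Laurent n | ∃ k : ℤ, ((0 < k ∧ k ≤ pairing v i * rootRatio i) ∨
      (k < 0 ∧ pairing v i * rootRatio i < k)) ∧ f = mono (v - k • corootGrad i)}
    have h3 : openString (wRefl i v) (corootGrad i) (pairing v i * rootRatio i) ≤ S := by
      refine Submodule.span_mono ?_
      rintro _ ⟨k, hk, hkm, rfl⟩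
      refine ⟨pairing v i * rootRatio i - k, Or.inl ⟨by omega, by omega⟩, ?_⟩
      rw [hw]
      congr 1
      module
    have h4 : mono (wRefl i v) ∈ S := by
      refine Submodule.subset_span ⟨pairing v i * rootRatio i, Or.inl ⟨?_, le_rfl⟩, by rw [hw]⟩
      exact mul_pos hpos hr
    have h5 := S.add_mem (h3 h2) (S.smul_mem (p.q ^ c * (p.tval i - (p.tval i)⁻¹)) h4)
    convert h5 using 1
    rw [mul_smul]
    abel

omit [Fact (2 ≤ n)] in
theorem FixesDelta.apply_fst {g : AffAut n} (hg : FixesDelta g) (x : AffWt n) :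
    (g x).1 = (g (x.1, 0)).1 := by
  rw [hg.apply x]; simp

/-- A conjugate of `T_i s_i` attached to a root with positive gradient is triangular. -/
theorem isTri_conj (p : Parameters) (u : List (Fin (n + 1))) (i : Fin (n + 1))
    (hpos : IsPosGrad (wProd u (aRoot i)).1) :
    IsTri (affOp p (wProd u) * (heckeOp p i * affOp p (aRefl i)) * affOp p (wProd u)⁻¹)
      fun mu => if 0 ≤ pairing ((wProd u)⁻¹ ((mu, 0) : AffWt n)).1 i then p.tval i
        else (p.tval i)⁻¹ := by
  intro mu
  have hg := fixesDelta_wProd u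
  set g := wProd u with hgdef
  obtain ⟨x, hx⟩ : ∃ x : AffWt n, x = g⁻¹ (mu, 0) := ⟨_, rfl⟩
  obtain ⟨be, hbe⟩ : ∃ be : Weight n, be = (g ((corootGrad i, 0) : AffWt n)).1 := ⟨_, rfl⟩
  have hgx : g x = (mu, 0) := by rw [hx, apply_inv_apply]
  have hroot : (g (aRoot i)).1 = rootRatio i • be := by
    rw [hg.apply_fst, hbe]
    have : ((aRoot i : AffWt n).1, (0 : ℤ)) = rootRatio i • ((corootGrad i, 0) : AffWt n) := by
      ext1
      · simp [aRoot, rootGrad_eq_ratio]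
      · simp
    rw [this, map_zsmul]; rfl
  have hr := rootRatio_pos i
  have hbb : rootRatio i * (be ⬝ᵥ be) = 2 := by
    rw [hbe, hgdef, wProd_dot]; exact rootRatio_mul_dot i
  have hmb : mu ⬝ᵥ be = pairing x.1 i := by
    have h1 := wProd_dot u x (corootGrad i, 0)
    rw [← hgdef, hgx, ← hbe] at h1
    exact h1
  have hbpos : 0 < be ⬝ᵥ be := pos_of_mul_pos_right (by rw [hbb]; norm_num) hr.le
  have hgen : ∀ k : ℤ, (g ((x.1 - k • corootGrad i, 0) : AffWt n)).1 = mu - k • be := by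
    intro k
    have e : ((x.1 - k • corootGrad i, 0) : AffWt n) = (x.1, 0) - k • (corootGrad i, 0) := by
      ext <;> simp
    rw [e, map_sub, map_zsmul, Prod.fst_sub, Prod.smul_fst, ← hg.apply_fst, hgx, ← hbe]
  obtain ⟨N, hN⟩ : ∃ N, N = pairing x.1 i * rootRatio i := ⟨_, rfl⟩
  have hNb : N * (be ⬝ᵥ be) = 2 * (mu ⬝ᵥ be) := by
    rw [hN, hmb, mul_assoc, hbb, mul_comm]
  have horb : SameOrbit mu (mu - N • be) := by
    have e1 : (aRefl i ((x.1, 0) : AffWt n)).1 = x.1 - N • corootGrad i := by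
      rw [aRefl_fst, wRefl, rootGrad_eq_ratio, smul_smul, hN]
    have h1 := sameOrbit_wProd u.reverse ((mu, 0) : AffWt n)
    rw [wProd_reverse, ← hgdef, ← hx] at h1
    have h2 := sameOrbit_aRefl i ((x.1, 0) : AffWt n)
    rw [e1] at h2
    have h3 := sameOrbit_wProd u ((x.1 - N • corootGrad i, 0) : AffWt n)
    rw [← hgdef, hgen] at h3
    exact (h1.trans h2).trans h3
  have hlt : ∀ k : ℤ, ((0 < k ∧ k ≤ N) ∨ (k < 0 ∧ N < k)) → OrdLT (mu - k • be) mu := by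
    intro k hk
    rcases hk with ⟨h1, h2⟩ | ⟨h1, h2⟩
    · rcases eq_or_lt_of_le h2 with rfl | h2
      · refine ⟨Or.inr ⟨horb.domRep_eq.symm, ?_⟩, fun e => ?_⟩
        · rw [domLE_iff]
          intro l
          have h4 := hpos.psum_nonneg l
          rw [hroot, psum_smul] at h4
          have h5 : 0 ≤ psum l be := nonneg_of_mul_nonneg_right h4 hr
          rw [psum_sub, psum_smul]
          nlinarith
        · rw [sub_eq_self, smul_eq_zero] at e
          rcases e with e | e
          · omega
          · rw [e] at hbpos; simp at hbpos
      · exact ordLT_of_root_string horb hNb hbpos h1 h2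
    · have e : mu - k • be = mu - (-k) • (-be) := by module
      rw [e]
      refine ordLT_of_root_string (N := -N) ?_ ?_ ?_ (by omega) (by omega)
      · rwa [neg_smul_neg]
      · rw [neg_dotProduct_neg, dotProduct_neg]; linarith
      · rwa [neg_dotProduct_neg]
  have h1 := heckeOp_affOp_mono p i x.1
  rw [← hN] at h1
  have h2 : affOp p g (heckeOp p i (affOp p (aRefl i) (mono x.1)) -
      (if 0 ≤ pairing x.1 i then p.tval i else (p.tval i)⁻¹) • mono x.1) ∈ lowSpan mu := by
    have hle : Submodule.span ℂ {f : Laurent n | ∃ k : ℤ, ((0 < k ∧ k ≤ N) ∨ (k < 0 ∧ N < k)) ∧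
        f = mono (x.1 - k • corootGrad i)} ≤ (lowSpan mu).comap (affOp p g) := by
      refine Submodule.span_le.mpr ?_
      rintro _ ⟨k, hk, rfl⟩
      change affOp p g (mono _) ∈ lowSpan mu
      rw [affOp_mono]
      refine am_mem ?_
      rw [hgen]
      exact mono_mem_lowSpan (hlt k hk)
    exact hle h1
  have h3 := Submodule.smul_mem _ (p.q ^ x.2) h2
  convert h3 using 1
  simp only [Module.End.mul_apply]
  rw [affOp_mono, ← hx, am_eq_smul, map_smul, map_smul, map_smul, map_sub, smul_sub, map_smul,
    smul_comm (p.q ^ x.2) (ite _ _ _), ← map_smul (affOp p g) (p.q ^ x.2) (mono x.1),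
    ← am_eq_smul, affOp_am p hg, hgx, am_mk_zero]
end
end Koornwinder

namespace Koornwinder

variable {n : ℕ}

/-! ### The diagonal of the `Y`-operators -/

/-- A regular vector in a chamber having `v` in its closure. -/
def genVec (v : Weight n) : Weight n := fun j => (2 * n + 2) * v j + (n - j)

theorem IsPosGrad.dot_genVec {be : Weight n} (hb : IsPosGrad be) (v : Weight n) :
    (0 ≤ v ⬝ᵥ be → 0 < genVec v ⬝ᵥ be) ∧ (v ⬝ᵥ be < 0 → genVec v ⬝ᵥ be < 0) := by
  have key : ∀ (x e : ℤ), 0 < e → e < 2 * n + 2 →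
      (0 ≤ x → 0 < (2 * (n : ℤ) + 2) * x + e) ∧ (x < 0 → (2 * (n : ℤ) + 2) * x + e < 0) := by
    intro x e h1 h2
    constructor
    · intro h; positivity
    · intro h; nlinarith
  obtain ⟨j, k, ⟨hjk, rfl⟩ | rfl⟩ := hb
  · have := key (v j - v k) ((k : ℤ) - j) (by rw [Fin.lt_def] at hjk; omega)
      (by have := k.isLt; omega)
    simp only [dotProduct_sub, dotProduct_single, mul_one, genVec]
    rwa [show (2 * (n : ℤ) + 2) * v j + (n - j) - ((2 * n + 2) * v k + (n - k)) =
      (2 * (n : ℤ) + 2) * (v j - v k) + ((k : ℤ) - j) by ring]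
  · have := key (v j + v k) ((n - j) + (n - k)) (by have := k.isLt; have := j.isLt; omega)
      (by have := k.isLt; omega)
    simp only [dotProduct_add, dotProduct_single, mul_one, genVec]
    rwa [show (2 * (n : ℤ) + 2) * v j + (n - j) + ((2 * n + 2) * v k + (n - k)) =
      (2 * (n : ℤ) + 2) * (v j + v k) + (((n : ℤ) - j) + (n - k)) by ring]

theorem isTri_affOp_transl (p : Parameters) (nu : Weight n) :
    IsTri (affOp p (transl nu)) fun mu => p.q ^ (nu ⬝ᵥ mu) := by
  intro mu
  rw [affOp_mono, transl_apply, am_eq_smul, zero_add, sub_self]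
  exact Submodule.zero_mem _

section
variable [Fact (2 ≤ n)]

theorem sign_pairing_genVec (u : List (Fin (n + 1))) (i : Fin (n + 1))
    (hpos : IsPosGrad (wProd u (aRoot i)).1) (mu : Weight n) :
    (pairing ((wProd u)⁻¹ ((genVec mu, 0) : AffWt n)).1 i).sign =
      if 0 ≤ pairing ((wProd u)⁻¹ ((mu, 0) : AffWt n)).1 i then 1 else -1 := by
  have h := root_dot_self_pos (n := n) i
  have e : ∀ v : Weight n, ((rootGrad i : Weight n) ⬝ᵥ rootGrad i) *
      pairing ((wProd u)⁻¹ ((v, 0) : AffWt n)).1 i = 2 * (v ⬝ᵥ (wProd u (aRoot i)).1) := by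
    intro v
    rw [root_dot_self_mul_pairing]
    congr 1
    exact wProd_inv_dot u (v, 0) (aRoot i)
  have h1 := e mu
  have h2 := e (genVec mu)
  obtain ⟨h3, h4⟩ := hpos.dot_genVec mu
  split_ifs with hc
  · have h5 : 0 ≤ mu ⬝ᵥ (wProd u (aRoot i)).1 := by
      have := mul_nonneg h.le hc; omega
    rw [Int.sign_eq_one_iff_pos]
    refine pos_of_mul_pos_right ?_ h.le
    rw [h2]
    have := h3 h5
    omega
  · have h5 : mu ⬝ᵥ (wProd u (aRoot i)).1 < 0 := by
      have := mul_neg_of_pos_of_neg h (not_le.mp hc); omega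
    rw [Int.sign_eq_neg_one_iff_neg]
    refine neg_of_mul_neg_right ?_ h.le
    rw [h2]
    have := h4 h5
    omega

theorem fixesDelta_inv (w : List (Fin (n + 1))) : FixesDelta (wProd w)⁻¹ := by
  rw [← wProd_reverse]; exact fixesDelta_wProd _

theorem isTri_word (p : Parameters) (v u : List (Fin (n + 1)))
    (hpos : ∀ v1 i v2, v = v1 ++ i :: v2 → IsPosGrad (wProd (u ++ v1) (aRoot i)).1) :
    IsTri (affOp p (wProd u) * heckeWord p v * affOp p (wProd v)⁻¹ * affOp p (wProd u)⁻¹)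
      fun mu => signProd p.tval v ((wProd u)⁻¹ ((genVec mu, 0) : AffWt n)).1 := by
  induction v generalizing u with
  | nil =>
    have : affOp p (wProd u) * heckeWord p [] * affOp p (wProd [])⁻¹ * affOp p (wProd u)⁻¹ = 1 := by
      rw [wProd_nil, inv_one, affOp_one, heckeWord, List.map_nil, List.prod_nil, mul_one, mul_one,
        ← affOp_mul p (fixesDelta_wProd u), mul_inv_cancel, affOp_one]
    rw [this]
    exact isTri_one
  | cons i v ih =>
    have h1 := hpos [] i v rfl
    rw [List.append_nil] at h1
    have h2 := (isTri_conj p u i h1).mul (ih (u ++ [i]) (by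
      intro v1 j v2 hv
      have := hpos (i :: v1) j v2 (by rw [hv]; rfl)
      rwa [List.append_assoc]))
    have e1 : affOp p (wProd u) * heckeWord p (i :: v) * affOp p (wProd (i :: v))⁻¹ *
        affOp p (wProd u)⁻¹ = affOp p (wProd u) * (heckeOp p i * affOp p (aRefl i)) *
        affOp p (wProd u)⁻¹ * (affOp p (wProd (u ++ [i])) * heckeWord p v * affOp p (wProd v)⁻¹ *
        affOp p (wProd (u ++ [i]))⁻¹) := by
      have a1 : affOp p (wProd (u ++ [i])) = affOp p (wProd u) * affOp p (aRefl i) := by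
        rw [wProd_append, affOp_mul p (fixesDelta_wProd u)]; simp
      have a2 : affOp p (wProd (u ++ [i]))⁻¹ = affOp p (aRefl i) * affOp p (wProd u)⁻¹ := by
        rw [wProd_append, mul_inv_rev, show wProd [i] = (aRefl i : AffAut n) by simp, aRefl_inv,
          affOp_mul p (fixesDelta_aRefl i)]
      have a3 : affOp p (wProd (i :: v))⁻¹ = affOp p (wProd v)⁻¹ * affOp p (aRefl i) := by
        rw [wProd_cons, mul_inv_rev, aRefl_inv, affOp_mul p (fixesDelta_inv v)]
      have a4 : affOp p (wProd u)⁻¹ * affOp p (wProd u) = 1 := by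
        rw [← affOp_mul p (fixesDelta_inv u), inv_mul_cancel, affOp_one]
      have a5 : affOp p (aRefl i) * affOp p (aRefl i : AffAut n) = 1 := by
        rw [← affOp_mul p (fixesDelta_aRefl i), aRefl_mul_self, affOp_one]
      have a6 : heckeWord p (i :: v) = heckeOp p i * heckeWord p v := by simp [heckeWord]
      rw [a1, a2, a3, a6]
      simp only [mul_assoc]
      rw [← mul_assoc (affOp p (wProd u)⁻¹) (affOp p (wProd u)), a4, one_mul,
        ← mul_assoc (affOp p (aRefl i)) (affOp p (aRefl i)), a5, one_mul]
    rw [e1]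
    convert h2 using 2 with mu
    rw [signProd, sign_pairing_genVec u i h1]
    congr 1
    · split_ifs <;> simp
    · congr 1
      rw [wProd_append, mul_inv_rev, show wProd [i] = (aRefl i : AffAut n) by simp, aRefl_inv]
      rfl

theorem signData_tval (p : Parameters) :
    SignData (fun i : Fin (n + 1) => p.tval i) p.t0 p.t p.tn where
  ne := tval_ne_zero p
  zero := by simp [Parameters.tval]
  last := by
    have := Fact.out (p := 2 ≤ n)
    have h : Fin.last n ≠ 0 := by intro h; simp [Fin.ext_iff] at h; omega
    simp [Parameters.tval, h]
  mid i h0 hn := by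
    have h1 : i ≠ 0 := fun e => h0 (by rw [e]; rfl)
    have h2 : i ≠ Fin.last n := fun e => hn (by rw [e]; rfl)
    simp [Parameters.tval, h1, h2]

theorem exists_word_transl {lam : Weight n} (hl : IsDominant lam) : ∃ w, wProd w = transl lam := by
  have p : Parameters := ⟨1, 1, 1, 1, 1, 1, one_ne_zero, one_ne_zero, one_ne_zero, one_ne_zero,
    one_ne_zero, one_ne_zero⟩
  obtain ⟨w, hw, -⟩ := hasSign_transl (signData_tval p) hl.2
  exact ⟨w, hw⟩

omit [Fact (2 ≤ n)] in
theorem rhoL_apply (lam : Weight n) (j : Fin n) : rhoL lam j = sgn (2 * lam j) := by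
  simp [rhoL, Finset.sum_apply, Pi.single_apply]

omit [Fact (2 ≤ n)] in
theorem rhoM_apply (lam : Weight n) (l : Fin n) :
    rhoM lam l = ∑ k ∈ Finset.univ.erase l,
      (if l < k then sgn (lam l - lam k) + sgn (lam l + lam k)
        else -sgn (lam k - lam l) + sgn (lam k + lam l)) := by
  have h1 : rhoM lam l = ∑ i, ∑ j,
      ((if l = i then (if i < j then sgn (lam i - lam j) + sgn (lam i + lam j) else 0) else 0) +
      (if l = j then (if i < j then -sgn (lam i - lam j) + sgn (lam i + lam j) else 0) else 0)) := by
    simp only [rhoM, Finset.sum_apply]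
    refine Finset.sum_congr rfl fun i _ => ?_
    rw [Finset.sum_filter]
    refine Finset.sum_congr rfl fun j _ => ?_
    simp only [Pi.add_apply, Pi.sub_apply, Pi.smul_apply, Pi.single_apply, smul_eq_mul]
    split_ifs <;> simp <;> ring
  have h2 : ∀ i j : Fin n, (if l = i then (if i < j then sgn (lam i - lam j) +
      sgn (lam i + lam j) else 0) else 0) = if l = i then (if l < j then sgn (lam l - lam j) +
      sgn (lam l + lam j) else 0) else 0 := by
    intro i j
    by_cases h : l = i
    · subst h; rfl
    · simp [h]
  simp only [h1, Finset.sum_add_distrib, h2]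
  rw [Finset.sum_comm]
  simp only [Finset.sum_ite_eq, Finset.mem_univ, if_true]
  rw [← Finset.sum_add_distrib, ← Finset.add_sum_erase _ _ (Finset.mem_univ l)]
  simp only [lt_irrefl, if_false, add_zero, zero_add]
  refine Finset.sum_congr rfl fun k hk => ?_
  have hk' : k ≠ l := Finset.ne_of_mem_erase hk
  rcases lt_or_gt_of_ne hk' with h | h
  · simp [h, h.not_gt]
  · simp [h, h.not_gt]

omit [Fact (2 ≤ n)] in
theorem sign_genVec (lam : Weight n) (j : Fin n) : (genVec lam j).sign = sgn (2 * lam j) := by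
  have hj := j.isLt
  unfold sgn genVec
  split_ifs with h
  · rw [Int.sign_eq_one_iff_pos]
    have : 0 ≤ (2 * (n : ℤ) + 2) * lam j := mul_nonneg (by omega) (by omega)
    omega
  · rw [Int.sign_eq_neg_one_iff_neg]
    have : (2 * (n : ℤ) + 2) * lam j ≤ (2 * (n : ℤ) + 2) * (-1) :=
      mul_le_mul_of_nonneg_left (by omega) (by omega)
    omega

omit [Fact (2 ≤ n)] in
theorem signSum_genVec (lam : Weight n) (j : Fin n) :
    signSum (Finset.univ.erase j) j (genVec lam) = rhoM lam j := by
  rw [rhoM_apply, signSum]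
  refine Finset.sum_congr rfl fun k hk => ?_
  have hk' : k ≠ j := Finset.ne_of_mem_erase hk
  have hk2 := k.isLt
  have hj2 := j.isLt
  have key : ∀ (x e : ℤ), 0 < e → e < 2 * n + 2 →
      ((2 * (n : ℤ) + 2) * x + e).sign = sgn x := by
    intro x e h1 h2
    unfold sgn
    split_ifs with h
    · rw [Int.sign_eq_one_iff_pos]; positivity
    · rw [Int.sign_eq_neg_one_iff_neg]; nlinarith
  have hadd : (genVec lam j + genVec lam k).sign = sgn (lam j + lam k) := by
    rw [← key (lam j + lam k) ((n - j) + (n - k)) (by omega) (by omega)]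
    congr 1
    simp only [genVec]; ring
  rw [hadd]
  rcases lt_or_gt_of_ne hk' with h | h
  · rw [if_neg h.not_gt, ← key (lam k - lam j) ((j : ℤ) - k) (by rw [Fin.lt_def] at h; omega)
      (by omega), ← Int.sign_neg, add_comm (lam k)]
    congr 2
    simp only [genVec]; ring
  · rw [if_pos h, ← key (lam j - lam k) ((k : ℤ) - j) (by rw [Fin.lt_def] at h; omega)
      (by omega)]
    congr 2
    simp only [genVec]; ring

/-- The operator `T_{τ(ν)}` for dominant `ν` is triangular, and its diagonal entries are the
`γ_μ^ν`. -/
theorem isTri_heckeElt (p : Parameters) {nu : Weight n} (hn : IsDominant nu) :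
    IsTri (heckeElt p (translation nu)) fun mu => ∏ j, spectralPoint p mu j ^ nu j := by
  obtain ⟨w, hw, hr, he⟩ := exists_heckeElt_eq p (exists_word_transl hn)
  obtain ⟨w0, hw0, hs⟩ := hasSign_transl (signData_tval p) hn.2
  have h1 := isTri_word p w [] (by
    rintro v1 i v2 rfl
    exact hr.transl_root hn hw)
  have h2 := h1.mul (isTri_affOp_transl p nu)
  have e1 : affOp p (wProd []) * heckeWord p w * affOp p (wProd w)⁻¹ * affOp p (wProd [])⁻¹ *
      affOp p (transl nu) = heckeWord p w := by
    rw [wProd_nil, inv_one, affOp_one, one_mul, mul_one, mul_assoc, ← hw,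
      ← affOp_mul p (fixesDelta_inv w), inv_mul_cancel, affOp_one, mul_one]
  rw [e1] at h2
  rw [he]
  convert h2 using 2 with mu
  have hτ : ∀ i j : Fin (n + 1), cartan i j = -1 → cartan j i = -1 → p.tval i = p.tval j := by
    intro i j h h'
    rw [tval_of_not_isLong p (not_isLong_of_cartan h'), tval_of_not_isLong p (not_isLong_of_cartan h)]
  have e2 : signProd p.tval w (genVec mu) = signProd p.tval w0 (genVec mu) :=
    signProd_congr (tval_ne_zero p) hτ (hw.trans hw0.symm) _
  rw [show ((wProd [])⁻¹ ((genVec mu, 0) : AffWt n)).1 = genVec mu from rfl, e2, hs, dotProduct]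
  simp only [sign_genVec, signSum_genVec, ← rhoL_apply]
  have e3 : ∀ s : Finset (Fin n), p.q ^ (∑ j ∈ s, nu j * mu j) = ∏ j ∈ s, (p.q ^ mu j) ^ nu j := by
    intro s
    induction s using Finset.induction_on with
    | empty => simp
    | insert j s hj ih =>
      rw [Finset.sum_insert hj, Finset.prod_insert hj, zpow_add₀ p.q_ne, ih, ← zpow_mul,
        mul_comm (mu j)]
  rw [e3, ← Finset.prod_mul_distrib]
  refine Finset.prod_congr rfl fun j _ => ?_
  rw [spectralPoint, ← mul_zpow, ← mul_zpow]

theorem isUnit_heckeElt (p : Parameters) {nu : Weight n} (hn : IsDominant nu) :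
    IsUnit (heckeElt p (translation nu)) := by
  obtain ⟨w, -, -, he⟩ := exists_heckeElt_eq p (exists_word_transl hn)
  rw [he]
  exact isUnit_heckeWord p w

theorem heckeElt_mul (p : Parameters) {lam mu : Weight n} (hl : IsDominant lam)
    (hm : IsDominant mu) : heckeElt p (translation lam) * heckeElt p (translation mu) =
      heckeElt p (translation (lam + mu)) := by
  have hlm : IsDominant (lam + mu) :=
    ⟨hl.1.add hm.1, fun j => add_nonneg (hl.2 j) (hm.2 j)⟩
  obtain ⟨w, hw, hr, he⟩ := exists_heckeElt_eq p (exists_word_transl hl)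
  obtain ⟨w', hw', hr', he'⟩ := exists_heckeElt_eq p (exists_word_transl hm)
  obtain ⟨v, hv, hrv, hev⟩ := exists_heckeElt_eq p (exists_word_transl hlm)
  have h := (braid_heckeOp p).prod_eq_of_isRed (hr.append_transl hr' hl hm hw hw') hrv
    (by rw [wProd_append, hw, hw', transl_mul, hv])
  rw [he, he', hev, heckeWord, heckeWord, heckeWord, ← h, List.map_append, List.prod_append]

theorem heckeElt_commute (p : Parameters) {lam mu : Weight n} (hl : IsDominant lam)
    (hm : IsDominant mu) :
    Commute (heckeElt p (translation lam)) (heckeElt p (translation mu)) := by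
  rw [Commute, SemiconjBy, heckeElt_mul p hl hm, heckeElt_mul p hm hl, add_comm]

theorem yOp_of_isDominant (p : Parameters) {nu : Weight n} (hn : IsDominant nu) :
    yOp p nu = heckeElt p (translation nu) := by
  rw [yOp, ← heckeElt_mul p hn (domShift_isDominant nu), mul_assoc,
    Ring.mul_inverse_cancel _ (isUnit_heckeElt p (domShift_isDominant nu)), mul_one]
end
end Koornwinder

namespace Koornwinder

variable {n : ℕ}

/-! ### Separation of the spectral points -/

theorem spectralPoint_ne_zero (p : Parameters) (lam : Weight n) (j : Fin n) :
    spectralPoint p lam j ≠ 0 :=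
  mul_ne_zero (mul_ne_zero (mul_ne_zero (zpow_ne_zero _ p.t0_ne) (zpow_ne_zero _ p.tn_ne))
    (zpow_ne_zero _ p.t_ne)) (zpow_ne_zero _ p.q_ne)

theorem exists_sum_eq_two_mul {ι : Type*} (s : Finset ι) (f : ι → ℤ) (c : ℤ)
    (h : ∀ k ∈ s, f k = 0 ∨ f k = 2 * c) : ∃ m : ℕ, m ≤ s.card ∧ ∑ k ∈ s, f k = 2 * (c * m) := by
  classical
  induction s using Finset.induction_on with
  | empty => exact ⟨0, by simp⟩
  | insert a s ha ih =>
    obtain ⟨m, hm, e⟩ := ih fun k hk => h k (Finset.mem_insert_of_mem hk)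
    rw [Finset.sum_insert ha, Finset.card_insert_of_notMem ha, e]
    rcases h a (Finset.mem_insert_self a s) with h0 | h0
    · exact ⟨m, by omega, by rw [h0, zero_add]⟩
    · exact ⟨m + 1, by omega, by rw [h0]; push_cast; ring⟩

theorem exists_rhoM_eq (lam : Weight n) (j : Fin n) :
    ∃ m : ℕ, m < n ∧ rhoM lam j = 2 * (sgn (2 * lam j) * m) := by
  obtain ⟨m, hm, e⟩ := exists_sum_eq_two_mul (Finset.univ.erase j)
    (fun k => if j < k then sgn (lam j - lam k) + sgn (lam j + lam k)
      else -sgn (lam k - lam j) + sgn (lam k + lam j)) (sgn (2 * lam j)) (by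
    intro k _
    simp only [sgn]
    split_ifs <;> omega)
  refine ⟨m, ?_, by rw [rhoM_apply, e]⟩
  rw [Finset.card_erase_of_mem (Finset.mem_univ j), Finset.card_univ, Fintype.card_fin] at hm
  have := j.isLt
  omega

theorem spectralPoint_eq (p : Parameters) (lam : Weight n) (j : Fin n) :
    ∃ m : ℕ, m < n ∧ (spectralPoint p lam j = p.t0 * p.tn * p.t ^ (2 * m) * p.q ^ lam j ∨
      (spectralPoint p lam j)⁻¹ = p.t0 * p.tn * p.t ^ (2 * m) * p.q ^ (-lam j)) := by
  obtain ⟨m, hm, e⟩ := exists_rhoM_eq lam j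
  refine ⟨m, hm, ?_⟩
  rw [spectralPoint, e, rhoL_apply]
  unfold sgn
  split_ifs
  · left
    rw [zpow_one, zpow_one, one_mul]
    norm_cast
  · right
    rw [show (2 : ℤ) * (-1 * m) = -((2 * m : ℕ) : ℤ) by push_cast; ring, zpow_neg, zpow_neg,
      zpow_neg, zpow_neg, zpow_one, zpow_one, zpow_natCast, mul_inv, mul_inv, mul_inv, inv_inv,
      inv_inv, inv_inv]

theorem Parameters.IsGeneric.zpow_injective {p : Parameters} (hp : p.IsGeneric n) {l l' : ℤ}
    (h : p.q ^ l = p.q ^ l') : l = l' := by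
  have key : ∀ a b : ℤ, a < b → p.q ^ a ≠ p.q ^ b := by
    intro a b hab h
    obtain ⟨k, hk⟩ := Int.eq_ofNat_of_zero_le (sub_nonneg.mpr hab.le)
    refine hp.1 k (by omega) ?_
    rw [← zpow_natCast, ← hk, zpow_sub₀ p.q_ne, h,
      div_self (zpow_ne_zero _ p.q_ne)]
  rcases lt_trichotomy l l' with hl | hl | hl
  · exact absurd h (key _ _ hl)
  · exact hl
  · exact absurd h.symm (key _ _ hl)

theorem Parameters.IsGeneric.eq_of_mul_zpow_eq {p : Parameters} (hp : p.IsGeneric n) {m m' : ℕ}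
    (hm : m < n) (hm' : m' < n) {l l' : ℤ}
    (h : p.t ^ (2 * m) * p.q ^ l = p.t ^ (2 * m') * p.q ^ l') : l = l' := by
  have key : ∀ (a b : ℕ) (x y : ℤ), a < b → b < n →
      p.t ^ (2 * a) * p.q ^ x ≠ p.t ^ (2 * b) * p.q ^ y := by
    intro a b x y hab hb h
    refine hp.2.1 (b - a) (by omega) (by omega) (x - y) ?_
    rw [show 2 * b = 2 * a + 2 * (b - a) by omega, pow_add, mul_assoc] at h
    have h2 := mul_left_cancel₀ (pow_ne_zero _ p.t_ne) h
    rw [zpow_sub₀ p.q_ne, h2, mul_div_cancel_right₀ _ (zpow_ne_zero _ p.q_ne)]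
  rcases lt_trichotomy m m' with hlt | rfl | hlt
  · exact absurd h (key _ _ _ _ hlt hm')
  · exact hp.zpow_injective (mul_left_cancel₀ (pow_ne_zero _ p.t_ne) h)
  · exact absurd h.symm (key _ _ _ _ hlt hm)

theorem Parameters.IsGeneric.mul_ne_one {p : Parameters} (hp : p.IsGeneric n) {m m' : ℕ}
    (hm : m < n) (hm' : m' < n) (l l' : ℤ) :
    (p.t0 * p.tn * p.t ^ (2 * m) * p.q ^ l) * (p.t0 * p.tn * p.t ^ (2 * m') * p.q ^ l') ≠ 1 := by
  intro h
  refine hp.2.2 (m + m') (by omega) (-(l + l')) ?_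
  rw [zpow_neg, zpow_add₀ p.q_ne]
  refine eq_inv_of_mul_eq_one_left ?_
  rw [← h]
  ring

theorem Parameters.IsGeneric.spectralPoint_injective {p : Parameters} (hp : p.IsGeneric n)
    {lam mu : Weight n} (h : spectralPoint p lam = spectralPoint p mu) : lam = mu := by
  funext j
  have hj := congrFun h j
  have h0 := spectralPoint_ne_zero p lam j
  have ht := mul_ne_zero p.t0_ne p.tn_ne
  obtain ⟨m, hm, e⟩ := spectralPoint_eq p lam j
  obtain ⟨m', hm', e'⟩ := spectralPoint_eq p mu j
  rw [← hj] at e'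
  rcases e with e | e <;> rcases e' with e' | e'
  · rw [e, mul_assoc, mul_assoc (p.t0 * p.tn)] at e'
    exact hp.eq_of_mul_zpow_eq hm hm' (mul_left_cancel₀ ht e')
  · exact absurd (by rw [← e, ← e', mul_inv_cancel₀ h0]) (hp.mul_ne_one hm hm' (lam j) (-mu j))
  · exact absurd (by rw [← e, ← e', inv_mul_cancel₀ h0]) (hp.mul_ne_one hm hm' (-lam j) (mu j))
  · rw [e, mul_assoc, mul_assoc (p.t0 * p.tn)] at e'
    exact neg_injective (hp.eq_of_mul_zpow_eq hm hm' (mul_left_cancel₀ ht e'))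

theorem exists_isDominant_prod_ne {y z : Fin n → ℂ} (hy : ∀ j, y j ≠ 0) (hz : ∀ j, z j ≠ 0)
    (h : y ≠ z) : ∃ nu : Weight n, IsDominant nu ∧ ∏ j, y j ^ nu j ≠ ∏ j, z j ^ nu j := by
  by_contra! hc
  refine h (funext fun j => ?_)
  have key : ∀ w : Fin n → ℂ, (∀ j, w j ≠ 0) → ∀ nu : Weight n,
      ∏ k, w k ^ ((Pi.single j 1 + nu : Weight n) k) = w j * ∏ k, w k ^ nu k := by
    intro w hw nu
    simp only [Pi.add_apply, zpow_add₀ (hw _), Finset.prod_mul_distrib, Pi.single_apply]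
    congr 1
    rw [Finset.prod_eq_single j] <;> simp +contextual
  have h1 := hc _ (add_domShift_isDominant (Pi.single j 1))
  rw [key y hy, key z hz, hc _ (domShift_isDominant (Pi.single j 1))] at h1
  exact mul_right_cancel₀ (Finset.prod_ne_zero_iff.mpr fun k _ => zpow_ne_zero _ (hz k)) h1

/-! ### Triangular families -/

/-- The number of weights below a given one. -/
noncomputable def ordRank (lam : Weight n) : ℕ := {mu | OrdLT mu lam}.ncard

theorem ordRank_lt {lam mu : Weight n} (h : OrdLT mu lam) : ordRank mu < ordRank lam :=
  Set.ncard_lt_ncard ⟨fun _ hnu => OrdLT.trans hnu h, fun hs => OrdLT.irrefl mu (hs h)⟩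
    (finite_setOf_ordLT lam)

theorem coeff_eq_zero_of_mem_lowSpan {lam mu : Weight n} (h : ¬ OrdLT mu lam) {f : Laurent n}
    (hf : f ∈ lowSpan lam) : f.coeff mu = 0 := by
  induction hf using Submodule.span_induction with
  | mem x hx =>
    obtain ⟨nu, hnu, rfl⟩ := hx
    rw [mono, AddMonoidAlgebra.coeff_single, Finsupp.single_eq_of_ne]
    rintro rfl
    exact h hnu
  | zero => simp
  | add x y _ _ hx hy => simp [hx, hy]
  | smul c x _ hx => simp [hx]

theorem coeff_of_sub_mem_lowSpan {lam mu : Weight n} (h : ¬ OrdLT mu lam) {f : Laurent n}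
    (hf : f - mono lam ∈ lowSpan lam) : f.coeff mu = if mu = lam then 1 else 0 := by
  have h1 := coeff_eq_zero_of_mem_lowSpan h hf
  rw [AddMonoidAlgebra.coeff_sub, Finsupp.sub_apply, sub_eq_zero] at h1
  rw [h1, mono, AddMonoidAlgebra.coeff_single, Finsupp.single_apply]
  simp only [eq_comm]

theorem linearIndependent_of_sub_mem_lowSpan {P : Weight n → Laurent n}
    (hP : ∀ lam, P lam - mono lam ∈ lowSpan lam) : LinearIndependent ℂ P := by
  rw [linearIndependent_iff']
  intro s g
  induction s using Finset.induction_on_max_value ordRank with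
  | empty => simp
  | insert a s ha hmax ih =>
    intro h0
    have h1 : g a = 0 := by
      have h2 := congrArg (fun f : Laurent n => f.coeff a) h0
      rw [Finset.sum_insert ha] at h2
      have h3 : (∑ i ∈ s, g i • P i).coeff a = 0 := by
        have : ∀ t ⊆ s, (∑ i ∈ t, g i • P i).coeff a = 0 := by
          intro t
          induction t using Finset.induction_on with
          | empty => simp
          | insert b t hb ih =>
            intro ht
            have hbs := ht (Finset.mem_insert_self b t)
            rw [Finset.sum_insert hb, AddMonoidAlgebra.coeff_add, Finsupp.add_apply,
              ih fun x hx => ht (Finset.mem_insert_of_mem hx), AddMonoidAlgebra.coeff_smul,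
              Finsupp.smul_apply, coeff_of_sub_mem_lowSpan _ (hP b), if_neg, smul_zero, add_zero]
            · rintro rfl; exact ha hbs
            · exact fun h => (ordRank_lt h).not_ge (hmax b hbs)
        exact this s subset_rfl
      simp only [AddMonoidAlgebra.coeff_add, Finsupp.add_apply, h3, AddMonoidAlgebra.coeff_smul,
        Finsupp.smul_apply, coeff_of_sub_mem_lowSpan (OrdLT.irrefl a) (hP a), if_true,
        smul_eq_mul, mul_one, add_zero, AddMonoidAlgebra.coeff_zero, Finsupp.zero_apply] at h2
      exact h2
    rw [Finset.sum_insert ha, h1, zero_smul, zero_add] at h0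
    intro i hi
    rcases Finset.mem_insert.mp hi with rfl | hi
    · exact h1
    · exact ih h0 i hi

theorem sum_coeff_smul_mono (f : Laurent n) : f.coeff.sum (fun lam c => c • mono lam) = f := by
  have h : ofMono (mono : Weight n → Laurent n) = 1 := end_ext fun lam => ofMono_mono _ lam
  exact LinearMap.congr_fun h f

theorem span_eq_top_of_sub_mem_lowSpan {P : Weight n → Laurent n}
    (hP : ∀ lam, P lam - mono lam ∈ lowSpan lam) : ⊤ ≤ Submodule.span ℂ (Set.range P) := by
  have h : ∀ (N : ℕ) (lam : Weight n), ordRank lam = N →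
      mono lam ∈ Submodule.span ℂ (Set.range P) := by
    intro N
    induction N using Nat.strong_induction_on with
    | _ N ih =>
      rintro lam rfl
      have h1 : lowSpan lam ≤ Submodule.span ℂ (Set.range P) := by
        refine Submodule.span_le.mpr ?_
        rintro _ ⟨mu, hmu, rfl⟩
        exact ih _ (ordRank_lt hmu) mu rfl
      have h2 := Submodule.sub_mem _ (Submodule.subset_span (Set.mem_range_self lam)) (h1 (hP lam))
      rwa [sub_sub_cancel] at h2
  intro f _
  rw [← sum_coeff_smul_mono f]
  exact Submodule.sum_mem _ fun lam _ => Submodule.smul_mem _ _ (h _ lam rfl)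

/-! ### Joint eigenvectors -/

/-- Joint eigenvectors of the `T_{τ(ν)}` with eigenvalues `γ_λ^ν`, for dominant `ν`. -/
def IsJointEigen (p : Parameters) (lam : Weight n) (f : Laurent n) : Prop :=
  ∀ nu, IsDominant nu →
    heckeElt p (translation nu) f = (∏ j, spectralPoint p lam j ^ nu j) • f

section
variable [Fact (2 ≤ n)]

theorem exists_annihilator {p : Parameters} (hp : p.IsGeneric n) (lam : Weight n)
    (S : Finset (Weight n)) (hS : ∀ m ∈ S, ∀ mu, OrdLT mu m → mu ∈ S) (hlam : lam ∉ S) :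
    ∃ (C : Module.End ℂ (Laurent n)) (d : Weight n → ℂ), IsTri C d ∧ d lam ≠ 0 ∧
      (∀ nu, IsDominant nu → Commute C (heckeElt p (translation nu))) ∧
      (∀ mu ∈ S, C (mono mu) = 0) ∧ ∀ f, IsJointEigen p lam f → C f = d lam • f := by
  induction S using Finset.induction_on_max_value ordRank with
  | empty => exact ⟨1, fun _ => 1, isTri_one, one_ne_zero, fun nu _ => Commute.one_left _, by simp,
      fun f _ => by simp⟩
  | insert a s ha hmax ih =>
    rw [Finset.mem_insert, not_or] at hlam
    have hs : ∀ m ∈ s, ∀ mu, OrdLT mu m → mu ∈ s := by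
      intro m hm mu hmu
      rcases Finset.mem_insert.mp (hS m (Finset.mem_insert_of_mem hm) mu hmu) with rfl | h
      · exact absurd (hmax m hm) (ordRank_lt hmu).not_ge
      · exact h
    obtain ⟨C, d, hC, hd, hcomm, hkill, heig⟩ := ih hs hlam.2
    have hlow : ∀ m ∈ insert a s, ∀ f ∈ lowSpan m, C f = 0 := by
      intro m hm f hf
      have hle : lowSpan m ≤ LinearMap.ker C := by
        refine Submodule.span_le.mpr ?_
        rintro _ ⟨mu, hmu, rfl⟩
        refine hkill mu ?_
        rcases Finset.mem_insert.mp (hS m hm mu hmu) with rfl | h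
        · rcases Finset.mem_insert.mp hm with rfl | hm
          · exact absurd hmu (OrdLT.irrefl _)
          · exact hs m hm _ hmu
        · exact h
      exact hle hf
    obtain ⟨nu, hnu, hne⟩ := exists_isDominant_prod_ne (spectralPoint_ne_zero p lam)
      (spectralPoint_ne_zero p a) fun h => hlam.1 (hp.spectralPoint_injective h)
    have hY := isTri_heckeElt p hnu
    set Y := heckeElt p (translation nu)
    set c := ∏ j, spectralPoint p a j ^ nu j
    have hB : IsTri (Y - c • 1) fun mu => ∏ j, spectralPoint p mu j ^ nu j - c := by
      intro mu
      convert hY mu using 1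
      simp only [LinearMap.sub_apply, LinearMap.smul_apply, Module.End.one_apply, sub_smul]
      abel
    refine ⟨C * (Y - c • 1), _, hC.mul hB, mul_ne_zero hd (sub_ne_zero.mpr hne), ?_, ?_, ?_⟩
    · intro nu' hnu'
      refine (hcomm nu' hnu').mul_left ?_
      refine (heckeElt_commute p hnu hnu').sub_left ?_
      exact (Commute.one_left _).smul_left c
    · intro mu hmu
      have h1 := hlow mu hmu _ (hB mu)
      rw [map_sub, map_smul, sub_eq_zero] at h1
      rw [Module.End.mul_apply, h1]
      rcases Finset.mem_insert.mp hmu with rfl | hmu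
      · change (c - c) • _ = _
        rw [sub_self, zero_smul]
      · rw [hkill mu hmu, smul_zero]
    · intro f hf
      rw [Module.End.mul_apply, LinearMap.sub_apply, LinearMap.smul_apply, Module.End.one_apply,
        hf nu hnu, ← sub_smul, map_smul, heig f hf, smul_smul, mul_comm]

theorem exists_projector {p : Parameters} (hp : p.IsGeneric n) (lam : Weight n) :
    ∃ (C : Module.End ℂ (Laurent n)) (d : Weight n → ℂ), IsTri C d ∧ d lam ≠ 0 ∧
      (∀ nu, IsDominant nu → Commute C (heckeElt p (translation nu))) ∧
      (∀ f ∈ lowSpan lam, C f = 0) ∧ ∀ f, IsJointEigen p lam f → C f = d lam • f := by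
  obtain ⟨C, d, h1, h2, h3, h4, h5⟩ := exists_annihilator hp lam
    (finite_setOf_ordLT lam).toFinset
    (fun m hm mu hmu => by
      rw [Set.Finite.mem_toFinset] at *
      exact OrdLT.trans hmu hm)
    (fun h => OrdLT.irrefl lam (by simpa using h))
  refine ⟨C, d, h1, h2, h3, fun f hf => ?_, h5⟩
  have hle : lowSpan lam ≤ LinearMap.ker C := by
    refine Submodule.span_le.mpr ?_
    rintro _ ⟨mu, hmu, rfl⟩
    exact h4 mu (by simpa using hmu)
  exact hle hf

theorem exists_isJointEigen {p : Parameters} (hp : p.IsGeneric n) (lam : Weight n) :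
    ∃ f, f - mono lam ∈ lowSpan lam ∧ IsJointEigen p lam f := by
  obtain ⟨C, d, hC, hd, hcomm, hlow, -⟩ := exists_projector hp lam
  refine ⟨(d lam)⁻¹ • C (mono lam), ?_, fun nu hnu => ?_⟩
  · convert Submodule.smul_mem _ (d lam)⁻¹ (hC lam) using 1
    rw [smul_sub, smul_smul, inv_mul_cancel₀ hd, one_smul]
  · have h1 := hlow _ (isTri_heckeElt p hnu lam)
    rw [map_sub, map_smul, sub_eq_zero] at h1
    rw [map_smul, ← Module.End.mul_apply, ← (hcomm nu hnu).eq, Module.End.mul_apply, h1,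
      smul_comm]

theorem IsJointEigen.unique {p : Parameters} (hp : p.IsGeneric n) {lam : Weight n}
    {f g : Laurent n} (hf : f - mono lam ∈ lowSpan lam) (hg : g - mono lam ∈ lowSpan lam)
    (hfe : IsJointEigen p lam f) (hge : IsJointEigen p lam g) : f = g := by
  obtain ⟨C, d, -, hd, -, hlow, heig⟩ := exists_projector hp lam
  have h1 := hlow _ (Submodule.sub_mem _ hf hg)
  rw [sub_sub_sub_cancel_right, map_sub, heig f hfe, heig g hge, ← smul_sub, smul_eq_zero] at h1
  exact sub_eq_zero.mp (h1.resolve_left hd)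

theorem IsJointEigen.yOp_apply {p : Parameters} {lam : Weight n} {f : Laurent n}
    (hf : IsJointEigen p lam f) (nu : Weight n) :
    yOp p nu f = (∏ j, spectralPoint p lam j ^ nu j) • f := by
  have h0 := spectralPoint_ne_zero p lam
  have hc : ∏ j, spectralPoint p lam j ^ domShift nu j ≠ 0 :=
    Finset.prod_ne_zero_iff.mpr fun j _ => zpow_ne_zero _ (h0 j)
  have h1 : Ring.inverse (heckeElt p (translation (domShift nu))) f =
      (∏ j, spectralPoint p lam j ^ domShift nu j)⁻¹ • f := by
    rw [eq_inv_smul_iff₀ hc, ← map_smul, ← hf _ (domShift_isDominant nu), ← Module.End.mul_apply,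
      Ring.inverse_mul_cancel _ (isUnit_heckeElt p (domShift_isDominant nu)),
      Module.End.one_apply]
  rw [yOp, Module.End.mul_apply, h1, map_smul, hf _ (add_domShift_isDominant nu), smul_smul]
  congr 1
  rw [inv_mul_eq_iff_eq_mul₀ hc, ← Finset.prod_mul_distrib]
  refine Finset.prod_congr rfl fun j _ => ?_
  rw [Pi.add_apply, zpow_add₀ (h0 j), mul_comm]

theorem IsJointEigen.evalY_apply {p : Parameters} {lam : Weight n} {f : Laurent n}
    (hf : IsJointEigen p lam f) (g : Laurent n) :
    evalY p g f = evalAt (spectralPoint p lam) g • f := by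
  rw [evalY, evalAt, Finsupp.sum, Finsupp.sum, LinearMap.sum_apply, Finset.sum_smul]
  refine Finset.sum_congr rfl fun nu _ => ?_
  rw [LinearMap.smul_apply, hf.yOp_apply, smul_smul]

theorem isJointEigen_of_evalY {p : Parameters} {lam : Weight n} {f : Laurent n}
    (h : ∀ g, evalY p g f = evalAt (spectralPoint p lam) g • f) : IsJointEigen p lam f := by
  intro nu hnu
  have h1 := h (mono nu)
  rw [evalY, evalAt, mono, AddMonoidAlgebra.coeff_single, Finsupp.sum_single_index (by simp),
    Finsupp.sum_single_index (by simp), one_smul, one_mul, yOp_of_isDominant p hnu] at h1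
  exact h1
end
end Koornwinder

theorem mainTheorem7 (n : ℕ) (hn : 2 ≤ n) (p : Koornwinder.Parameters) (hp : p.IsGeneric n) :
    ∃! P : Module.Basis (Koornwinder.Weight n) ℂ (Koornwinder.Laurent n),
      ∀ lam : Koornwinder.Weight n,
        (P lam - Koornwinder.mono lam ∈
          Submodule.span ℂ {f : Koornwinder.Laurent n |
            ∃ mu : Koornwinder.Weight n, Koornwinder.OrdLT mu lam ∧ f = Koornwinder.mono mu}) ∧
        ∀ f : Koornwinder.Laurent n,
          Koornwinder.evalY p f (P lam) =
            Koornwinder.evalAt (Koornwinder.spectralPoint p lam) f • P lam := by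
  have : Fact (2 ≤ n) := ⟨hn⟩
  choose P hP hE using Koornwinder.exists_isJointEigen hp
  refine ⟨Module.Basis.mk (Koornwinder.linearIndependent_of_sub_mem_lowSpan hP)
    (Koornwinder.span_eq_top_of_sub_mem_lowSpan hP), fun lam => ?_, fun Q hQ => ?_⟩
  · rw [Module.Basis.mk_apply]
    exact ⟨hP lam, (hE lam).evalY_apply⟩
  · refine Module.Basis.eq_of_apply_eq fun lam => ?_
    rw [Module.Basis.mk_apply]
    exact Koornwinder.IsJointEigen.unique hp (hQ lam).1 (hP lam)
      (Koornwinder.isJointEigen_of_evalY (hQ lam).2) (hE lam)
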